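/- \textbf{Theorem (modified Boneh--Boyen HIBE).} Let $n$ be the security parameter. Algorithms are uniform, and PPT means probabilistic polynomial time. \emph{Groups.} A generator of three-leveled multilinear groups is a PPT algorithm $\mathcal G$ that on input $1^n$ outputs, except with negligible probability, the description $GDS$ of groups $\mathbb G_1,\mathbb G_2,\mathbb G_3$ of prime order $p>2^n$ with generators $g_1,g_2,g_3$ and maps $e_{i,j}:\mathbb G_i\times\mathbb G_j\to\mathbb G_{i+j}$ ($i,j\ge1$, $i+j\le3$) satisfying $e_{i,j}(g_i^a,g_j^b)=g_{i+j}^{ab}$; group elements have unique representations of length polynomial in $n$, and the group operations and the maps $e_{i,j}$ are computable in polynomial time. \emph{Assumption.} For a function $N=N(n)$, the $(3,N)$-MDHE assumption for $\mathcal G$ says that for every PPT algorithm $\mathcal B$ the quantity $|\Pr[\mathcal B(D,Z_0)=0]-\Pr[\mathcal B(D,Z_1)=0]|$ is negligible in $n$, where $a,b,c\in\mathbb Z_p$ are uniform, $D$ consists of $GDS$ and $g_1,g_1^{a},\dots,g_1^{a^N},g_1^{a^{N+2}},\dots,g_1^{a^{2N}},g_1^b,g_1^c$, $Z_0=g_3^{a^{N+1}bc}$,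 and $Z_1\in\mathbb G_3$ is uniform. \emph{Scheme.} Let $l_1=2n$, $l_2=n$, and let $H:\{0,1\}^*\to\{0,1\}^{l_1}$ (one function for each $n$) be a polynomial-time computable hash function. Let $L=L(n)$ be the maximum depth. Identities are $ID=(I_1,\dots,I_\ell)$ with $1\le\ell\le L$, $I_i\in\{0,1\}^{l_1}$; time periods are $T\in\{0,1\}^{l_2}$; put $CI_i=H(I_1\|\cdots\|I_i)$. \begin{itemize} \item \textbf{Setup} chooses uniform $f_{1,i,0},f_{1,i,j,\beta},h_{1,0},h_{1,j,\beta}\in\mathbb G_1$ and $\alpha\in\mathbb Z_p$. The master key is $\alpha$ and the public parameters $PP$ are $GDS$, these elements of $\mathbb G_1$, and $\Lambda=g_3^\alpha$. Put $f_{2,i,0}=e_{1,1}(f_{1,i,0},g_1)$ and likewise for the others, $F_{k,i}(x)=f_{k,i,0}\prod_{j=1}^{l_1}f_{k,i,j,x[j]}$ and $H_k(T)=h_{k,0}\prod_{j=1}^{l_2}h_{k,j,T[j]}$ for $k=1,2$. \item \textbf{GenKey} for $(ID,T)$ chooses uniform $r_1,\dots,r_\ell,r_{L+1}\in\mathbb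 Z_p$ and outputs $D_0=g_2^\alpha\prod_{i=1}^{\ell}F_{2,i}(CI_i)^{r_i}\cdot H_2(T)^{r_{L+1}}$, $D_i=g_2^{-r_i}$ $(1\le i\le\ell)$, $D_{L+1}=g_2^{-r_{L+1}}$. \item \textbf{Encrypt} for $(ID,T)$ with exponent $s\in\mathbb Z_p$ outputs the header $C_0=g_1^s$, $C_i=F_{1,i}(CI_i)^s$ $(1\le i\le\ell)$, $C_{L+1}=H_1(T)^s$ and the session key $EK=\Lambda^s$. \end{itemize} (RandKey, Delegate and Decrypt are the usual algorithms of this scheme and play no role in the security experiment.) \emph{Security.} In the selective chosen-plaintext experiment a PPT adversary $\mathcal A$, given $1^n$, submits a challenge identity $ID^*$ and time $T^*$; then $\mathcal G$ and Setup are run and $\mathcal A$ receives $PP$; $\mathcal A$ adaptively makes polynomially many private key queries $(ID,T)$, not allowed if $ID$ is a prefix of (or equal to) $ID^*$ and $T=T^*$; it receives the header for $(ID^*,T^*)$ with a uniform exponent $s$ together with a key $EK^*$, which for a uniform bit $\mu$ is the real session key if $\mu=0$ and a uniform element of $\mathbb G_3$ if $\mu=1$; it makes further queries under the same restriction; it outputs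 $\mu'$. The scheme is \emph{selectively secure under chosen-plaintext attacks} if $|\Pr[\mu'=\mu]-\tfrac12|$ is negligible in $n$ for every PPT adversary. \emph{Claim.} Let $\mathcal G$ be such a generator, let $L$ be polynomially bounded and computable in time polynomial in $n$, let $N\ge1$ be polynomially bounded, and suppose that $H$ is collision resistant (every PPT algorithm, on input $1^n$, outputs a collision of $H$ with negligible probability). If the $(3,N)$-MDHE assumption holds for $\mathcal G$, then the above HIBE scheme is selectively secure under chosen-plaintext attacks. -/

import Mathlib

namespace BBHIBE

/-! ### Machine model: programs on finite data, with a step count -/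

/-- Finite data: natural numbers (stored in binary) and ordered pairs. -/
inductive Val where
  | num (n : ℕ) : Val
  | pair (a b : Val) : Val
  deriving DecidableEq

namespace Val

/-- Number of symbols needed to write the value down (numbers in binary). -/
def size : Val → ℕ
  | num n => n.size + 1
  | pair a b => a.size + b.size + 1

def toNat : Val → ℕ
  | num n => n
  | pair _ _ => 0

def fst : Val → Val
  | num _ => num 0
  | pair a _ => a

def snd : Val → Val
  | num _ => num 0
  | pair _ b => b

def ofList : List Val → Val
  | [] => num 0
  | a :: l => pair a (ofList l)

def toList : Val → List Val
  | num _ => []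
  | pair a b => a :: b.toList

def ofBool (b : Bool) : Val := num b.toNat

def ofBits (x : List Bool) : Val := ofList (x.map ofBool)

/-- Reads a value as a bit string of length `l` (an entry other than `1`, or a missing entry,
is the bit `0`); `readBits l (ofBits (List.ofFn x)) = x`. -/
def readBits (l : ℕ) (v : Val) : Fin l → Bool :=
  fun j => decide (v.toList[(j : ℕ)]? = some (num 1))

end Val

/-- Elementary operations. -/
inductive Prim where
  | id : Prim
  | fst : Prim
  | snd : Prim
  | const (n : ℕ) : Prim
  | size : Prim
  | add : Prim
  | sub : Prim
  | mul : Prim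
  | div : Prim
  | mod : Prim
  | eq : Prim
  | isPair : Prim

open Val in
def Prim.eval : Prim → Val → Val
  | .id, v => v
  | .fst, v => v.fst
  | .snd, v => v.snd
  | .const n, _ => num n
  | .size, v => num v.size
  | .add, v => num (v.fst.toNat + v.snd.toNat)
  | .sub, v => num (v.fst.toNat - v.snd.toNat)
  | .mul, v => num (v.fst.toNat * v.snd.toNat)
  | .div, v => num (v.fst.toNat / v.snd.toNat)
  | .mod, v => num (v.fst.toNat % v.snd.toNat)
  | .eq, v => ofBool (decide (v.fst = v.snd))
  | .isPair, v => match v with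
    | num _ => num 0
    | pair _ _ => num 1

/-- Deterministic programs: elementary operations, sequential composition, computing a pair,
branching (`num 0` is "false") and counted loops. -/
inductive Prog where
  | prim (o : Prim) : Prog
  | seq (f g : Prog) : Prog
  | fork (f g : Prog) : Prog
  | branch (c f g : Prog) : Prog
  | loop (f : Prog) : Prog

/-- `P.run v` is the output of `P` on input `v`, together with its running time. The cost is
logarithmic: an elementary operation is charged the full length of its input and output, and
`loop f`, on input `(m, x)`, is charged for each of the `m` applications of `f`. Thus running
times agree up to a polynomial with those of Turing machines (a polynomial-time machine is
simulated with a loop over a clock computed from the input length). -/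
def Prog.run : Prog → Val → Val × ℕ
  | .prim o, v => (o.eval v, 1 + v.size + (o.eval v).size)
  | .seq f g, v => ((g.run (f.run v).1).1, 1 + (f.run v).2 + (g.run (f.run v).1).2)
  | .fork f g, v => (.pair (f.run v).1 (g.run v).1, 1 + v.size + (f.run v).2 + (g.run v).2)
  | .branch c f g, v =>
      if (c.run v).1 = .num 0 then ((g.run v).1, 1 + v.size + (c.run v).2 + (g.run v).2)
      else ((f.run v).1, 1 + v.size + (c.run v).2 + (f.run v).2)
  | .loop f, v =>
      (fun w : Val × ℕ => ((f.run w.1).1, w.2 + (f.run w.1).2))^[v.fst.toNat]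
        (v.snd, 1 + v.size)

/-- Time polynomial in the security parameter `n` and the length of the remaining input `x`.
(The security parameter counts with its value, i.e. as if written in unary.) -/
def PolyTime (P : Prog) : Prop :=
  ∃ q : Polynomial ℕ, ∀ (n : ℕ) (x : Val), (P.run (.pair (.num n) x)).2 ≤ q.eval (n + x.size)

/-- A probabilistic polynomial-time algorithm: on security parameter `n` and input `x` it tosses
`coins n` fair coins, a polynomial number, and runs a polynomial-time program on `n`, the outcome
`ρ` of the coins (read as a binary number below `2 ^ coins n`) and `x`. -/
structure PPT where
  prog : Prog
  polyTime : PolyTime prog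
  coins : Polynomial ℕ

/-- The output of the algorithm when the coins show `ρ`. -/
def PPT.out (A : PPT) (n ρ : ℕ) (x : Val) : Val :=
  (A.prog.run (.pair (.num n) (.pair (.num ρ) x))).1

/-- The distribution of the coins. -/
noncomputable def PPT.toss (A : PPT) (n : ℕ) : PMF (Fin (2 ^ A.coins.eval n)) :=
  PMF.uniformOfFintype _

noncomputable def PPT.run (A : PPT) (n : ℕ) (x : Val) : PMF Val :=
  (A.toss n).map fun ρ => A.out n ρ x

/-- Negligible functions of the security parameter. -/
def Negligible (f : ℕ → ℝ) : Prop :=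
  Asymptotics.SuperpolynomialDecay Filter.atTop (fun n : ℕ => (n : ℝ)) f

/-- Bounded by a polynomial. -/
def PolyBounded (f : ℕ → ℕ) : Prop :=
  ∃ q : Polynomial ℕ, ∀ n, f n ≤ q.eval n

/-- A function of the security parameter that is computable in time polynomial in it. -/
def PolyComputable (f : ℕ → ℕ) : Prop :=
  ∃ P : Prog, PolyTime P ∧ ∀ n, (P.run (.pair (.num n) (.num 0))).1 = .num (f n)

/-! ### Leveled multilinear maps -/

/-- `k`-leveled multilinear groups: groups `G 1, …, G k` of prime order `p`, with generators `g i`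
and maps `e i j : G i × G j → G (i + j)` for `i, j ≥ 1`, `i + j ≤ k`. (Levels outside `1, …, k`
are present only for notational convenience and are never used. Non-degeneracy
`e (g i) (g j) = g (i + j)` is the case `a = b = 1` of bilinearity.) -/
structure MultilinearGroup (k : ℕ) where
  p : ℕ
  prime : p.Prime
  G : ℕ → Type
  commGroup : ∀ i, CommGroup (G i)
  fintype : ∀ i, Fintype (G i)
  g : ∀ i, G i
  e : ∀ i j, G i → G j → G (i + j)
  card_eq : ∀ i, 1 ≤ i → i ≤ k → Fintype.card (G i) = p
  generates : ∀ i, 1 ≤ i → i ≤ k → ∀ x : G i, x ∈ Subgroup.zpowers (g i)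
  bilinear : ∀ i j, 1 ≤ i → 1 ≤ j → i + j ≤ k → ∀ a b : ℕ,
    e i j (g i ^ a) (g j ^ b) = g (i + j) ^ (a * b)

attribute [instance] MultilinearGroup.commGroup MultilinearGroup.fintype

instance {k : ℕ} (M : MultilinearGroup k) : NeZero M.p := ⟨M.prime.ne_zero⟩

/-- A generator of `k`-leveled multilinear groups with efficiently computable operations. On
security parameter `n` and input `k` the algorithm `gen` outputs, except with negligible
probability (`good n` is the set of proper outputs; for an errorless generator it contains all
outputs), a description `d = (p, (g 1, …, g k), aux)` of a multilinear group `grp d` of order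
`p > 2 ^ n`. The element `x` of level `i` is represented by the value `enc d i x`, of polynomial
length. -/
structure GroupGenerator (k : ℕ) where
  gen : PPT
  grp : Val → MultilinearGroup k
  enc : ∀ (d : Val) (i : ℕ), (grp d).G i → Val
  good : ℕ → Set Val
  good_spec : Negligible fun n => ((gen.run n (.num k)).toOuterMeasure (good n)ᶜ).toReal
  lt_order : ∀ n, ∀ d ∈ good n, 2 ^ n < (grp d).p
  description : ∀ n, ∀ d ∈ good n, ∃ aux : Val,
    d = .pair (.num (grp d).p)
      (.pair (.ofList (List.ofFn fun i : Fin k => enc d (i + 1) ((grp d).g (i + 1)))) aux)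
  enc_injective : ∀ n, ∀ d ∈ good n, ∀ i, 1 ≤ i → i ≤ k → Function.Injective (enc d i)
  enc_size : ∃ q : Polynomial ℕ, ∀ n, ∀ d ∈ good n, ∀ i, 1 ≤ i → i ≤ k →
    ∀ x, (enc d i x).size ≤ q.eval n
  mul_efficient : ∃ P : Prog, PolyTime P ∧ ∀ n, ∀ d ∈ good n,
    ∀ i, 1 ≤ i → i ≤ k → ∀ x y,
      (P.run (.pair (.num n) (.ofList [d, .num i, enc d i x, enc d i y]))).1 = enc d i (x * y)
  map_efficient : ∃ P : Prog, PolyTime P ∧ ∀ n, ∀ d ∈ good n,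
    ∀ i j, 1 ≤ i → 1 ≤ j → i + j ≤ k → ∀ x y,
      (P.run (.pair (.num n) (.ofList [d, .num i, .num j, enc d i x, enc d j y]))).1
        = enc d (i + j) ((grp d).e i j x y)

/-- The distribution of the group description. -/
noncomputable def GroupGenerator.sample {k : ℕ} (𝒢 : GroupGenerator k) (n : ℕ) : PMF Val :=
  𝒢.gen.run n (.num k)

/-! ### The three-leveled multilinear Diffie–Hellman exponent assumption -/

/-- The tuple `(D, Z)` handed to a distinguisher, with
`D = (g₁, g₁^a, …, g₁^(a^N), g₁^(a^(N+2)), …, g₁^(a^(2N)), g₁^b, g₁^c)`, preceded by the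
description `d` of the group. -/
noncomputable def mdheInstance (𝒢 : GroupGenerator 3) (N : ℕ) (d : Val)
    (a b c : ZMod (𝒢.grp d).p) (Z : (𝒢.grp d).G 3) : Val :=
  let M := 𝒢.grp d
  let pw : ZMod M.p → Val := fun x => 𝒢.enc d 1 (M.g 1 ^ x.val)
  .ofList [d,
    .ofList ((List.range (N + 1)).map fun i => pw (a ^ i)),
    .ofList ((List.range (N - 1)).map fun i => pw (a ^ (N + 2 + i))),
    pw b, pw c, 𝒢.enc d 3 Z]

/-- The output of the distinguisher `B` on a challenge whose last component is
`Z₀ = g₃^(a^(N+1) b c)` if `real`, and a uniformly random element `Z₁` of `G₃` otherwise. -/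
noncomputable def mdheExperiment (𝒢 : GroupGenerator 3) (N : ℕ) (B : PPT) (n : ℕ) (real : Bool) :
    PMF Val := do
  let d ← 𝒢.sample n
  let a ← PMF.uniformOfFintype (ZMod (𝒢.grp d).p)
  let b ← PMF.uniformOfFintype (ZMod (𝒢.grp d).p)
  let c ← PMF.uniformOfFintype (ZMod (𝒢.grp d).p)
  let Z₁ ← PMF.uniformOfFintype ((𝒢.grp d).G 3)
  let Z₀ := (𝒢.grp d).g 3 ^ (a ^ (N + 1) * b * c).val
  B.run n (mdheInstance 𝒢 N d a b c (if real then Z₀ else Z₁))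

noncomputable def mdheAdvantage (𝒢 : GroupGenerator 3) (N : ℕ) (B : PPT) (n : ℕ) : ℝ :=
  |(mdheExperiment 𝒢 N B n true (.num 0)).toReal - (mdheExperiment 𝒢 N B n false (.num 0)).toReal|

/-- The decisional `(3, N)`-MDHE assumption, `N` being a function of the security parameter. -/
def MDHEAssumption (𝒢 : GroupGenerator 3) (N : ℕ → ℕ) : Prop :=
  ∀ B : PPT, Negligible fun n => mdheAdvantage 𝒢 (N n) B n

/-! ### Collision-resistant hash functions -/

/-- An efficiently computable hash function `{0,1}^* → {0,1}^(2n)` for each security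
parameter `n`. -/
structure HashFunction where
  eval : ∀ n : ℕ, List Bool → (Fin (2 * n) → Bool)
  efficient : ∃ P : Prog, PolyTime P ∧ ∀ (n : ℕ) (x : List Bool),
    (P.run (.pair (.num n) (.ofBits x))).1 = .ofBits (List.ofFn (eval n x))

/-- The value encodes a collision of the hash function. -/
def HashFunction.IsCollision (H : HashFunction) (n : ℕ) (v : Val) : Prop :=
  ∃ x y : List Bool, v = .pair (.ofBits x) (.ofBits y) ∧ x ≠ y ∧ H.eval n x = H.eval n y

/-- Every probabilistic polynomial-time algorithm finds a collision with negligible probability. -/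
def HashFunction.CollisionResistant (H : HashFunction) : Prop :=
  ∀ C : PPT, Negligible fun n =>
    ((C.run n (.num 0)).toOuterMeasure {v | H.IsCollision n v}).toReal

/-! ### The modified Boneh–Boyen HIBE (KEM version) -/

/-- Hierarchical identities `(I_1, …, I_ℓ)`, `1 ≤ ℓ ≤ L`, with `I_i ∈ {0,1}^l`. -/
structure HierID (l L : ℕ) where
  toList : List (Fin l → Bool)
  ne_nil : toList ≠ []
  length_le : toList.length ≤ L

abbrev HierID.depth {l L : ℕ} (ID : HierID l L) : ℕ := ID.toList.length

/-- The level `i ≤ ℓ` as a level of the hierarchy. -/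
abbrev HierID.level {l L : ℕ} (ID : HierID l L) (i : Fin ID.depth) : Fin L :=
  Fin.castLE ID.length_le i

/-- `EncodeCID`: `CI_j = H(I_1 ‖ ⋯ ‖ I_j)`. -/
def HierID.encodeCID {l L : ℕ} (H : List Bool → (Fin l → Bool)) (ID : HierID l L) :
    Fin ID.depth → (Fin l → Bool) :=
  fun i => H ((ID.toList.take (i + 1)).flatMap List.ofFn)

section Scheme

variable (M : MultilinearGroup 3) (l₁ l₂ L : ℕ)

/-- The part `(f_{1,i}, h_1, Λ)` of the public parameters that accompanies the group
description; `f i j b` and `h j b` are `f_{1,i,j,b}` and `h_{1,j,b}`. -/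
structure PublicParams where
  f0 : Fin L → M.G 1
  f : Fin L → Fin l₁ → Bool → M.G 1
  h0 : M.G 1
  h : Fin l₂ → Bool → M.G 1
  Lam : M.G 3

/-- A private key `(D_0, D_1, …, D_ℓ, D_{L+1}) ∈ G₂^(ℓ+2)`. -/
structure PrivateKey (ℓ : ℕ) where
  D0 : M.G 2
  D : Fin ℓ → M.G 2
  Dlast : M.G 2

/-- A ciphertext header `(C_0, C_1, …, C_ℓ, C_{L+1}) ∈ G₁^(ℓ+2)`. -/
structure Header (ℓ : ℕ) where
  C0 : M.G 1
  C : Fin ℓ → M.G 1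
  Clast : M.G 1

/-- The hash `u_0 ∏_j u_{j, x[j]}` underlying `F` and `H`. -/
def selectProd {X : Type} [CommGroup X] {l : ℕ} (u0 : X) (u : Fin l → Bool → X)
    (x : Fin l → Bool) : X :=
  u0 * ∏ j, u j (x j)

variable {M l₁ l₂ L}

/-- The passage from level one to level two by pairing with `g_1`. -/
def toLevelTwo (x : M.G 1) : M.G 2 := M.e 1 1 x (M.g 1)

namespace PublicParams

/-- `F_{1,i}`. -/
def F1 (PP : PublicParams M l₁ l₂ L) (i : Fin L) (CI : Fin l₁ → Bool) : M.G 1 :=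
  selectProd (PP.f0 i) (PP.f i) CI

/-- `F_{2,i}`. -/
def F2 (PP : PublicParams M l₁ l₂ L) (i : Fin L) (CI : Fin l₁ → Bool) : M.G 2 :=
  selectProd (toLevelTwo (PP.f0 i)) (fun j b => toLevelTwo (PP.f i j b)) CI

/-- `H_1`. -/
def H1 (PP : PublicParams M l₁ l₂ L) (T : Fin l₂ → Bool) : M.G 1 :=
  selectProd PP.h0 PP.h T

/-- `H_2`. -/
def H2 (PP : PublicParams M l₁ l₂ L) (T : Fin l₂ → Bool) : M.G 2 :=
  selectProd (toLevelTwo PP.h0) (fun j b => toLevelTwo (PP.h j b)) T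

end PublicParams

variable (M l₁ l₂ L) in
/-- `Setup`: outputs the master key `α` and the public parameters. -/
noncomputable def setup : PMF (ZMod M.p × PublicParams M l₁ l₂ L) := do
  let f0 ← PMF.uniformOfFintype (Fin L → M.G 1)
  let f ← PMF.uniformOfFintype (Fin L → Fin l₁ → Bool → M.G 1)
  let h0 ← PMF.uniformOfFintype (M.G 1)
  let h ← PMF.uniformOfFintype (Fin l₂ → Bool → M.G 1)
  let α ← PMF.uniformOfFintype (ZMod M.p)
  pure (α, ⟨f0, f, h0, h, M.g 3 ^ α.val⟩)

/-- `GenKey`. -/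
noncomputable def genKey (H : List Bool → (Fin l₁ → Bool)) (PP : PublicParams M l₁ l₂ L)
    (α : ZMod M.p) (ID : HierID l₁ L) (T : Fin l₂ → Bool) : PMF (PrivateKey M ID.depth) := do
  let r ← PMF.uniformOfFintype (Fin ID.depth → ZMod M.p)
  let rlast ← PMF.uniformOfFintype (ZMod M.p)
  pure {
    D0 := M.g 2 ^ α.val * (∏ i, PP.F2 (ID.level i) (ID.encodeCID H i) ^ (r i).val)
      * PP.H2 T ^ rlast.val
    D := fun i => (M.g 2 ^ (r i).val)⁻¹
    Dlast := (M.g 2 ^ rlast.val)⁻¹ }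

/-- `RandKey`. -/
noncomputable def randKey (H : List Bool → (Fin l₁ → Bool)) (PP : PublicParams M l₁ l₂ L)
    (ID : HierID l₁ L) (T : Fin l₂ → Bool) (SK : PrivateKey M ID.depth) :
    PMF (PrivateKey M ID.depth) := do
  let r ← PMF.uniformOfFintype (Fin ID.depth → ZMod M.p)
  let rlast ← PMF.uniformOfFintype (ZMod M.p)
  pure {
    D0 := SK.D0 * (∏ i, PP.F2 (ID.level i) (ID.encodeCID H i) ^ (r i).val)
      * PP.H2 T ^ rlast.val
    D := fun i => SK.D i * (M.g 2 ^ (r i).val)⁻¹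
    Dlast := SK.Dlast * (M.g 2 ^ rlast.val)⁻¹ }

/-- `Delegate`, from the key `SK` of the identity `ID|_(ℓ-1)` of depth `ℓ - 1` to `ID`. -/
noncomputable def delegate (H : List Bool → (Fin l₁ → Bool)) (PP : PublicParams M l₁ l₂ L)
    (ID : HierID l₁ L) (T : Fin l₂ → Bool) (SK : PrivateKey M (ID.depth - 1)) :
    PMF (PrivateKey M ID.depth) := do
  let last : Fin ID.depth := ⟨ID.depth - 1, Nat.sub_one_lt (List.length_pos_of_ne_nil ID.ne_nil).ne'⟩
  let r ← PMF.uniformOfFintype (ZMod M.p)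
  randKey H PP ID T {
    D0 := SK.D0 * PP.F2 (ID.level last) (ID.encodeCID H last) ^ r.val
    D := fun i => if hi : (i : ℕ) < ID.depth - 1 then SK.D ⟨i, hi⟩ else (M.g 2 ^ r.val)⁻¹
    Dlast := SK.Dlast }

/-- `Encrypt`, with the exponent `s`: a ciphertext header and a session key. -/
def encrypt (H : List Bool → (Fin l₁ → Bool)) (PP : PublicParams M l₁ l₂ L)
    (ID : HierID l₁ L) (T : Fin l₂ → Bool) (s : ZMod M.p) : Header M ID.depth × M.G 3 :=
  ({ C0 := M.g 1 ^ s.val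
     C := fun i => PP.F1 (ID.level i) (ID.encodeCID H i) ^ s.val
     Clast := PP.H1 T ^ s.val }, PP.Lam ^ s.val)

/-- `Decrypt`, when the identity and the time of the header and of the key agree. -/
def decrypt {ℓ : ℕ} (CH : Header M ℓ) (SK : PrivateKey M ℓ) : M.G 3 :=
  M.e 1 2 CH.C0 SK.D0 * (∏ i, M.e 1 2 (CH.C i) (SK.D i)) * M.e 1 2 CH.Clast SK.Dlast

end Scheme

/-! ### Representation of the objects of the scheme as data -/

section Encoding

variable (𝒢 : GroupGenerator 3) (d : Val) {l₁ l₂ L : ℕ}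

def encParams (PP : PublicParams (𝒢.grp d) l₁ l₂ L) : Val :=
  let enc1 := 𝒢.enc d 1
  .ofList [d,
    .ofList (List.ofFn fun i => .pair (enc1 (PP.f0 i))
      (.ofList (List.ofFn fun j => .pair (enc1 (PP.f i j false)) (enc1 (PP.f i j true))))),
    .pair (enc1 PP.h0)
      (.ofList (List.ofFn fun j => .pair (enc1 (PP.h j false)) (enc1 (PP.h j true)))),
    𝒢.enc d 3 PP.Lam]

def encKey {ℓ : ℕ} (SK : PrivateKey (𝒢.grp d) ℓ) : Val :=
  .ofList [𝒢.enc d 2 SK.D0, .ofList (List.ofFn fun i => 𝒢.enc d 2 (SK.D i)), 𝒢.enc d 2 SK.Dlast]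

def encHeader {ℓ : ℕ} (CH : Header (𝒢.grp d) ℓ) : Val :=
  .ofList [𝒢.enc d 1 CH.C0, .ofList (List.ofFn fun i => 𝒢.enc d 1 (CH.C i)), 𝒢.enc d 1 CH.Clast]

/-- Reads a hierarchical identity, given as the list of its components. -/
def readID (l L : ℕ) (v : Val) : Option (HierID l L) :=
  if h : v.toList ≠ [] ∧ v.toList.length ≤ L then
    some ⟨v.toList.map (Val.readBits l), by simpa using h.1, by simpa using h.2⟩
  else none

end Encoding

/-! ### Selective security of the key encapsulation under chosen-plaintext attacks -/

/-- An interactive probabilistic polynomial-time adversary that makes `q₁ n` private key queries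
before and `q₂ n` after it gets the challenge. It is given by its next-message function: the next
message is computed in polynomial time from the security parameter, the adversary's coins (tossed
once, at the start) and the list of all messages received so far. -/
structure Adversary extends PPT where
  q₁ : Polynomial ℕ
  q₂ : Polynomial ℕ

def Adversary.move (A : Adversary) (n ρ : ℕ) (received : List Val) : Val :=
  A.toPPT.out n ρ (.ofList received)

section Game

variable (𝒢 : GroupGenerator 3) (H : HashFunction) (L : ℕ) (A : Adversary) (n : ℕ)

open Classical in
/-- The answer to a private key query `(ID, T)`, when the challenge is for `(ID', T')`. A query is
refused if `ID` is not a hierarchical identity of depth between `1` and `L`, or if `ID` is a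
prefix of `ID'` and `T = T'`. -/
noncomputable def answer (d : Val) (PP : PublicParams (𝒢.grp d) (2 * n) n L)
    (α : ZMod (𝒢.grp d).p) (ID' : HierID (2 * n) L) (T' : Fin n → Bool) (query : Val) : PMF Val :=
  let T := query.snd.readBits n
  match readID (2 * n) L query.fst with
  | none => pure (.num 0)
  | some ID =>
    if ID.toList <+: ID'.toList ∧ T = T' then pure (.num 0)
    else (genKey (H.eval n) PP α ID T).map (encKey 𝒢 d)

/-- A phase of `m` adaptive queries, starting and ending with a list of received messages. -/
noncomputable def queryPhase (move : List Val → Val) (answer : Val → PMF Val) :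
    ℕ → List Val → PMF (List Val)
  | 0, received => pure received
  | m + 1, received => do
    let a ← answer (move received)
    queryPhase move answer m (received ++ [a])

/-- The experiment from Setup on, for a challenge identity and time already submitted; the result
says whether the adversary guesses `μ`. -/
noncomputable def gameFrom (ρ : ℕ) (ID' : HierID (2 * n) L) (T' : Fin n → Bool) : PMF Bool := do
  let d ← 𝒢.sample n
  let keys ← setup (𝒢.grp d) (2 * n) n L
  let α := keys.1
  let PP := keys.2
  let oracle := answer 𝒢 H L n d PP α ID' T'
  let received₁ ← queryPhase (A.move n ρ) oracle (A.q₁.eval n) [encParams 𝒢 d PP]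
  let μ ← PMF.uniformOfFintype Bool
  let s ← PMF.uniformOfFintype (ZMod (𝒢.grp d).p)
  let EK₁ ← PMF.uniformOfFintype ((𝒢.grp d).G 3)
  let CT := encrypt (H.eval n) PP ID' T' s
  let EK := if μ then EK₁ else CT.2
  let challenge := Val.pair (encHeader 𝒢 d CT.1) (𝒢.enc d 3 EK)
  let received₂ ← queryPhase (A.move n ρ) oracle (A.q₂.eval n) (received₁ ++ [challenge])
  let guess : Bool := decide (A.move n ρ received₂ = .num 1)
  pure (guess == μ)

/-- The experiment. The adversary first submits the challenge identity and time, knowing only the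
security parameter. (If it does not submit an identity of depth between `1` and `L`, then the
experiment stops, with a fair coin as its result.) -/
noncomputable def game : PMF Bool := do
  let ρ ← A.toPPT.toss n
  let target := A.move n ρ []
  match readID (2 * n) L target.fst with
  | none => PMF.uniformOfFintype Bool
  | some ID' => gameFrom 𝒢 H L A n ρ ID' (target.snd.readBits n)

noncomputable def hibeAdvantage : ℝ :=
  |(game 𝒢 H L A n true).toReal - 1 / 2|

end Game

/-- Selective security, under chosen-plaintext attacks, of the modified Boneh–Boyen HIBE over `𝒢`
with hash function `H`, maximum depth `L`, identity components in `{0,1}^(2n)` and time periods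
in `{0,1}^n`. -/
def SelectivelySecure (𝒢 : GroupGenerator 3) (H : HashFunction) (L : ℕ → ℕ) : Prop :=
  ∀ A : Adversary, Negligible fun n => hibeAdvantage 𝒢 H (L n) A n

end BBHIBE

set_option autoImplicit false
namespace BBHIBE

/-! ### Polynomial bounds -/

/-! The proof is a partitioning reduction. From the challenge, the elements `g₁^a`, `g₁^(a^N)`,
`g₁^b`, `g₁^c` and `Z` are used. Put `β = a^N b`; the element `g₂^β` is the pairing of `g₁^(a^N)`
with `g₁^b`. The unknown master key is taken to be `α = a β = a^(N+1) b` and the encryption exponent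
to be `c`. Then `Λ` is the pairing of `g₁^a` with `g₂^β`, and the real session key `Λ^c` is exactly
`Z₀`.

Every parameter in level one is `g₁^(u + δ a)` with a fresh random `u`, which hides `δ ∈ {0, 1}`. In
the rows of the target, `δ` vanishes exactly at the bit values of `CI*_i` and of `T*`. So the hash
of a word in a row has exponent `K + J a` with `K` and `J` known, `J` being the Hamming distance
from the target word; in levels deeper than the target, `J = 1`. On the target itself `J = 0`, and
the header is a list of known powers of `g₁^c`. If `J ≠ 0` in some row of a query, the random
exponent of that row is chosen as `r - β / J`. Since `a β + (K + J a)(r - β / J) = (K + J a) r - K β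
/ J`, the product `a β` cancels, and the key is computable from `g₂`, `g₂^a` and `g₂^β`
(`Sim.key_eq`). Division by `J` is possible modulo `p` because `J ≤ 2n + 1 < p`.

The row used is that of the time period if `T ≠ T*`, and otherwise that of the last component of the
identity. One level is enough, as `CI_ℓ` hashes the whole prefix: if `J` vanishes in both rows, then
two bit strings of equal length, namely `ID` and the first `ℓ` components of `ID*`, have the same
hash. Either they are equal and the query is forbidden, or they form a collision
(`Sim.prefix_of_coeffJ_eq_zero`).

For the probabilities, all random choices are drawn in advance and experiments become averages over
finite types. Hybrid answers have the challenger's distribution and coincide with the simulator's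
unless the query contains a collision (`Sim.map_hybridAnswer`), so the two experiments are identical
until a collision occurs (`Sim.abs_gameIn_sub_le`). The exception `a = 0`, where `a β` is not
uniform, costs `1 / p`. Collisions are charged to an algorithm that runs the same simulation with
exponents of its own. Sampling exponents modulo `p` from coins costs another `2^(-n)`. The sum of
these errors is `Sim.hibeAdvantage_le`.

As algorithms are programs of a concrete machine model, the simulator has to be a program with a
proved time bound. This is done by closure properties of the class `FP` of polynomial-time
functions, above all `FP.iterate` for loops whose state grows by a bounded amount per step. -/

theorem eval_le_eval (q : Polynomial ℕ) {a b : ℕ} (h : a ≤ b) : q.eval a ≤ q.eval b := by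
  induction q using Polynomial.induction_on' with
  | add p r hp hr => simpa using add_le_add hp hr
  | monomial k c => simpa using Nat.mul_le_mul_left c (Nat.pow_le_pow_left h k)

/-- Bounded by a polynomial in the security parameter and the length of the input. -/
def PB (φ : ℕ → Val → ℕ) : Prop :=
  ∃ q : Polynomial ℕ, ∀ n x, φ n x ≤ q.eval (n + x.size)

namespace PB

theorem mono {φ ψ : ℕ → Val → ℕ} (hψ : PB ψ) (h : ∀ n x, φ n x ≤ ψ n x) : PB φ := by
  obtain ⟨q, hq⟩ := hψ
  exact ⟨q, fun n x => (h n x).trans (hq n x)⟩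

theorem const (c : ℕ) : PB fun _ _ => c := ⟨Polynomial.C c, by simp⟩

theorem size : PB fun _ x => x.size := ⟨Polynomial.X, by simp⟩

theorem param : PB fun n _ => n := ⟨Polynomial.X, by simp⟩

theorem add {φ ψ : ℕ → Val → ℕ} (h : PB φ) (h' : PB ψ) : PB fun n x => φ n x + ψ n x := by
  obtain ⟨q, hq⟩ := h
  obtain ⟨r, hr⟩ := h'
  exact ⟨q + r, fun n x => by simpa using add_le_add (hq n x) (hr n x)⟩

theorem mul {φ ψ : ℕ → Val → ℕ} (h : PB φ) (h' : PB ψ) : PB fun n x => φ n x * ψ n x := by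
  obtain ⟨q, hq⟩ := h
  obtain ⟨r, hr⟩ := h'
  exact ⟨q * r, fun n x => by simpa using Nat.mul_le_mul (hq n x) (hr n x)⟩

theorem comp {φ : ℕ → Val → ℕ} {g : ℕ → Val → Val} (h : PB φ)
    (hg : PB fun n x => (g n x).size) : PB fun n x => φ n (g n x) := by
  obtain ⟨q, hq⟩ := h
  obtain ⟨r, hr⟩ := hg
  refine ⟨q.comp (Polynomial.X + r), fun n x => (hq n _).trans ?_⟩
  have := hr n x
  simp only [Polynomial.eval_comp, Polynomial.eval_add, Polynomial.eval_X]
  exact eval_le_eval q (by simp only at this; omega)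

theorem eval (q : Polynomial ℕ) {φ : ℕ → Val → ℕ} (h : PB φ) : PB fun n x => q.eval (φ n x) := by
  obtain ⟨r, hr⟩ := h
  exact ⟨q.comp r, fun n x => by simpa using eval_le_eval q (hr n x)⟩

theorem of_polyBounded {f : ℕ → ℕ} (h : PolyBounded f) : PB fun n _ => f n := by
  obtain ⟨q, hq⟩ := h
  exact ⟨q, fun n x => (hq n).trans (eval_le_eval q (by omega))⟩

end PB

/-! ### Sizes -/

theorem size_le_self (n : ℕ) : n.size ≤ n := Nat.size_le.2 Nat.lt_two_pow_self

theorem size_add_le (a b : ℕ) : (a + b).size ≤ a.size + b.size := by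
  rw [Nat.size_le]
  rcases Nat.eq_zero_or_pos a with rfl | ha
  · simpa using Nat.lt_size_self b
  rcases Nat.eq_zero_or_pos b with rfl | hb
  · simpa using Nat.lt_size_self a
  have h1 := Nat.lt_size_self a
  have h2 := Nat.lt_size_self b
  rw [pow_add]
  nlinarith

theorem size_mul_le (a b : ℕ) : (a * b).size ≤ a.size + b.size := by
  rw [Nat.size_le, pow_add]
  exact Nat.mul_lt_mul'' (Nat.lt_size_self a) (Nat.lt_size_self b)

def Val.isPair : Val → Bool
  | num _ => false
  | pair _ _ => true

namespace Val

@[simp] theorem fst_pair (a b : Val) : (pair a b).fst = a := rfl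
@[simp] theorem snd_pair (a b : Val) : (pair a b).snd = b := rfl
@[simp] theorem fst_num (k : ℕ) : (num k).fst = num 0 := rfl
@[simp] theorem snd_num (k : ℕ) : (num k).snd = num 0 := rfl
@[simp] theorem toNat_num (k : ℕ) : (num k).toNat = k := rfl
@[simp] theorem toNat_pair (a b : Val) : (pair a b).toNat = 0 := rfl
@[simp] theorem isPair_num (k : ℕ) : (num k).isPair = false := rfl
@[simp] theorem isPair_pair (a b : Val) : (pair a b).isPair = true := rfl
@[simp] theorem size_num (k : ℕ) : (num k).size = k.size + 1 := rfl
@[simp] theorem size_pair (a b : Val) : (pair a b).size = a.size + b.size + 1 := rfl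
@[simp] theorem toList_num (k : ℕ) : (num k).toList = [] := rfl
@[simp] theorem toList_pair (a b : Val) : (pair a b).toList = a :: b.toList := rfl
@[simp] theorem ofList_nil : ofList [] = num 0 := rfl
@[simp] theorem ofList_cons (a : Val) (l : List Val) : ofList (a :: l) = pair a (ofList l) := rfl

end Val

theorem Val.size_pos (v : Val) : 0 < v.size := by cases v <;> simp [Val.size]

theorem Val.size_fst_le (v : Val) : v.fst.size ≤ v.size := by
  cases v <;> simp [Val.size, Val.fst]; omega

theorem Val.size_snd_le (v : Val) : v.snd.size ≤ v.size := by
  cases v <;> simp [Val.size, Val.snd]; omega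

theorem Val.size_toNat_le (v : Val) : v.toNat.size ≤ v.size := by
  cases v <;> simp [Val.size, Val.toNat]

/-- Linear growth keeps the cost of a single operation, which includes the length of its output,
linear in its input. Multiplication is covered because bit lengths of factors add up. -/
theorem Prim.size_eval_le (o : Prim) : ∃ c, ∀ v, (o.eval v).size ≤ c + 2 * v.size := by
  have hb : ∀ b : Bool, (Val.ofBool b).size ≤ 2 := by decide
  cases o with
  | const n => exact ⟨n.size + 1, fun v => by simp [Prim.eval]⟩
  | _ =>
    refine ⟨2, fun v => ?_⟩
    have hf := v.size_fst_le
    have hs := v.size_snd_le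
    have h1 := v.fst.size_toNat_le
    have h2 := v.snd.size_toNat_le
    simp only [Prim.eval, Val.size]
    first
      | omega
      | (have := size_add_le v.fst.toNat v.snd.toNat; omega)
      | (have := size_mul_le v.fst.toNat v.snd.toNat; omega)
      | (have := Nat.size_le_size (Nat.sub_le v.fst.toNat v.snd.toNat); omega)
      | (have := Nat.size_le_size (Nat.div_le_self v.fst.toNat v.snd.toNat); omega)
      | (have := Nat.size_le_size (Nat.mod_le v.fst.toNat v.snd.toNat); omega)
      | (have := hb (decide (v.fst = v.snd)); omega)
      | (have := size_le_self v.size; omega)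
      | (cases v <;> simp [Val.size]; done)
      | (cases v with
        | num k => simp only [Val.size, Nat.size_zero]; omega
        | pair a b => simp only [Val.size, Nat.size_one]; omega)

/-- Every operation pays for writing its output, so time bounds are also length bounds. This is what
makes composition of polynomial-time functions polynomial. -/
theorem Prog.size_run_le (P : Prog) : ∀ v, (P.run v).1.size ≤ (P.run v).2 := by
  induction P with
  | prim o => intro v; simp only [Prog.run]; omega
  | seq f g _ hg => intro v; simp only [Prog.run]; have := hg (f.run v).1; omega
  | fork f g hf hg =>
    intro v; simp only [Prog.run, Val.size]; have := hf v; have := hg v; omega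
  | branch c f g _ hf hg =>
    intro v; simp only [Prog.run]; have := hf v; have := hg v; split <;> simp only <;> omega
  | loop f hf =>
    intro v
    simp only [Prog.run]
    cases v.fst.toNat with
    | zero => have := v.size_snd_le; simp only [Function.iterate_zero, id]; omega
    | succ m =>
      rw [Function.iterate_succ_apply']
      simp only
      exact (hf _).trans (Nat.le_add_left _ _)

/-! ### Polynomial-time functions -/

/-- Functions of the security parameter and an input that are computed in polynomial time. -/
def FP (f : ℕ → Val → Val) : Prop :=
  ∃ P : Prog, PolyTime P ∧ ∀ n x, (P.run (.pair (.num n) x)).1 = f n x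

/-- Polynomial-time computable functions with values in `ℕ`. -/
abbrev FN (f : ℕ → Val → ℕ) : Prop := FP fun n x => .num (f n x)

/-- Polynomial-time computable functions with values in `Bool`. -/
abbrev FB (f : ℕ → Val → Bool) : Prop := FP fun n x => .ofBool (f n x)

/-- Polynomial-time computable functions with values in lists. -/
abbrev FL (f : ℕ → Val → List Val) : Prop := FP fun n x => .ofList (f n x)

theorem PolyTime.fp {P : Prog} (h : PolyTime P) : FP fun n x => (P.run (.pair (.num n) x)).1 :=
  ⟨P, h, fun _ _ => rfl⟩

theorem PB.input : PB fun n x => (Val.pair (.num n) x).size :=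
  ((PB.param.add PB.size).add (PB.const 2)).mono fun n x => by
    have := size_le_self n
    simp only [Val.size]; omega

namespace FP

theorem size {f : ℕ → Val → Val} (h : FP f) : PB fun n x => (f n x).size := by
  obtain ⟨P, hP, hf⟩ := h
  refine PB.mono hP fun n x => ?_
  rw [← hf]
  exact P.size_run_le _

theorem congr {f g : ℕ → Val → Val} (h : FP f) (hfg : ∀ n x, f n x = g n x) : FP g := by
  have : f = g := funext fun n => funext (hfg n)
  exact this ▸ h

theorem prim {f : ℕ → Val → Val} (o : Prim) (h : FP f) : FP fun n x => o.eval (f n x) := by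
  have hs := h.size
  obtain ⟨P, hP, hf⟩ := h
  obtain ⟨c, hc⟩ := o.size_eval_le
  refine ⟨.seq P (.prim o), ?_, fun n x => by simp only [Prog.run, hf]⟩
  refine PB.mono (((PB.const (2 + c)).add (PB.mul (PB.const 3) hs)).add hP) fun n x => ?_
  simp only [Prog.run, hf]
  have := hc (f n x)
  omega

theorem pair {f g : ℕ → Val → Val} (hf : FP f) (hg : FP g) :
    FP fun n x => .pair (f n x) (g n x) := by
  obtain ⟨P, hP, hf⟩ := hf
  obtain ⟨Q, hQ, hg⟩ := hg
  refine ⟨.fork P Q, ?_, fun n x => by simp only [Prog.run, hf, hg]⟩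
  refine PB.mono ((((PB.const 1).add PB.input).add hP).add hQ) fun n x => ?_
  simp only [Prog.run]
  omega

theorem param : FN fun n _ => n := by
  refine ⟨.prim .fst, ?_, fun n x => by simp only [Prog.run, Prim.eval, Val.fst]⟩
  refine PB.mono ((PB.const 1).add (PB.mul (PB.const 2) PB.input)) fun n x => ?_
  simp only [Prog.run, Prim.eval, Val.fst, Val.size]
  omega

theorem id : FP fun _ x => x := by
  refine ⟨.prim .snd, ?_, fun n x => by simp only [Prog.run, Prim.eval, Val.snd]⟩
  refine PB.mono ((PB.const 1).add (PB.mul (PB.const 2) PB.input)) fun n x => ?_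
  simp only [Prog.run, Prim.eval, Val.snd, Val.size]
  omega

theorem comp {f g : ℕ → Val → Val} (hf : FP f) (hg : FP g) : FP fun n x => f n (g n x) := by
  obtain ⟨R, hR, hr⟩ := param.pair hg
  have hs := hg.size
  obtain ⟨P, hP, hf⟩ := hf
  refine ⟨.seq R P, ?_, fun n x => by simp only [Prog.run, hr, hf]⟩
  refine PB.mono (((PB.const 1).add hR).add (PB.comp hP hs)) fun n x => ?_
  simp only [Prog.run, hr]
  omega

theorem fst {f : ℕ → Val → Val} (h : FP f) : FP fun n x => (f n x).fst := h.prim .fst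

theorem snd {f : ℕ → Val → Val} (h : FP f) : FP fun n x => (f n x).snd := h.prim .snd

theorem num (c : ℕ) : FN fun _ _ => c := id.prim (.const c)

theorem sizeNum {f : ℕ → Val → Val} (h : FP f) : FN fun n x => (f n x).size := h.prim .size

theorem add {f g : ℕ → Val → ℕ} (hf : FN f) (hg : FN g) : FN fun n x => f n x + g n x :=
  (hf.pair hg).prim .add

theorem sub {f g : ℕ → Val → ℕ} (hf : FN f) (hg : FN g) : FN fun n x => f n x - g n x :=
  (hf.pair hg).prim .sub

theorem mul {f g : ℕ → Val → ℕ} (hf : FN f) (hg : FN g) : FN fun n x => f n x * g n x :=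
  (hf.pair hg).prim .mul

theorem div {f g : ℕ → Val → ℕ} (hf : FN f) (hg : FN g) : FN fun n x => f n x / g n x :=
  (hf.pair hg).prim .div

theorem mod {f g : ℕ → Val → ℕ} (hf : FN f) (hg : FN g) : FN fun n x => f n x % g n x :=
  (hf.pair hg).prim .mod

theorem eq {f g : ℕ → Val → Val} (hf : FP f) (hg : FP g) :
    FB fun n x => decide (f n x = g n x) :=
  (hf.pair hg).prim .eq

theorem toNat {f : ℕ → Val → Val} (h : FP f) : FN fun n x => (f n x).toNat :=
  (h.pair (num 0)).prim .add

theorem eqNat {f g : ℕ → Val → ℕ} (hf : FN f) (hg : FN g) :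
    FB fun n x => decide (f n x = g n x) :=
  (hf.eq hg).congr fun n x => by simp

theorem leNat {f g : ℕ → Val → ℕ} (hf : FN f) (hg : FN g) :
    FB fun n x => decide (f n x ≤ g n x) :=
  ((hf.sub hg).eqNat (num 0)).congr fun n x => by simp [Nat.sub_eq_zero_iff_le]

theorem ltNat {f g : ℕ → Val → ℕ} (hf : FN f) (hg : FN g) :
    FB fun n x => decide (f n x < g n x) :=
  ((hf.add (num 1)).leNat hg).congr fun _ _ => rfl

theorem cond {c : ℕ → Val → Bool} {f g : ℕ → Val → Val} (hc : FB c) (hf : FP f) (hg : FP g) :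
    FP fun n x => bif c n x then f n x else g n x := by
  obtain ⟨R, hR, hc⟩ := hc
  obtain ⟨P, hP, hf⟩ := hf
  obtain ⟨Q, hQ, hg⟩ := hg
  have key : ∀ n x, (Prog.branch R P Q).run (.pair (.num n) x) =
      bif c n x then (f n x, 1 + (Val.pair (.num n) x).size + (R.run (.pair (.num n) x)).2
        + (P.run (.pair (.num n) x)).2)
      else (g n x, 1 + (Val.pair (.num n) x).size + (R.run (.pair (.num n) x)).2
        + (Q.run (.pair (.num n) x)).2) := by
    intro n x
    simp only [Prog.run, hc]
    cases c n x <;> simp [Val.ofBool, hf, hg]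
  refine ⟨.branch R P Q, ?_, fun n x => by simp only [key]; cases c n x <;> rfl⟩
  refine PB.mono (((((PB.const 1).add PB.input).add hR).add hP).add hQ) fun n x => ?_
  rw [key]
  cases c n x <;> simp only [cond_true, cond_false] <;> omega

theorem ite {c : ℕ → Val → Prop} [∀ n x, Decidable (c n x)] {f g : ℕ → Val → Val}
    (hc : FB fun n x => decide (c n x)) (hf : FP f) (hg : FP g) :
    FP fun n x => if c n x then f n x else g n x :=
  (hc.cond hf hg).congr fun n x => by by_cases h : c n x <;> simp [h]

theorem iteNat {c : ℕ → Val → Prop} [∀ n x, Decidable (c n x)] {f g : ℕ → Val → ℕ}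
    (hc : FB fun n x => decide (c n x)) (hf : FN f) (hg : FN g) :
    FN fun n x => if c n x then f n x else g n x :=
  (hc.ite hf hg).congr fun n x => by by_cases h : c n x <;> simp [h]

theorem and {b c : ℕ → Val → Prop} [∀ n x, Decidable (b n x)] [∀ n x, Decidable (c n x)]
    (hb : FB fun n x => decide (b n x)) (hc : FB fun n x => decide (c n x)) :
    FB fun n x => decide (b n x ∧ c n x) :=
  (hb.cond hc (num 0)).congr fun n x => by by_cases h : b n x <;> simp [h, Val.ofBool]

theorem eqBool {b c : ℕ → Val → Bool} (hb : FB b) (hc : FB c) :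
    FB fun n x => decide (b n x = c n x) :=
  (hb.eq hc).congr fun n x => by
    beta_reduce; congr 1; generalize b n x = u; generalize c n x = v
    cases u <;> cases v <;> simp [Val.ofBool]

theorem ofBoolNat {b : ℕ → Val → Bool} (hb : FB b) : FN fun n x => (b n x).toNat := hb

theorem min {f g : ℕ → Val → ℕ} (hf : FN f) (hg : FN g) : FN fun n x => Min.min (f n x) (g n x) :=
  ((hf.leNat hg).iteNat hf hg).congr fun n x => by simp only [min_def]

theorem isPair {f : ℕ → Val → Val} (h : FP f) :
    FB fun n x => (f n x).isPair :=
  (h.prim .isPair).congr fun n x => by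
    beta_reduce; generalize f n x = v; cases v <;> simp [Prim.eval, Val.ofBool, Val.isPair]

theorem _root_.BBHIBE.Prog.iterate_run (P : Prog) (v : Val) (m : ℕ) (s : ℕ → Val) (c C : ℕ) (h0 : s 0 = v)
    (hs : ∀ i < m, (P.run (s i)).1 = s (i + 1)) (hc : ∀ i < m, (P.run (s i)).2 ≤ C) :
    ((fun w : Val × ℕ => ((P.run w.1).1, w.2 + (P.run w.1).2))^[m] (v, c)).1 = s m ∧
      ((fun w : Val × ℕ => ((P.run w.1).1, w.2 + (P.run w.1).2))^[m] (v, c)).2 ≤ c + m * C := by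
  induction m with
  | zero => simp [h0]
  | succ m ih =>
    obtain ⟨h1, h2⟩ := ih (fun i hi => hs i (by omega)) fun i hi => hc i (by omega)
    rw [Function.iterate_succ_apply']
    simp only [h1]
    refine ⟨hs m (by omega), ?_⟩
    have := hc m (by omega)
    rw [Nat.succ_mul]
    omega

/-- A polynomial number of iterations of a function `g` of the state and of fixed data `e`, when
each application lengthens a state with the invariant `I` by a polynomial in the length of `e` at
most. -/
theorem iterate {g : ℕ → Val → Val → Val} {φ : ℕ → Val → ℕ} {m : ℕ → Val → ℕ} {s e : ℕ → Val → Val}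
    (I : ℕ → Val → Val → Prop) (hg : FP fun n z => g n z.fst z.snd) (hφ : PB φ)
    (hgrow : ∀ n s e, I n e s → I n e (g n s e) ∧ (g n s e).size ≤ s.size + φ n e)
    (hI : ∀ n x, I n (e n x) (s n x))
    (hm : FN m) (hmb : PB m) (hs : FP s) (he : FP e) :
    FP fun n x => (fun t => g n t (e n x))^[m n x] (s n x) := by
  -- The loop passes nothing but its state from one round to the next, so the body carries `n` and
  -- the fixed data `e` along: it maps `(n, (s, e))` to `(n, (g s e, e))`.
  obtain ⟨Q, hQ, hq⟩ := param.pair (hg.pair id.snd)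
  have hsz : PB fun n x => (s n x).size := hs.size
  have hez : PB fun n x => (e n x).size := he.size
  obtain ⟨R, hR, hr⟩ := hm.pair (param.pair (hs.pair he))
  set st : ℕ → Val → ℕ → Val := fun n x i => (fun t => g n t (e n x))^[i] (s n x) with hst
  have hsti : ∀ n x i, I n (e n x) (st n x i) ∧
      (st n x i).size ≤ (s n x).size + i * φ n (e n x) := by
    intro n x i
    induction i with
    | zero => simp [hst, hI]
    | succ i ih =>
      have : st n x (i + 1) = g n (st n x i) (e n x) := Function.iterate_succ_apply' _ _ _
      rw [this, Nat.succ_mul]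
      have := hgrow n (st n x i) (e n x) ih.1
      exact ⟨this.1, by omega⟩
  obtain ⟨c, hc⟩ := hQ
  -- A bound, uniform over all rounds, for the input length of the loop body; its running time in
  -- each round is then at most `c.eval (B n x)`.
  set B : ℕ → Val → ℕ := fun n x =>
    n + ((s n x).size + m n x * φ n (e n x) + (e n x).size + 1) with hB
  have hBb : PB B := PB.param.add (((hsz.add (hmb.mul (hφ.comp hez))).add hez).add (PB.const 1))
  have hCb : PB fun n x => c.eval (B n x) := PB.eval c hBb
  have hrun : ∀ n x, ((Prog.loop Q).run (R.run (.pair (.num n) x)).1).1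
        = .pair (.num n) (.pair (st n x (m n x)) (e n x)) ∧
      ((Prog.loop Q).run (R.run (.pair (.num n) x)).1).2 ≤
        (1 + (R.run (.pair (.num n) x)).1.size) + m n x * c.eval (B n x) := by
    intro n x
    simp only [Prog.run]
    rw [hr]
    simp only [Val.fst, Val.snd, Val.toNat]
    refine Prog.iterate_run Q _ (m n x) (fun i => .pair (.num n) (.pair (st n x i) (e n x))) _ _ rfl
      (fun i _ => ?_) fun i hi => ?_
    · simp only [hq, Val.fst, Val.snd, hst]
      rw [Function.iterate_succ_apply']
    · refine (hc n _).trans (eval_le_eval c ?_)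
      have h1 := (hsti n x i).2
      have h2 : i * φ n (e n x) ≤ m n x * φ n (e n x) := Nat.mul_le_mul_right _ hi.le
      simp only [Val.size, hB]
      omega
  have hRs : PB fun n x => (R.run (.pair (.num n) x)).1.size :=
    PB.mono hR fun n x => R.size_run_le _
  have hLP : ∃ P : Prog, PolyTime P ∧ ∀ n x, (P.run (.pair (.num n) x)).1
      = .pair (.num n) (.pair (st n x (m n x)) (e n x)) := by
    refine ⟨.seq R (.loop Q), ?_, fun n x => (hrun n x).1⟩
    refine PB.mono (((PB.const 1).add hR).add (((PB.const 1).add hRs).add (hmb.mul hCb)))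
      fun n x => ?_
    rw [Prog.run]
    have := (hrun n x).2
    simp only at this ⊢
    omega
  obtain ⟨P, hP, hp⟩ := hLP
  have : FP fun n x => .pair (.num n) (.pair (st n x (m n x)) (e n x)) := ⟨P, hP, hp⟩
  exact this.snd.fst

end FP

/-! ### Lists -/

namespace Val

@[simp] theorem toList_ofList (l : List Val) : (ofList l).toList = l := by
  induction l with
  | nil => rfl
  | cons a l ih => simp [ofList, ih]

theorem ofList_injective : Function.Injective ofList :=
  Function.LeftInverse.injective toList_ofList

theorem ofBits_injective : Function.Injective ofBits := by
  intro x y h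
  refine List.map_injective_iff.2 ?_ (ofList_injective h)
  intro a b; cases a <;> cases b <;> simp [ofBool]

theorem length_toList_le (v : Val) : v.toList.length ≤ v.size := by
  induction v with
  | num n => simp [toList]
  | pair a b _ ih => simp only [toList, List.length_cons, size]; omega

theorem size_ofList_append (l l' : List Val) :
    (ofList (l ++ l')).size + 1 = (ofList l).size + (ofList l').size := by
  induction l with
  | nil => simp [ofList]; omega
  | cons a l ih => simp only [List.cons_append, ofList, size]; omega

theorem size_ofList_le (l : List Val) (c : ℕ) (h : ∀ v ∈ l, v.size ≤ c) :
    (ofList l).size ≤ l.length * (c + 1) + 1 := by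
  induction l with
  | nil => simp [ofList]
  | cons a l ih =>
    have h1 := ih fun v hv => h v (by simp [hv])
    have h2 := h a (by simp)
    simp only [List.length_cons, ofList, size, Nat.succ_mul]
    omega

theorem size_ofList_toList_le (v : Val) : (ofList v.toList).size ≤ v.size := by
  induction v with
  | num k => simp
  | pair a b _ ih => simp only [toList_pair, ofList_cons, size_pair]; omega

/-- The entry at position `i` of a list. -/
def nth (v : Val) (i : ℕ) : Val := (Val.snd^[i] v).fst

theorem nth_eq (v : Val) (i : ℕ) : v.nth i = v.toList.getD i (num 0) := by
  induction i generalizing v with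
  | zero => cases v <;> rfl
  | succ i ih =>
    have : v.nth (i + 1) = v.snd.nth i := rfl
    rw [this, ih]
    cases v <;> simp [snd, toList]

@[simp] theorem nth_ofList (l : List Val) (i : ℕ) : (ofList l).nth i = l.getD i (num 0) := by
  rw [nth_eq, toList_ofList]

theorem nth_min_size (v : Val) (i : ℕ) : v.nth (min i v.size) = v.nth i := by
  have := v.length_toList_le
  rw [nth_eq, nth_eq]
  rcases le_total i v.size with h | h
  · rw [min_eq_left h]
  · rw [min_eq_right h, List.getD_eq_default _ _ this, List.getD_eq_default _ _ (this.trans h)]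

end Val

/-- The loop state is the pair of the remaining list and the accumulator. The invariant that the
remaining list is no longer than the original one bounds the entry `y`, and hence the growth, in
terms of the fixed data. The number of rounds is the length in symbols of the list, which is at
least its number of entries; surplus rounds do nothing. -/
theorem FP.foldl {g : ℕ → Val → Val → Val → Val} {φ : ℕ → Val → ℕ} {l s : ℕ → Val → Val}
    (hg : FP fun n z => g n z.fst z.snd.fst z.snd.snd) (hφ : PB φ)
    (hgrow : ∀ n s y x, (g n s y x).size ≤ s.size + φ n (Val.pair y x))
    (hl : FP l) (hs : FP s) :
    FP fun n x => (l n x).toList.foldl (fun s y => g n s y x) (s n x) := by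
  obtain ⟨q, hq⟩ := hφ
  have hstep : FP fun n z =>
      bif z.fst.fst.isPair then Val.pair z.fst.fst.snd (g n z.fst.snd z.fst.fst.fst z.snd.snd)
      else z.fst := by
    have ht := FP.id.fst
    refine FP.cond ht.fst.isPair (ht.fst.snd.pair ?_) ht
    exact hg.comp (ht.snd.pair (ht.fst.fst.pair FP.id.snd.snd))
  have hψ : PB fun n e => q.eval (n + (e.size + e.size + 1)) :=
    PB.eval q (PB.param.add ((PB.size.add PB.size).add (PB.const 1)))
  have key := FP.iterate (g := fun n t e =>
      bif t.fst.isPair then Val.pair t.fst.snd (g n t.snd t.fst.fst e.snd) else t)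
    (φ := fun n e => q.eval (n + (e.size + e.size + 1)))
    (fun _ e t => t.fst.size ≤ e.fst.size) hstep hψ ?_ ?_ hl.sizeNum hl.size (hl.pair hs)
    (hl.pair FP.id)
  · refine key.snd.congr fun n x => ?_
    -- Any number of rounds that exhausts the list gives the fold, since an exhausted list is a
    -- fixed point.
    have hiter : ∀ (m : ℕ) (v a : Val), v.toList.length ≤ m →
        ((fun t => bif t.fst.isPair then Val.pair t.fst.snd (g n t.snd t.fst.fst x) else t)^[m]
          (Val.pair v a)).snd = v.toList.foldl (fun s y => g n s y x) a := by
      intro m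
      induction m with
      | zero => intro v a h; cases v <;> simp_all [Val.toList_num, Val.toList_pair, Val.snd_pair]
      | succ m ih =>
        intro v a h
        rw [Function.iterate_succ_apply]
        cases v with
        | num k =>
          have := ih (Val.num k) a (by simp [Val.toList_num])
          simpa [Val.fst_pair, Val.fst_num, Val.isPair_num, Val.isPair_pair] using this
        | pair b c =>
            simpa [Val.fst_pair, Val.snd_pair, Val.isPair_pair, Val.toList_pair]
              using ih c (g n a b x) (by simpa [Val.toList_pair] using h)
    exact hiter _ _ _ (Val.length_toList_le _)
  · intro n t e h
    cases ht : t.fst with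
    | num k => exact ⟨by simpa [Val.isPair_num, Val.isPair_pair] using h, by simp [Val.isPair_num]⟩
    | pair b c =>
      rw [ht] at h
      cases t with
      | num k => simp [Val.fst_num] at ht
      | pair t1 t2 =>
        simp only [Val.fst_pair] at ht
        subst ht
        simp only [Val.isPair_pair, cond_true, Val.fst_pair, Val.snd_pair]
        refine ⟨by simp only [Val.size_pair] at h ⊢; omega, ?_⟩
        have h1 := (hgrow n t2 b e.snd).trans (Nat.add_le_add_left (hq n _) _)
        have h2 : q.eval (n + (Val.pair b e.snd).size) ≤ q.eval (n + (e.size + e.size + 1)) := by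
          apply eval_le_eval
          have := e.size_snd_le
          have := e.size_fst_le
          simp only [Val.size_pair] at h ⊢
          omega
        simp only [Val.size_pair] at h ⊢
        omega
  · intro n x
    exact le_rfl

/-- The index is a binary number and may be exponentially large, so the number of steps is capped by
the length of the list; beyond its end the entry is `0` anyway. -/
theorem FP.nth {v : ℕ → Val → Val} {i : ℕ → Val → ℕ} (hv : FP v) (hi : FN i) :
    FP fun n x => (v n x).nth (i n x) := by
  have h := FP.iterate (g := fun _ t _ => t.snd) (φ := fun _ _ => 0) (fun _ _ _ => True)
    FP.id.fst.snd (PB.const 0) (fun n s e _ => ⟨trivial, s.size_snd_le⟩) (fun _ _ => trivial)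
    (hi.min hv.sizeNum) (hv.size.mono fun n x => min_le_right _ _) hv FP.id
  exact h.fst.congr fun n x => (v n x).nth_min_size (i n x)

theorem FL.reverse_toList {v : ℕ → Val → Val} (hv : FP v) :
    FL fun n x => (v n x).toList.reverse := by
  have h := FP.foldl (g := fun _ s y _ => Val.pair y s) (φ := fun _ z => z.size)
    (FP.id.snd.fst.pair FP.id.fst) PB.size (fun n s y x => by simp only [Val.size_pair]; omega) hv (FP.num 0)
  refine h.congr fun n x => ?_
  have : ∀ l l' : List Val, l.foldl (fun s y => Val.pair y s) (Val.ofList l')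
      = Val.ofList (l.reverse ++ l') := by
    intro l
    induction l with
    | nil => simp
    | cons a l ih => intro l'; simpa [Val.ofList_nil, Val.ofList_cons] using ih (a :: l')
  simpa [Val.ofList_nil, Val.ofList_cons] using this (v n x).toList []

theorem FL.toList {v : ℕ → Val → Val} (hv : FP v) : FL fun n x => (v n x).toList :=
  (FL.reverse_toList (FL.reverse_toList hv)).congr fun n x => by simp

theorem FL.append {l l' : ℕ → Val → List Val} (h : FL l) (h' : FL l') :
    FL fun n x => l n x ++ l' n x := by
  have h := FP.foldl (g := fun _ s y _ => .pair y s) (φ := fun _ z => z.size)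
    (FP.id.snd.fst.pair FP.id.fst) PB.size (fun n s y x => by simp only [Val.size_pair]; omega)
    (FL.reverse_toList h) h'
  refine h.congr fun n x => ?_
  simp only [Val.toList_ofList, List.foldl_reverse]
  induction l n x with
  | nil => rfl
  | cons a l ih => simp [Val.ofList_cons, ih]

theorem FL.nil : FL fun _ _ => [] := FP.num 0

theorem FL.cons {f : ℕ → Val → Val} {l : ℕ → Val → List Val} (hf : FP f) (hl : FL l) :
    FL fun n x => f n x :: l n x := FP.pair hf hl

theorem FN.length {l : ℕ → Val → List Val} (h : FL l) : FN fun n x => (l n x).length := by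
  have h := FP.foldl (g := fun _ s _ _ => .num (s.toNat + 1)) (φ := fun _ _ => Nat.size 1)
    (FP.id.fst.toNat.add (FP.num 1)) (PB.const _) (fun n s y x => by
      have h1 := size_add_le s.toNat 1
      have h2 := s.size_toNat_le
      cases s <;>
        simp only [Val.size_num, Val.size_pair, Val.toNat_num, Val.toNat_pair, Nat.size_zero] at * <;>
        omega) h (FP.num 0)
  refine h.congr fun n x => ?_
  have : ∀ (l : List Val) k, l.foldl (fun s _ => .num (s.toNat + 1)) (Val.num k)
      = .num (k + l.length) := by
    intro l
    induction l with
    | nil => simp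
    | cons a l ih => intro k; simp only [List.foldl_cons, ih, Val.toNat_num, List.length_cons]; congr 1; omega
  simpa using this (l n x) 0

theorem PB.length {l : ℕ → Val → List Val} (h : FL l) : PB fun n x => (l n x).length :=
  (FP.size h).mono fun n x => by simpa using (Val.ofList (l n x)).length_toList_le

theorem FL.flatMap {l : ℕ → Val → List Val} {g : ℕ → Val → Val → List Val} (hl : FL l)
    (hg : FL fun n z => g n z.fst z.snd) : FL fun n x => (l n x).flatMap fun y => g n y x := by
  have hgs := FP.size hg
  have h := FP.foldl (g := fun n s y x => Val.ofList (s.toList ++ g n y x))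
    (FL.append (FL.toList FP.id.fst) (hg.comp FP.id.snd)) hgs
    (fun n s y x => by
      have h1 := Val.size_ofList_append s.toList (g n y x)
      have := Val.size_ofList_toList_le s
      simp only [Val.fst_pair, Val.snd_pair]
      omega) hl (FP.num 0)
  refine h.congr fun n x => ?_
  have : ∀ l l' : List Val, l.foldl (fun s y => Val.ofList (s.toList ++ g n y x)) (Val.ofList l')
      = Val.ofList (l' ++ l.flatMap fun y => g n y x) := by
    intro l
    induction l with
    | nil => simp
    | cons a l ih => intro l'; simp [ih]
  simpa [Val.ofList_nil, Val.ofList_cons] using this (l n x) []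

theorem FL.map {l : ℕ → Val → List Val} {g : ℕ → Val → Val → Val} (hl : FL l)
    (hg : FP fun n z => g n z.fst z.snd) : FL fun n x => (l n x).map fun y => g n y x :=
  (FL.flatMap (g := fun n y x => [g n y x]) hl (FL.cons hg FL.nil)).congr fun n x => by
    beta_reduce; rw [List.map_eq_flatMap]

/-- The list is built from its end by a counter that runs down from `m`. The invariant that the
counter is no longer than `m` bounds each new entry. -/
theorem FL.range {m : ℕ → Val → ℕ} (hm : FN m) (hb : PB m) :
    FL fun n x => (List.range (m n x)).map Val.num := by
  have h := FP.iterate (e := fun n x => Val.num (m n x)) (φ := fun _ e => e.size + 1)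
    (g := fun _ t _ => Val.pair (Val.num (t.fst.toNat - 1)) (Val.pair (Val.num (t.fst.toNat - 1)) t.snd))
    (fun _ e t => t.isPair ∧ t.fst.size ≤ e.size)
    (by
      have := FP.id.fst.fst.toNat.sub (FP.num 1)
      exact this.pair (this.pair FP.id.fst.snd))
    (PB.size.add (PB.const 1))
    (fun n t e h => by
      cases t with
      | num k => simp [Val.isPair_num] at h
      | pair a b =>
        have h1 := Nat.size_le_size (Nat.sub_le a.toNat 1)
        have h2 := a.size_toNat_le
        have h4 : (a.toNat - 1).size + 1 ≤ a.size := by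
          cases a with
          | num k =>
            simpa [Val.toNat_num, Val.size_num] using
              Nat.size_le_size (Nat.sub_le k 1)
          | pair b c => simp
        have h3 := h.2
        simp only [Val.fst_pair, Val.snd_pair, Val.size_num, Val.size_pair, Val.isPair_pair] at h3 ⊢
        refine ⟨⟨trivial, by omega⟩, by omega⟩)
    (s := fun n x => Val.pair (Val.num (m n x)) (Val.num 0))
    (fun n x => by simp [Val.isPair_pair, Val.fst_pair]) hm hb (hm.pair (FP.num 0)) hm
  refine h.snd.congr fun n x => ?_
  have : ∀ (i k : ℕ) (l : List ℕ), (fun t : Val =>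
      Val.pair (Val.num (t.fst.toNat - 1)) (Val.pair (Val.num (t.fst.toNat - 1)) t.snd))^[i]
        (Val.pair (Val.num (k + i)) (Val.ofList (l.map Val.num)))
      = Val.pair (Val.num k) (Val.ofList (((List.range' k i) ++ l).map Val.num)) := by
    intro i
    induction i with
    | zero => simp
    | succ i ih =>
      intro k l
      rw [Function.iterate_succ_apply]
      have := ih k ((k + i) :: l)
      simp only [List.map_cons, Val.ofList_cons] at this
      simp only [Val.fst_pair, Val.snd_pair, Val.toNat_num, ← Nat.add_assoc, Nat.add_sub_cancel, this,
        List.range'_1_concat, List.append_assoc, List.singleton_append]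
  have := this (m n x) 0 []
  simp only [Nat.zero_add, List.map_nil, Val.ofList_nil, List.append_nil] at this
  simp only [this, List.range_eq_range', Val.snd_pair]

theorem FN.sum {l : ℕ → Val → List ℕ} (h : FL fun n x => (l n x).map .num) :
    FN fun n x => (l n x).sum := by
  have h := FP.foldl (g := fun _ s y _ => .num (s.toNat + y.toNat)) (φ := fun _ z => z.size)
    (FP.id.fst.toNat.add FP.id.snd.fst.toNat) PB.size (fun n s y x => by
      have h1 := size_add_le s.toNat y.toNat
      have h2 := s.size_toNat_le
      have h3 := y.size_toNat_le
      cases s <;>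
        simp only [Val.size_num, Val.size_pair, Val.toNat_num, Val.toNat_pair, Nat.size_zero] at * <;>
        omega) h (FP.num 0)
  refine h.congr fun n x => ?_
  have : ∀ (l : List ℕ) k, (l.map Val.num).foldl (fun s y => .num (s.toNat + y.toNat)) (Val.num k)
      = .num (k + l.sum) := by
    intro l
    induction l with
    | nil => simp
    | cons a l ih =>
      intro k
      simp only [List.map_cons, List.foldl_cons, Val.toNat_num, ih, List.sum_cons]; congr 1; omega
  simpa using this (l n x) 0

/-- Sums over an index range; the index is passed to the summand as a value. -/
theorem FN.sum_range {m : ℕ → Val → ℕ} {g : ℕ → Val → Val → ℕ} (hm : FN m) (hb : PB m)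
    (hg : FN fun n z => g n z.fst z.snd) :
    FN fun n x => ((List.range (m n x)).map fun i => g n (.num i) x).sum :=
  FN.sum ((FL.map (g := fun n i x => .num (g n i x)) (FL.range hm hb) hg).congr
    fun n x => by simp [Function.comp_def])

theorem FL.map_range {m : ℕ → Val → ℕ} {g : ℕ → Val → Val → Val} (hm : FN m) (hb : PB m)
    (hg : FP fun n z => g n z.fst z.snd) :
    FL fun n x => (List.range (m n x)).map fun i => g n (.num i) x :=
  (FL.map (FL.range hm hb) hg).congr fun n x => by simp [Function.comp_def]

theorem FL.take {k : ℕ → Val → ℕ} {l : ℕ → Val → List Val} (hk : FN k) (hl : FL l) :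
    FL fun n x => (l n x).take (k n x) := by
  have h := FL.map_range (g := fun n i x => (Val.ofList (l n x)).nth i.toNat)
    (hk.min (FN.length hl)) ((PB.length hl).mono fun n x => min_le_right _ _)
    ((hl.comp FP.id.snd).nth FP.id.fst.toNat)
  refine h.congr fun n x => ?_
  congr 1
  apply List.ext_getElem
  · simp
  · intro i h1 h2
    simp at h1
    simp [Val.toNat_num, h1]

/-- The first entry other than `0`, if any. -/
def firstNonzero (l : List Val) : Val :=
  l.foldl (fun s y => if s = .num 0 then y else s) (.num 0)

theorem firstNonzero_spec (l : List Val) :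
    (firstNonzero l = .num 0 ∧ ∀ v ∈ l, v = .num 0) ∨ (firstNonzero l ≠ .num 0 ∧ firstNonzero l ∈ l) := by
  have h1 : ∀ (l : List Val) s, s ≠ .num 0 →
      l.foldl (fun s y => if s = Val.num 0 then y else s) s = s := by
    intro l
    induction l with
    | nil => simp
    | cons a l ih => intro s hs; simp [hs, ih]
  unfold firstNonzero
  induction l with
  | nil => simp
  | cons a l ih =>
    by_cases ha : a = .num 0
    · subst ha
      simp only [List.foldl_cons, if_true, List.mem_cons]
      rcases ih with h | h
      · exact Or.inl ⟨h.1, by rintro v (rfl | hv); exacts [rfl, h.2 v hv]⟩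
      · exact Or.inr ⟨h.1, Or.inr h.2⟩
    · right
      simp [h1 l a ha, ha]

theorem FP.firstNonzero {l : ℕ → Val → List Val} (hl : FL l) :
    FP fun n x => firstNonzero (l n x) := by
  have h := FP.foldl (g := fun _ s y _ => if s = .num 0 then y else s) (φ := fun _ z => z.size)
    (FP.ite (FP.id.fst.eq (FP.num 0)) FP.id.snd.fst FP.id.fst) PB.size (fun n s y x => by
      split <;> simp only [Val.size_pair] <;> omega) hl (FP.num 0)
  exact h.congr fun n x => by simp [BBHIBE.firstNonzero]

theorem FN.polynomial (q : Polynomial ℕ) : FN fun n _ => q.eval n := by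
  induction q using Polynomial.induction_on' with
  | add p r hp hr => simpa using hp.add hr
  | monomial k c =>
    induction k with
    | zero => simpa using FP.num c
    | succ k ih => simpa [pow_succ, mul_assoc] using ih.mul FP.param

/-- The exponent is bounded in value, so repeated multiplication will do; each factor lengthens the
product by at most the length of the base. -/
theorem FN.pow {b k : ℕ → Val → ℕ} (hb : FN b) (hk : FN k) (hkb : PB k) :
    FN fun n x => b n x ^ k n x := by
  have h := FP.iterate (g := fun _ s e => .num (s.toNat * e.toNat)) (φ := fun _ e => e.size)
    (fun _ _ _ => True) (FP.id.fst.toNat.mul FP.id.snd.toNat) PB.size (fun n s e _ => by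
      refine ⟨trivial, ?_⟩
      have h1 := size_mul_le s.toNat e.toNat
      have h2 := s.size_toNat_le
      have h3 := e.size_toNat_le
      cases s <;> cases e <;>
        simp only [Val.size_num, Val.size_pair, Val.toNat_num, Val.toNat_pair, Nat.size_zero,
          Nat.mul_zero, Nat.zero_mul] at * <;>
        omega)
    (fun _ _ => trivial) hk hkb (FP.num 1) hb
  refine h.congr fun n x => ?_
  beta_reduce
  induction k n x with
  | zero => simp
  | succ k ih => rw [Function.iterate_succ_apply', ih, pow_succ]; rfl

/-! ### Truncation and fast exponentiation -/

/-- The value itself if its length is at most `B`, and `0` otherwise. -/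
def trunc (B : ℕ) (v : Val) : Val := if v.size ≤ B then v else .num 0

theorem trunc_of_le {B : ℕ} {v : Val} (h : v.size ≤ B) : trunc B v = v := if_pos h

theorem size_trunc_le (B : ℕ) (v : Val) : (trunc B v).size ≤ B + 1 := by
  unfold trunc
  split
  · omega
  · simp

theorem FP.trunc {B : ℕ → Val → ℕ} {f : ℕ → Val → Val} (hB : FN B) (hf : FP f) :
    FP fun n x => trunc (B n x) (f n x) :=
  (hf.sizeNum.leNat hB).ite hf (FP.num 0)

/-- The state `(acc, sq, k)` of fast exponentiation, initially `(b, b, k)`. -/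
def powStep (op : Val → Val → Val) (t : Val) : Val :=
  .pair (if t.snd.snd.toNat % 2 = 1 then op t.fst t.snd.fst else t.fst)
    (.pair (op t.snd.fst t.snd.fst) (.num (t.snd.snd.toNat / 2)))

/-- Computes `b ^ (k + 1)` with respect to the operation `op`. -/
def powSucc (op : Val → Val → Val) (b : Val) (k : ℕ) : Val :=
  ((powStep op)^[k.size] (.pair b (.pair b (.num k)))).fst

/-- Square and multiply preserves `acc * sq ^ k`. As the accumulator starts with the base itself, no
encoding of the unit element is needed, at the price of computing the power `k + 1`. -/
theorem powSucc_eq {X : Type*} [Monoid X] {op : Val → Val → Val} {enc : X → Val}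
    (h : ∀ x y, op (enc x) (enc y) = enc (x * y)) (x : X) (k : ℕ) :
    powSucc op (enc x) k = enc (x ^ (k + 1)) := by
  have : ∀ (i k : ℕ) (x y : X), k < 2 ^ i → ((powStep op)^[i] (.pair (enc y) (.pair (enc x) (.num k)))).fst
      = enc (y * x ^ k) := by
    intro i
    induction i with
    | zero => intro k x y hk; have : k = 0 := by simpa using hk
              subst this; simp [Val.fst_pair]
    | succ i ih =>
      intro k x y hk
      rw [Function.iterate_succ_apply]
      have hk2 : k / 2 < 2 ^ i := by rw [pow_succ] at hk; omega
      have hpow : (x * x) ^ (k / 2) * x ^ (k % 2) = x ^ k := by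
        rw [← pow_two, ← pow_mul, ← pow_add, Nat.div_add_mod]
      simp only [powStep, Val.fst_pair, Val.snd_pair, Val.toNat_num, h]
      rcases Nat.mod_two_eq_zero_or_one k with h0 | h1
      · rw [h0] at hpow ⊢
        rw [if_neg (by omega), ih _ _ _ hk2, ← hpow, pow_zero, mul_one]
      · rw [h1] at hpow ⊢
        rw [if_pos rfl, ih _ _ _ hk2, ← hpow, pow_one, mul_assoc]
        congr 2
        exact ((Commute.refl x).mul_right (Commute.refl x)).pow_right _ 
  rw [powSucc, this _ _ _ _ (Nat.lt_size_self k), pow_succ']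

/-- An arbitrary polynomial-time `op` could lengthen its operands by a power in every round, and
repeated squaring would then exceed any polynomial. Truncation bounds every intermediate result on
all inputs, including meaningless ones. -/
theorem FP.powSucc {op : ℕ → Val → Val → Val → Val} {B : ℕ → Val → ℕ} {b : ℕ → Val → Val}
    {k : ℕ → Val → ℕ} (hop : FP fun n z => op n z.fst z.snd.fst z.snd.snd) (hB : FN B) (hBb : PB B)
    (hb : FP b) (hk : FN k) :
    FP fun n x => powSucc (fun u v => BBHIBE.trunc (B n x) (op n u v x)) (b n x) (k n x) := by
  have hB' : FN fun n (z : Val) => B n z.snd := hB.comp FP.id.snd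
  have ht := FP.id.fst
  have h1 : ∀ {u v : ℕ → Val → Val}, FP u → FP v →
      FP fun n z => BBHIBE.trunc (B n z.snd) (op n (u n z) (v n z) z.snd) := fun hu hv =>
    hB'.trunc (hop.comp (hu.pair (hv.pair FP.id.snd)))
  have hstep : FP fun n z =>
      powStep (fun u v => BBHIBE.trunc (B n z.snd) (op n u v z.snd)) z.fst := by
    unfold powStep
    refine FP.pair (FP.ite ((ht.snd.snd.toNat.mod (FP.num 2)).eqNat (FP.num 1)) ?_ ht.fst)
      (FP.pair ?_ (ht.snd.snd.toNat.div (FP.num 2)))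
    exacts [h1 ht.fst ht.snd.fst, h1 ht.snd.fst ht.snd.fst]
  -- The number of rounds is the bit length of the exponent, which is one less than the length of
  -- `num k` as a value.
  have hks : FN fun n x => (k n x).size := (hk.sizeNum.sub (FP.num 1)).congr fun n x => by
    simp [Val.size_num]
  have hkb : PB fun n x => (k n x).size := (FP.size hk).mono fun n x => by simp [Val.size_num]
  have h := FP.iterate (g := fun n t x => powStep (fun u v => BBHIBE.trunc (B n x) (op n u v x)) t)
    (φ := fun n x => 2 * B n x + 8) (fun _ _ _ => True) hstep
    (((PB.const 2).mul hBb).add (PB.const 8)) (fun n t x _ => by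
      refine ⟨trivial, ?_⟩
      have h1 : ∀ u v, (BBHIBE.trunc (B n x) (op n u v x)).size ≤ B n x + 1 := fun u v => size_trunc_le _ _
      have h2 := h1 t.fst t.snd.fst
      have h3 := h1 t.snd.fst t.snd.fst
      have h4 := Nat.size_le_size (Nat.div_le_self t.snd.snd.toNat 2)
      have h5 := t.snd.snd.size_toNat_le
      have h6 : (if t.snd.snd.toNat % 2 = 1 then
          BBHIBE.trunc (B n x) (op n t.fst t.snd.fst x) else t.fst).size
          ≤ t.fst.size + (B n x + 1) := by split <;> omega
      have h7 : t.fst.size + t.snd.snd.size ≤ t.size + 1 := by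
        cases t with
        | num k => simp
        | pair a b => have := b.size_snd_le; simp only [Val.fst_pair, Val.snd_pair, Val.size_pair]; omega
      simp only [powStep, Val.size_pair, Val.size_num]
      omega)
    (fun _ _ => trivial) hks hkb (hb.pair (hb.pair hk)) FP.id
  exact h.fst

/-! ### The efficient operations as polynomial-time functions -/

noncomputable section

namespace GroupGenerator

variable {k : ℕ} (𝒢 : GroupGenerator k)

/-- A polynomial-time function that computes the group operations. -/
def mulFun (n : ℕ) (x : Val) : Val := (𝒢.mul_efficient.choose.run (.pair (.num n) x)).1

/-- A polynomial-time function that computes the maps `e i j`. -/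
def mapFun (n : ℕ) (x : Val) : Val := (𝒢.map_efficient.choose.run (.pair (.num n) x)).1

/-- A bound for the length of group elements. -/
def encBound (n : ℕ) : ℕ := 𝒢.enc_size.choose.eval n

theorem fp_mulFun : FP 𝒢.mulFun := 𝒢.mul_efficient.choose_spec.1.fp

theorem fp_mapFun : FP 𝒢.mapFun := 𝒢.map_efficient.choose_spec.1.fp

theorem fn_encBound : FN fun n _ => 𝒢.encBound n := FN.polynomial _

theorem pb_encBound : PB fun n _ => 𝒢.encBound n := PB.eval _ PB.param

end GroupGenerator

/-- A polynomial-time function that computes the hash function. -/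
def HashFunction.hashFun (H : HashFunction) (n : ℕ) (x : Val) : Val :=
  (H.efficient.choose.run (.pair (.num n) x)).1

theorem HashFunction.fp_hashFun (H : HashFunction) : FP H.hashFun := H.efficient.choose_spec.1.fp

theorem PolyComputable.fn {f : ℕ → ℕ} (h : PolyComputable f) : FN fun n _ => f n := by
  obtain ⟨P, hP, hf⟩ := h
  exact (hP.fp.comp (FP.num 0)).congr fun n x => hf n

/-! ### The simulator

The simulator answers the adversary, given the description `d` of the groups, elements `ga`, `gc`
of level one, `hb` of level two and `Z` of level three, coins `ρ` of the adversary, a number `y`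
whose base-`p` digits are the random exponents, and the target `(ids, T)` with the hashes `cis` of
the prefixes of `ids`. Exponents are natural numbers. Row `i < L` stands for level `i` of the
hierarchy, row `L` for the time period. -/

namespace Sim

variable (𝒢 : GroupGenerator 3) (H : HashFunction) (L : ℕ → ℕ) (A : Adversary)

/-- The data that the simulator works with. -/
def mkEnv (d ga hb gc Z : Val) (ρ y : ℕ) (ids T cis : Val) : Val :=
  .ofList [d, ga, hb, gc, Z, .num ρ, .num y, ids, T, cis]

def envD (E : Val) : Val := E.nth 0
def envGa (E : Val) : Val := E.nth 1
def envHb (E : Val) : Val := E.nth 2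
def envGc (E : Val) : Val := E.nth 3
def envZ (E : Val) : Val := E.nth 4
def envRho (E : Val) : ℕ := (E.nth 5).toNat
def envY (E : Val) : ℕ := (E.nth 6).toNat
def envIds (E : Val) : List Val := (E.nth 7).toList
def envT (E : Val) : Val := E.nth 8
def envCis (E : Val) : Val := E.nth 9

/-- Large enough for each kind of row: `2 n` bit positions with the constant term in column `2 n`,
the four secret exponents, and the `L n + 1` exponents of a private key. -/
def width (n : ℕ) : ℕ := 2 * n + L n + 5

/-- There are `L n` rows for levels, one for the time period, one for the secret exponents (row `L n
+ 1`), and row `L n + 1 + t` for the key issued after `t` messages. The parameters and the challenge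
are messages too, so `t ≤ q₁ + q₂ + 1`. -/
def rows (n : ℕ) : ℕ := L n + A.q₁.eval n + A.q₂.eval n + 4

/-- The number of random exponents. -/
def digits (n : ℕ) : ℕ := rows L A n * width L n * 2

/-- The number of the random exponent at position `(row, j, b)`. -/
def index (n row j : ℕ) (b : Bool) : ℕ := (row * width L n + j) * 2 + b.toNat

/-- The random exponent at position `(row, j, b)`. -/
def rnd (n p y row j : ℕ) (b : Bool) : ℕ :=
  -- The minimum has no effect on positions inside the array; it keeps the exponent polynomial for
  -- all others.
  y / p ^ min (index L n row j b) (digits L A n) % p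

/-- The truncation leaves encodings of group elements unchanged and is there for the time bound of
fast exponentiation. -/
def mulV (n : ℕ) (d : Val) (i : ℕ) (x y : Val) : Val :=
  trunc (𝒢.encBound n) (𝒢.mulFun n (.ofList [d, .num i, x, y]))

def mapV (n : ℕ) (d : Val) (i j : ℕ) (x y : Val) : Val :=
  𝒢.mapFun n (.ofList [d, .num i, .num j, x, y])

/-- The power `x ^ k` in level `i`. -/
def powV (n : ℕ) (d : Val) (i : ℕ) (x : Val) (k : ℕ) : Val :=
  -- `powSucc` raises to one more than its argument, so the exponent is `k + p`, and `x ^ p = 1`.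
  -- This covers `k = 0` without an encoding of `1`.
  powSucc (mulV 𝒢 n d i) x (k + d.fst.toNat - 1)

/-- The generator of level `i + 1`. -/
def genV (d : Val) (i : ℕ) : Val := d.snd.fst.nth i

/-- `g₁ ^ x * ga ^ z`. -/
def exp1 (n : ℕ) (E : Val) (x z : ℕ) : Val :=
  mulV 𝒢 n (envD E) 1 (powV 𝒢 n (envD E) 1 (genV (envD E) 0) x)
    (powV 𝒢 n (envD E) 1 (envGa E) z)

/-- `g₂ ^ x * e(ga, g₁) ^ z * hb ^ w`. -/
def exp2 (n : ℕ) (E : Val) (x z w : ℕ) : Val :=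
  mulV 𝒢 n (envD E) 2 (mulV 𝒢 n (envD E) 2 (powV 𝒢 n (envD E) 2 (genV (envD E) 1) x)
    (powV 𝒢 n (envD E) 2 (mapV 𝒢 n (envD E) 1 1 (envGa E) (genV (envD E) 0)) z))
    (powV 𝒢 n (envD E) 2 (envHb E) w)

/-- The inverse of `k` modulo the prime `p`. -/
def modInv (p k : ℕ) : ℕ :=
  -- By Fermat the inverse is the power `p - 2`, which is `powSucc` at `p - 3`.
  (powSucc (fun u v => trunc (p.size + 1) (.num (u.toNat * v.toNat % p))) (.num (k % p))
    (p - 3)).toNat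

def bitAt (v : Val) (j : ℕ) : Bool := decide (v.nth j = .num 1)

/-- The concatenation of the components of an identity. -/
def flatBits (n : ℕ) (ids : List Val) : List Val :=
  ids.flatMap fun c => (List.range (2 * n)).map fun j => .ofBool (bitAt c j)

def ci (n : ℕ) (ids : List Val) (i : ℕ) : Val :=
  H.hashFun n (.ofList (flatBits n (ids.take (i + 1))))

/-- The exponent of `ga` in the parameter at position `(row, j, b)`. -/
def delta (n : ℕ) (E : Val) (row j : ℕ) (b : Bool) : ℕ :=
  if row = L n then if b = bitAt (envT E) j then 0 else 1
  else if row < (envIds E).length then if b = bitAt ((envCis E).nth row) j then 0 else 1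
  else 0

/-- The exponent of `ga` in the constant term of a row. -/
def delta0 (n : ℕ) (E : Val) (row : ℕ) : ℕ :=
  if row = L n then 0 else if row < (envIds E).length then 0 else 1

def u (n : ℕ) (E : Val) (row j : ℕ) (b : Bool) : ℕ :=
  rnd L A n (envD E).fst.toNat (envY E) row j b

def u0 (n : ℕ) (E : Val) (row : ℕ) : ℕ := u L A n E row (2 * n) false

def rowLength (n row : ℕ) : ℕ := if row = L n then n else 2 * n

/-- The known part of the exponent of the hash of `w` in a row. -/
def coeffK (n : ℕ) (E : Val) (row : ℕ) (w : Val) : ℕ :=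
  u0 L A n E row + ((List.range (rowLength L n row)).map fun j => u L A n E row j (bitAt w j)).sum

/-- The exponent of `ga` in the hash of `w` in a row. -/
def coeffJ (n : ℕ) (E : Val) (row : ℕ) (w : Val) : ℕ :=
  delta0 L n E row + ((List.range (rowLength L n row)).map fun j => delta L n E row j (bitAt w j)).sum

def paramPair (n : ℕ) (E : Val) (row j : ℕ) : Val :=
  .pair (exp1 𝒢 n E (u L A n E row j false) (delta L n E row j false))
    (exp1 𝒢 n E (u L A n E row j true) (delta L n E row j true))

def paramRow (n : ℕ) (E : Val) (row : ℕ) : Val :=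
  .pair (exp1 𝒢 n E (u0 L A n E row) (delta0 L n E row))
    (.ofList ((List.range (rowLength L n row)).map fun j => paramPair 𝒢 L A n E row j))

def params (n : ℕ) (E : Val) : Val :=
  .ofList [envD E, .ofList ((List.range (L n)).map fun i => paramRow 𝒢 L A n E i),
    paramRow 𝒢 L A n E (L n), mapV 𝒢 n (envD E) 1 2 (envGa E) (envHb E)]

def header (n : ℕ) (E : Val) : Val :=
  .ofList [envGc E,
    .ofList ((List.range (envIds E).length).map fun i =>
      powV 𝒢 n (envD E) 1 (envGc E) (coeffK L A n E i ((envCis E).nth i))),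
    powV 𝒢 n (envD E) 1 (envGc E) (coeffK L A n E (L n) (envT E))]

/-- The word that is hashed in a row, for a query `(ids, T)`. -/
def word (n : ℕ) (ids : List Val) (T : Val) (row : ℕ) : Val :=
  if row = L n then T else ci H n ids row

/-- The random exponents of the private key generated after `t` messages. -/
def keyRnd (n : ℕ) (E : Val) (t i : ℕ) : ℕ := u L A n E (L n + 1 + t) i false

/-- The private key for `(ids, T)`; the exponent of row `piv` is shifted. -/
def key (n : ℕ) (E : Val) (t : ℕ) (ids : List Val) (T : Val) (piv : ℕ) : Val :=
  let p := (envD E).fst.toNat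
  let inv := modInv p (coeffJ L n E piv (word H L n ids T piv))
  .ofList [exp2 𝒢 n E
      (((List.range ids.length).map fun i => coeffK L A n E i (ci H n ids i) * keyRnd L A n E t i).sum
        + coeffK L A n E (L n) T * keyRnd L A n E t (L n))
      (((List.range ids.length).map fun i => coeffJ L n E i (ci H n ids i) * keyRnd L A n E t i).sum
        + coeffJ L n E (L n) T * keyRnd L A n E t (L n))
      -- Exponents are natural numbers, so `p - 1` plays the role of `-1`. The exponent of `g₂^β` is
      -- `-K / J`: this is what remains of the shift `-β / J` of row `piv` after `a β` has
      -- cancelled.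
      ((p - 1) * coeffK L A n E piv (word H L n ids T piv) * inv),
    .ofList ((List.range ids.length).map fun i =>
      exp2 𝒢 n E ((p - 1) * keyRnd L A n E t i) 0 (if i = piv then inv else 0)),
    exp2 𝒢 n E ((p - 1) * keyRnd L A n E t (L n)) 0 (if piv = L n then inv else 0)]

/-- The answer to the query `v` made after `t` messages. -/
def answer (n : ℕ) (E : Val) (t : ℕ) (v : Val) : Val :=
  if 1 ≤ v.fst.toList.length ∧ v.fst.toList.length ≤ L n then
    -- The time row serves as pivot unless `T = T*`; then the last level is tried. If `J` vanishes
    -- there as well, the query is either forbidden or contains a collision.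
    if coeffJ L n E (L n) v.snd = 0 then
      if coeffJ L n E (v.fst.toList.length - 1) (ci H n v.fst.toList (v.fst.toList.length - 1)) = 0
      then .num 0
      else key 𝒢 H L A n E t v.fst.toList v.snd (v.fst.toList.length - 1)
    else key 𝒢 H L A n E t v.fst.toList v.snd (L n)
  else .num 0

/-- A bound for the length of private keys. -/
def keyBound (n : ℕ) : ℕ := 3 * (L n * (𝒢.encBound n + 1) + 𝒢.encBound n + 2) + 1

def move (n ρ : ℕ) (R : Val) : Val :=
  (A.prog.run (.pair (.num n) (.pair (.num ρ) R))).1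

/-- The list of received messages after one more query. -/
def step (n : ℕ) (E : Val) (R : Val) : Val :=
  -- The answer depends on all earlier messages, so without truncation its length could compound
  -- over the queries. Genuine keys fit within `keyBound`.
  .ofList (R.toList ++ [trunc (keyBound 𝒢 L n)
    (answer 𝒢 H L A n E R.toList.length (move A n (envRho E) R))])

/-- All messages that the adversary receives. -/
def run (n : ℕ) (E : Val) : Val :=
  (fun R => step 𝒢 H L A n E R)^[A.q₂.eval n] (.ofList
    (((fun R => step 𝒢 H L A n E R)^[A.q₁.eval n] (.ofList [params 𝒢 L A n E])).toList
      ++ [.pair (header 𝒢 L A n E) (envZ E)]))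

/-! ### Running time of the simulator -/

section Time

variable {d x y v w E R T : ℕ → Val → Val} {p k i j t row z e piv : ℕ → Val → ℕ} {b : ℕ → Val → Bool}
  {ids : ℕ → Val → List Val} {L}

theorem fp_envD (hE : FP E) : FP fun n x => envD (E n x) := hE.nth (FP.num 0)
theorem fp_envGa (hE : FP E) : FP fun n x => envGa (E n x) := hE.nth (FP.num 1)
theorem fp_envHb (hE : FP E) : FP fun n x => envHb (E n x) := hE.nth (FP.num 2)
theorem fp_envGc (hE : FP E) : FP fun n x => envGc (E n x) := hE.nth (FP.num 3)
theorem fp_envZ (hE : FP E) : FP fun n x => envZ (E n x) := hE.nth (FP.num 4)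
theorem fn_envRho (hE : FP E) : FN fun n x => envRho (E n x) := (hE.nth (FP.num 5)).toNat
theorem fn_envY (hE : FP E) : FN fun n x => envY (E n x) := (hE.nth (FP.num 6)).toNat
theorem fl_envIds (hE : FP E) : FL fun n x => envIds (E n x) := FL.toList (hE.nth (FP.num 7))
theorem fp_envT (hE : FP E) : FP fun n x => envT (E n x) := hE.nth (FP.num 8)
theorem fp_envCis (hE : FP E) : FP fun n x => envCis (E n x) := hE.nth (FP.num 9)

theorem fn_p (hE : FP E) : FN fun n x => (envD (E n x)).fst.toNat := (fp_envD hE).fst.toNat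

theorem fn_width (hL : FN fun n _ => L n) : FN fun n _ => width L n :=
  (((FP.num 2).mul FP.param).add hL).add (FP.num 5)

theorem fn_rows (hL : FN fun n _ => L n) : FN fun n _ => rows L A n :=
  ((hL.add (FN.polynomial _)).add (FN.polynomial _)).add (FP.num 4)

theorem fn_digits (hL : FN fun n _ => L n) : FN fun n _ => digits L A n :=
  ((fn_rows A hL).mul (fn_width hL)).mul (FP.num 2)

theorem pb_digits (hb : PB fun n _ => L n) : PB fun n _ => digits L A n :=
  ((((hb.add (PB.eval _ PB.param)).add (PB.eval _ PB.param)).add (PB.const 4)).mul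
    ((((PB.const 2).mul PB.param).add hb).add (PB.const 5))).mul (PB.const 2)

variable (hL : FN fun n _ => L n) (hLb : PB fun n _ => L n)
include hL

theorem fn_index (hr : FN row) (hj : FN j) (hb : FB b) :
    FN fun n x => index L n (row n x) (j n x) (b n x) :=
  (((hr.mul (fn_width hL)).add hj).mul (FP.num 2)).add hb.ofBoolNat

include hLb in
theorem fn_rnd (hp : FN p) (hy : FN z) (hr : FN row) (hj : FN j) (hb : FB b) :
    FN fun n x => rnd L A n (p n x) (z n x) (row n x) (j n x) (b n x) :=
  (hy.div (FN.pow hp ((fn_index hL hr hj hb).min (fn_digits A hL))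
    ((pb_digits A hLb).mono fun _ _ => min_le_right _ _))).mod hp

omit hL

theorem fp_mulV (hd : FP d) (hi : FN i) (hx : FP x) (hy : FP y) :
    FP fun n z => mulV 𝒢 n (d n z) (i n z) (x n z) (y n z) :=
  𝒢.fn_encBound.trunc (𝒢.fp_mulFun.comp (FL.cons hd (FL.cons hi (FL.cons hx (FL.cons hy FL.nil)))))

theorem fp_mapV (hd : FP d) (hi : FN i) (hj : FN j) (hx : FP x) (hy : FP y) :
    FP fun n z => mapV 𝒢 n (d n z) (i n z) (j n z) (x n z) (y n z) :=
  𝒢.fp_mapFun.comp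
    (FL.cons hd (FL.cons hi (FL.cons hj (FL.cons hx (FL.cons hy FL.nil)))))

theorem fp_powV (hd : FP d) (hi : FN i) (hx : FP x) (hk : FN k) :
    FP fun n z => powV 𝒢 n (d n z) (i n z) (x n z) (k n z) := by
  have hs : ∀ {f : ℕ → Val → Val}, FP f → FP fun n z => f n z.snd.snd := fun hf =>
    hf.comp FP.id.snd.snd
  refine FP.powSucc (op := fun n u v z => 𝒢.mulFun n (.ofList [d n z, .num (i n z), u, v]))
    (𝒢.fp_mulFun.comp (FL.cons (hs hd) (FL.cons (hs hi)
      (FL.cons FP.id.fst (FL.cons FP.id.snd.fst FL.nil))))) 𝒢.fn_encBound 𝒢.pb_encBound hx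
    ((hk.add hd.fst.toNat).sub (FP.num 1))

theorem fp_genV (hd : FP d) (k : ℕ) : FP fun n z => genV (d n z) k := hd.snd.fst.nth (FP.num k)

theorem fp_exp1 (hE : FP E) (hk : FN k) (hz : FN z) :
    FP fun n x => exp1 𝒢 n (E n x) (k n x) (z n x) :=
  fp_mulV 𝒢 (fp_envD hE) (FP.num 1)
    (fp_powV 𝒢 (fp_envD hE) (FP.num 1) (fp_genV (fp_envD hE) 0) hk)
    (fp_powV 𝒢 (fp_envD hE) (FP.num 1) (fp_envGa hE) hz)

theorem fp_exp2 (hE : FP E) (hk : FN k) (hz : FN z) (he : FN e) :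
    FP fun n x => exp2 𝒢 n (E n x) (k n x) (z n x) (e n x) :=
  fp_mulV 𝒢 (fp_envD hE) (FP.num 2)
    (fp_mulV 𝒢 (fp_envD hE) (FP.num 2)
      (fp_powV 𝒢 (fp_envD hE) (FP.num 2) (fp_genV (fp_envD hE) 1) hk)
      (fp_powV 𝒢 (fp_envD hE) (FP.num 2)
        (fp_mapV 𝒢 (fp_envD hE) (FP.num 1) (FP.num 1) (fp_envGa hE) (fp_genV (fp_envD hE) 0)) hz))
    (fp_powV 𝒢 (fp_envD hE) (FP.num 2) (fp_envHb hE) he)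

theorem fn_modInv (hp : FN p) (hk : FN k) : FN fun n x => modInv (p n x) (k n x) := by
  have hs : FN fun n z => p n z.snd.snd := FP.comp hp FP.id.snd.snd
  refine FP.toNat (FP.powSucc (op := fun n u v x => .num (u.toNat * v.toNat % p n x))
    ((FP.id.fst.toNat.mul FP.id.snd.fst.toNat).mod hs)
    (B := fun n x => (p n x).size + 1) hp.sizeNum hp.size (hk.mod hp) (hp.sub (FP.num 3)))

theorem fb_bitAt (hv : FP v) (hj : FN j) : FB fun n x => bitAt (v n x) (j n x) :=
  (hv.nth hj).eq (FP.num 1)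

theorem fl_flatBits (hi : FL ids) : FL fun n x => flatBits n (ids n x) :=
  FL.flatMap hi (FL.map_range (g := fun _ i z => .ofBool (bitAt z.fst i.toNat))
    ((FP.num 2).mul FP.param) ((PB.const 2).mul PB.param) (fb_bitAt FP.id.snd.fst FP.id.fst.toNat))

theorem fp_ci (hi : FL ids) (hj : FN j) : FP fun n x => ci H n (ids n x) (j n x) :=
  H.fp_hashFun.comp (fl_flatBits (FL.take (hj.add (FP.num 1)) hi))

include hL

theorem fn_delta (hE : FP E) (hr : FN row) (hj : FN j) (hb : FB b) :
    FN fun n x => delta L n (E n x) (row n x) (j n x) (b n x) :=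
  FP.iteNat (hr.eqNat hL)
    (FP.iteNat (hb.eqBool (fb_bitAt (fp_envT hE) hj)) (FP.num 0) (FP.num 1))
    (FP.iteNat (hr.ltNat (FN.length (fl_envIds hE)))
      (FP.iteNat (hb.eqBool (fb_bitAt ((fp_envCis hE).nth hr) hj)) (FP.num 0) (FP.num 1)) (FP.num 0))

theorem fn_delta0 (hE : FP E) (hr : FN row) : FN fun n x => delta0 L n (E n x) (row n x) :=
  FP.iteNat (hr.eqNat hL) (FP.num 0)
    (FP.iteNat (hr.ltNat (FN.length (fl_envIds hE))) (FP.num 0) (FP.num 1))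

theorem fn_rowLength (hr : FN row) : FN fun n x => rowLength L n (row n x) :=
  FP.iteNat (hr.eqNat hL) FP.param ((FP.num 2).mul FP.param)

omit hL in
theorem pb_rowLength : PB fun n x => rowLength L n (row n x) :=
  ((PB.const 2).mul PB.param).mono fun n x => by unfold rowLength; split <;> omega

theorem fn_coeffJ (hE : FP E) (hr : FN row) (hw : FP w) :
    FN fun n x => coeffJ L n (E n x) (row n x) (w n x) := by
  have hr' : FN fun n z => row n z.snd := FP.comp hr FP.id.snd
  exact (fn_delta0 hL hE hr).add (FN.sum_range
    (g := fun n i x => delta L n (E n x) (row n x) i.toNat (bitAt (w n x) i.toNat))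
    (fn_rowLength hL hr) pb_rowLength (fn_delta hL (hE.comp FP.id.snd) hr' FP.id.fst.toNat
      (fb_bitAt (hw.comp FP.id.snd) FP.id.fst.toNat)))

include hLb

theorem fn_u (hE : FP E) (hr : FN row) (hj : FN j) (hb : FB b) :
    FN fun n x => u L A n (E n x) (row n x) (j n x) (b n x) :=
  fn_rnd A hL hLb (fn_p hE) (fn_envY hE) hr hj hb

theorem fn_u0 (hE : FP E) (hr : FN row) : FN fun n x => u0 L A n (E n x) (row n x) :=
  fn_u A hL hLb hE hr ((FP.num 2).mul FP.param) (FP.num 0)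

theorem fn_coeffK (hE : FP E) (hr : FN row) (hw : FP w) :
    FN fun n x => coeffK L A n (E n x) (row n x) (w n x) := by
  have hr' : FN fun n z => row n z.snd := FP.comp hr FP.id.snd
  exact (fn_u0 A hL hLb hE hr).add (FN.sum_range
    (g := fun n i x => u L A n (E n x) (row n x) i.toNat (bitAt (w n x) i.toNat))
    (fn_rowLength hL hr) pb_rowLength (fn_u A hL hLb (hE.comp FP.id.snd) hr' FP.id.fst.toNat
      (fb_bitAt (hw.comp FP.id.snd) FP.id.fst.toNat)))

theorem fp_paramPair (hE : FP E) (hr : FN row) (hj : FN j) :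
    FP fun n x => paramPair 𝒢 L A n (E n x) (row n x) (j n x) := by
  have h : ∀ b : Bool, FP fun n x => exp1 𝒢 n (E n x) (u L A n (E n x) (row n x) (j n x) b)
      (delta L n (E n x) (row n x) (j n x) b) := fun b =>
    fp_exp1 𝒢 hE (fn_u A hL hLb hE hr hj (FP.num _)) (fn_delta hL hE hr hj (FP.num _))
  exact (h false).pair (h true)

theorem fp_paramRow (hE : FP E) (hr : FN row) :
    FP fun n x => paramRow 𝒢 L A n (E n x) (row n x) := by
  have hr' : FN fun n z => row n z.snd := FP.comp hr FP.id.snd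
  exact (fp_exp1 𝒢 hE (fn_u0 A hL hLb hE hr) (fn_delta0 hL hE hr)).pair
    (FL.map_range (g := fun n i x => paramPair 𝒢 L A n (E n x) (row n x) i.toNat)
      (fn_rowLength hL hr) pb_rowLength
      (fp_paramPair 𝒢 A hL hLb (hE.comp FP.id.snd) hr' FP.id.fst.toNat))

theorem fp_params (hE : FP E) : FP fun n x => params 𝒢 L A n (E n x) :=
  FL.cons (fp_envD hE) (FL.cons
    (FL.map_range (g := fun n i x => paramRow 𝒢 L A n (E n x) i.toNat) hL hLb
      (fp_paramRow 𝒢 A hL hLb (hE.comp FP.id.snd) FP.id.fst.toNat))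
    (FL.cons (fp_paramRow 𝒢 A hL hLb hE hL) (FL.cons
      (fp_mapV 𝒢 (fp_envD hE) (FP.num 1) (FP.num 2) (fp_envGa hE) (fp_envHb hE)) FL.nil)))

theorem fp_header (hE : FP E) : FP fun n x => header 𝒢 L A n (E n x) := by
  have hE' : FP fun n z => E n z.snd := hE.comp FP.id.snd
  have hl := fl_envIds hE
  exact FL.cons (fp_envGc hE) (FL.cons (FL.map_range
      (g := fun n i x => powV 𝒢 n (envD (E n x)) 1 (envGc (E n x))
        (coeffK L A n (E n x) i.toNat ((envCis (E n x)).nth i.toNat)))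
      (FN.length hl) (PB.length hl)
      (fp_powV 𝒢 (fp_envD hE') (FP.num 1) (fp_envGc hE') (fn_coeffK A hL hLb hE' FP.id.fst.toNat
        ((fp_envCis hE').nth FP.id.fst.toNat))))
    (FL.cons (fp_powV 𝒢 (fp_envD hE) (FP.num 1) (fp_envGc hE)
      (fn_coeffK A hL hLb hE hL (fp_envT hE))) FL.nil))

omit hLb in
theorem fp_word (hi : FL ids) (hT : FP T) (hr : FN row) :
    FP fun n x => word H L n (ids n x) (T n x) (row n x) :=
  (hr.eqNat hL).ite hT (fp_ci H hi hr)

theorem fn_keyRnd (hE : FP E) (ht : FN t) (hi : FN i) :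
    FN fun n x => keyRnd L A n (E n x) (t n x) (i n x) :=
  fn_u A hL hLb hE ((hL.add (FP.num 1)).add ht) hi (FP.num 0)

theorem fp_key (hE : FP E) (ht : FN t) (hi : FL ids) (hT : FP T) (hv : FN piv) :
    FP fun n x => key 𝒢 H L A n (E n x) (t n x) (ids n x) (T n x) (piv n x) := by
  have hE' : FP fun n z => E n z.snd := hE.comp FP.id.snd
  have ht' : FN fun n z => t n z.snd := FP.comp ht FP.id.snd
  have hv' : FN fun n z => piv n z.snd := FP.comp hv FP.id.snd
  have hi' : FL fun n z => ids n z.snd := FP.comp hi FP.id.snd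
  have hw := fp_word H hL hi hT hv
  have hinv := fn_modInv (fn_p hE) (fn_coeffJ hL hE hv hw)
  have hinv' : FN fun n z => modInv (envD (E n z.snd)).fst.toNat
      (coeffJ L n (E n z.snd) (piv n z.snd) (word H L n (ids n z.snd) (T n z.snd) (piv n z.snd))) :=
    FP.comp hinv FP.id.snd
  have hlen := FN.length hi
  have hlb := PB.length hi
  have hneg := (fn_p hE).sub (FP.num 1)
  have hneg' := (fn_p hE').sub (FP.num 1)
  have hj := FP.id.fst.toNat
  have hci := fp_ci H hi' hj
  refine FL.cons (fp_exp2 𝒢 hE ?_ ?_ ((hneg.mul (fn_coeffK A hL hLb hE hv hw)).mul hinv))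
    (FL.cons ?_ (FL.cons (fp_exp2 𝒢 hE (hneg.mul (fn_keyRnd A hL hLb hE ht hL)) (FP.num 0)
      (FP.iteNat (hv.eqNat hL) hinv (FP.num 0))) FL.nil))
  · exact (FN.sum_range (g := fun n i x => coeffK L A n (E n x) i.toNat (ci H n (ids n x) i.toNat)
      * keyRnd L A n (E n x) (t n x) i.toNat) hlen hlb
      ((fn_coeffK A hL hLb hE' hj hci).mul (fn_keyRnd A hL hLb hE' ht' hj))).add
      ((fn_coeffK A hL hLb hE hL hT).mul (fn_keyRnd A hL hLb hE ht hL))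
  · exact (FN.sum_range (g := fun n i x => coeffJ L n (E n x) i.toNat (ci H n (ids n x) i.toNat)
      * keyRnd L A n (E n x) (t n x) i.toNat) hlen hlb
      ((fn_coeffJ hL hE' hj hci).mul (fn_keyRnd A hL hLb hE' ht' hj))).add
      ((fn_coeffJ hL hE hL hT).mul (fn_keyRnd A hL hLb hE ht hL))
  · exact FL.map_range (g := fun n i x => exp2 𝒢 n (E n x)
        (((envD (E n x)).fst.toNat - 1) * keyRnd L A n (E n x) (t n x) i.toNat) 0
        (if i.toNat = piv n x then modInv (envD (E n x)).fst.toNat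
          (coeffJ L n (E n x) (piv n x) (word H L n (ids n x) (T n x) (piv n x))) else 0)) hlen hlb
      (fp_exp2 𝒢 hE' (hneg'.mul (fn_keyRnd A hL hLb hE' ht' hj)) (FP.num 0)
        (FP.iteNat (hj.eqNat hv') hinv' (FP.num 0)))

theorem fp_answer (hE : FP E) (ht : FN t) (hv : FP v) :
    FP fun n x => answer 𝒢 H L A n (E n x) (t n x) (v n x) := by
  have hi := FL.toList hv.fst
  have hlen := FN.length hi
  have hlast := hlen.sub (FP.num 1)
  have hkey := fun {piv : ℕ → Val → ℕ} (h : FN piv) => fp_key 𝒢 H A hL hLb hE ht hi hv.snd h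
  exact (((FP.num 1).leNat hlen).and (hlen.leNat hL)).ite
    (((fn_coeffJ hL hE hL hv.snd).eqNat (FP.num 0)).ite
      (((fn_coeffJ hL hE hlast (fp_ci H hi hlast)).eqNat (FP.num 0)).ite (FP.num 0) (hkey hlast))
      (hkey hL)) (FP.num 0)

omit hLb in
theorem fn_keyBound : FN fun n _ => keyBound 𝒢 L n :=
  ((FP.num 3).mul (((hL.mul (𝒢.fn_encBound.add (FP.num 1))).add 𝒢.fn_encBound).add (FP.num 2))).add
    (FP.num 1)

omit hL in
theorem pb_keyBound : PB fun n _ => keyBound 𝒢 L n :=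
  ((PB.const 3).mul (((hLb.mul (𝒢.pb_encBound.add (PB.const 1))).add 𝒢.pb_encBound).add
    (PB.const 2))).add (PB.const 1)

omit hL hLb in
theorem fp_move (hk : FN k) (hR : FP R) : FP fun n x => move A n (k n x) (R n x) :=
  A.polyTime.fp.comp (hk.pair hR)

theorem fp_iterate_step (hE : FP E) (hR : FP R) (q : Polynomial ℕ) :
    FP fun n x => (fun R => step 𝒢 H L A n (E n x) R)^[q.eval n] (R n x) := by
  refine FP.iterate (g := fun n R E => step 𝒢 H L A n E R) (φ := fun n _ => keyBound 𝒢 L n + 3)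
    (fun _ _ _ => True) ?_ ((pb_keyBound 𝒢 hLb).add (PB.const 3)) (fun n R E _ => ⟨trivial, ?_⟩)
    (fun _ _ => trivial) (FN.polynomial q) (PB.eval q PB.param) hR hE
  · have hR := FL.toList FP.id.fst
    exact FL.append hR (FL.cons ((fn_keyBound 𝒢 hL).trunc (fp_answer 𝒢 H A hL hLb FP.id.snd
      (FN.length hR) (fp_move A (fn_envRho FP.id.snd) FP.id.fst))) FL.nil)
  · have h1 := Val.size_ofList_append R.toList [trunc (keyBound 𝒢 L n)
      (answer 𝒢 H L A n E R.toList.length (move A n (envRho E) R))]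
    have h2 := Val.size_ofList_toList_le R
    have h3 := size_trunc_le (keyBound 𝒢 L n)
      (answer 𝒢 H L A n E R.toList.length (move A n (envRho E) R))
    simp only [Val.ofList_cons, Val.ofList_nil, Val.size_pair, Val.size_num, Nat.size_zero] at h1
    unfold step
    omega

theorem fp_run (hE : FP E) : FP fun n x => run 𝒢 H L A n (E n x) :=
  fp_iterate_step 𝒢 H A hL hLb hE (FL.append (FL.toList (fp_iterate_step 𝒢 H A hL hLb hE
      (FL.cons (fp_params 𝒢 A hL hLb hE) FL.nil) A.q₁))
    (FL.cons ((fp_header 𝒢 A hL hLb hE).pair (fp_envZ hE)) FL.nil)) A.q₂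

end Time
end Sim
end

/-! ### Exponents in multilinear groups -/

namespace MultilinearGroup

variable {k : ℕ} (M : MultilinearGroup k)

instance : Fact M.p.Prime := ⟨M.prime⟩

/-- The element of level `i` with exponent `x`. -/
def gp (i : ℕ) (x : ZMod M.p) : M.G i := M.g i ^ x.val

variable {M} {i j : ℕ}

theorem orderOf_g (hi : 1 ≤ i) (hik : i ≤ k) : orderOf (M.g i) = M.p := by
  rw [orderOf_eq_card_of_forall_mem_zpowers (M.generates i hi hik), Nat.card_eq_fintype_card,
    M.card_eq i hi hik]

theorem pow_p_eq_one (hi : 1 ≤ i) (hik : i ≤ k) (x : M.G i) : x ^ M.p = 1 := by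
  rw [← M.card_eq i hi hik, pow_card_eq_one]

theorem g_pow (hi : 1 ≤ i) (hik : i ≤ k) (m : ℕ) : M.g i ^ m = M.gp i m := by
  rw [gp, ZMod.val_natCast, ← orderOf_g hi hik, pow_mod_orderOf]

theorem gp_one (hi : 1 ≤ i) (hik : i ≤ k) : M.gp i 1 = M.g i := by
  simpa using (g_pow hi hik 1).symm

theorem gp_add (hi : 1 ≤ i) (hik : i ≤ k) (x y : ZMod M.p) :
    M.gp i (x + y) = M.gp i x * M.gp i y := by
  conv_rhs => rw [gp, gp, ← pow_add, g_pow hi hik]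
  simp

theorem gp_pow (hi : 1 ≤ i) (hik : i ≤ k) (x : ZMod M.p) (m : ℕ) :
    M.gp i x ^ m = M.gp i (x * m) := by
  conv_lhs => rw [gp, ← pow_mul, g_pow hi hik]
  simp

theorem gp_pow_val (hi : 1 ≤ i) (hik : i ≤ k) (x y : ZMod M.p) :
    M.gp i x ^ y.val = M.gp i (x * y) := by
  rw [gp_pow hi hik, ZMod.natCast_zmod_val]

theorem gp_zero : M.gp i 0 = 1 := by simp [gp]

theorem gp_neg (hi : 1 ≤ i) (hik : i ≤ k) (x : ZMod M.p) : M.gp i (-x) = (M.gp i x)⁻¹ := by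
  rw [eq_inv_iff_mul_eq_one, ← gp_add hi hik, neg_add_cancel, gp_zero]

theorem gp_sum (hi : 1 ≤ i) (hik : i ≤ k) {ι : Type*} (s : Finset ι) (f : ι → ZMod M.p) :
    M.gp i (∑ t ∈ s, f t) = ∏ t ∈ s, M.gp i (f t) := by
  classical
  induction s using Finset.induction_on with
  | empty => simp [gp_zero]
  | insert a s ha ih => rw [Finset.sum_insert ha, Finset.prod_insert ha, gp_add hi hik, ih]

theorem gp_bijective (hi : 1 ≤ i) (hik : i ≤ k) : Function.Bijective (M.gp i) := by
  rw [Fintype.bijective_iff_surjective_and_card]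
  refine ⟨fun x => ?_, by rw [ZMod.card, M.card_eq i hi hik]⟩
  obtain ⟨m, hm⟩ := (mem_powers_iff_mem_zpowers (x := M.g i)).2 (M.generates i hi hik x)
  exact ⟨m, by rw [← hm]; exact (g_pow hi hik m).symm⟩

theorem e_gp (hi : 1 ≤ i) (hj : 1 ≤ j) (hij : i + j ≤ k) (x y : ZMod M.p) :
    M.e i j (M.gp i x) (M.gp j y) = M.gp (i + j) (x * y) := by
  rw [gp, gp, M.bilinear i j hi hj hij, g_pow (by omega) hij]
  simp

end MultilinearGroup

open MultilinearGroup

theorem toLevelTwo_gp {M : MultilinearGroup 3} (x : ZMod M.p) :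
    toLevelTwo (M.gp 1 x) = M.gp 2 x := by
  have := M.e_gp (i := 1) (j := 1) le_rfl le_rfl (by norm_num) x 1
  rwa [gp_one le_rfl (by norm_num), mul_one] at this

theorem selectProd_gp {k i l : ℕ} {M : MultilinearGroup k} (hi : 1 ≤ i) (hik : i ≤ k)
    (x : ZMod M.p) (f : Fin l → Bool → ZMod M.p) (w : Fin l → Bool) :
    selectProd (M.gp i x) (fun j b => M.gp i (f j b)) w = M.gp i (x + ∑ j, f j (w j)) := by
  rw [selectProd, gp_add hi hik, gp_sum hi hik]

/-! ### Correctness of the operations on data -/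

namespace GroupGenerator

variable {k : ℕ} {𝒢 : GroupGenerator k} {n : ℕ} {d : Val} (hd : d ∈ 𝒢.good n)
include hd

theorem size_enc_le {i : ℕ} (hi : 1 ≤ i) (hik : i ≤ k) (x : (𝒢.grp d).G i) :
    (𝒢.enc d i x).size ≤ 𝒢.encBound n :=
  𝒢.enc_size.choose_spec n d hd i hi hik x

theorem mulFun_enc {i : ℕ} (hi : 1 ≤ i) (hik : i ≤ k) (x y : (𝒢.grp d).G i) :
    𝒢.mulFun n (.ofList [d, .num i, 𝒢.enc d i x, 𝒢.enc d i y]) = 𝒢.enc d i (x * y) :=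
  𝒢.mul_efficient.choose_spec.2 n d hd i hi hik x y

theorem mapFun_enc {i j : ℕ} (hi : 1 ≤ i) (hj : 1 ≤ j) (hij : i + j ≤ k) (x : (𝒢.grp d).G i)
    (y : (𝒢.grp d).G j) :
    𝒢.mapFun n (.ofList [d, .num i, .num j, 𝒢.enc d i x, 𝒢.enc d j y])
      = 𝒢.enc d (i + j) ((𝒢.grp d).e i j x y) :=
  𝒢.map_efficient.choose_spec.2 n d hd i j hi hj hij x y

theorem fst_eq : d.fst = .num (𝒢.grp d).p := by
  obtain ⟨aux, h⟩ := 𝒢.description n d hd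
  have := congrArg Val.fst h
  simpa using this

end GroupGenerator

theorem HashFunction.hashFun_ofBits (H : HashFunction) (n : ℕ) (x : List Bool) :
    H.hashFun n (.ofBits x) = .ofBits (List.ofFn (H.eval n x)) :=
  H.efficient.choose_spec.2 n x

theorem sum_map_range {X : Type*} [AddCommMonoid X] (f : ℕ → X) (m : ℕ) :
    ((List.range m).map f).sum = ∑ i : Fin m, f i := by
  rw [Fin.sum_univ_eq_sum_range f m]
  induction m with
  | zero => simp
  | succ m ih => rw [List.sum_range_succ, Finset.sum_range_succ, ih]

theorem map_range_eq_ofFn {X : Type*} (f : ℕ → X) (m : ℕ) :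
    (List.range m).map f = List.ofFn fun i : Fin m => f i := by
  apply List.ext_getElem <;> simp

/-- Concatenation of blocks of fixed length loses nothing when the number of blocks is known. This
is why only identities of equal depth are compared when a collision is extracted. -/
theorem flatMap_ofFn_injective {l : ℕ} : ∀ {x y : List (Fin l → Bool)}, x.length = y.length →
    x.flatMap List.ofFn = y.flatMap List.ofFn → x = y
  | [], [], _, _ => rfl
  | a :: x, b :: y, h, h' => by
    simp only [List.flatMap_cons] at h'
    obtain ⟨h1, h2⟩ := List.append_inj h' (by simp)
    rw [List.ofFn_injective h1, flatMap_ofFn_injective (by simpa using h) h2]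

namespace Sim

section Bits

variable (H : HashFunction)

theorem bitAt_eq_readBits {l : ℕ} (v : Val) (j : Fin l) : bitAt v j = v.readBits l j := by
  rw [bitAt, Val.nth_eq, Val.readBits, List.getD_eq_getElem?_getD]
  cases v.toList[(j : ℕ)]? <;> simp

theorem bitAt_ofBits {l : ℕ} (x : Fin l → Bool) (j : Fin l) :
    bitAt (.ofBits (List.ofFn x)) j = x j := by
  simp only [bitAt, Val.ofBits, Val.nth_ofList, List.getD_eq_getElem?_getD]
  simp [Val.ofBool]

theorem ofList_flatBits (n : ℕ) (ids : List Val) :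
    Val.ofList (flatBits n ids) = .ofBits ((ids.map (Val.readBits (2 * n))).flatMap List.ofFn) := by
  rw [Val.ofBits, flatBits, List.flatMap_map, List.map_flatMap]
  congr 2
  funext c
  rw [map_range_eq_ofFn, List.map_ofFn]
  congr 1
  funext j
  simp [bitAt_eq_readBits]

theorem ci_eq (n : ℕ) (ids : List Val) (i : ℕ) :
    ci H n ids i = .ofBits (List.ofFn (H.eval n
      (((ids.map (Val.readBits (2 * n))).take (i + 1)).flatMap List.ofFn))) := by
  rw [ci, ofList_flatBits, H.hashFun_ofBits, List.map_take]

theorem readID_eq_some {l L : ℕ} {v : Val} {ID : HierID l L} (h : readID l L v = some ID) :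
    ID.toList = v.toList.map (Val.readBits l) ∧ 1 ≤ v.toList.length ∧ v.toList.length ≤ L := by
  unfold readID at h
  split at h
  · rename_i h'
    simp only [Option.some.injEq] at h
    subst h
    exact ⟨rfl, List.length_pos_of_ne_nil h'.1, h'.2⟩
  · simp at h

theorem readID_eq_none {l L : ℕ} {v : Val} :
    readID l L v = none ↔ ¬ (1 ≤ v.toList.length ∧ v.toList.length ≤ L) := by
  unfold readID
  simp only [Nat.one_le_iff_ne_zero, ne_eq, List.length_eq_zero_iff]
  split <;> simp_all

theorem bitAt_ci {n L : ℕ} {v : Val} {ID : HierID (2 * n) L} (h : readID (2 * n) L v = some ID)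
    (i : Fin ID.depth) (j : Fin (2 * n)) :
    bitAt (ci H n v.toList i) j = ID.encodeCID (H.eval n) i j := by
  rw [ci_eq, bitAt_ofBits, HierID.encodeCID, (readID_eq_some h).1]

end Bits

/-- Fermat's little theorem. Both sides are `0` when `p` divides `k`, since the exponent `p - 2` is
positive for `p ≥ 3`. The truncation is harmless, as residues are no longer than `p`. -/
theorem modInv_eq {p k : ℕ} [Fact p.Prime] (hp : 3 ≤ p) : (modInv p k : ZMod p) = (k : ZMod p)⁻¹ := by
  have hp0 : 0 < p := by omega
  have h := powSucc_eq (X := ZMod p) (op := fun u v => trunc (p.size + 1) (.num (u.toNat * v.toNat % p)))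
    (enc := fun x => .num x.val) (fun x y => by
      simp only [Val.toNat_num]
      rw [trunc_of_le, ZMod.val_mul]
      have := Nat.size_le_size (Nat.mod_lt (x.val * y.val) hp0).le
      simpa using this) (k : ZMod p) (p - 3)
  rw [modInv, ← ZMod.val_natCast, h, Val.toNat_num, ZMod.natCast_zmod_val]
  have hp3 : p - 3 + 1 = p - 2 := by omega
  rw [hp3]
  by_cases hk : (k : ZMod p) = 0
  · rw [hk, inv_zero, zero_pow (by omega)]
  · refine eq_inv_of_mul_eq_one_left ?_
    rw [← pow_succ, show p - 2 + 1 = p - 1 by omega, ZMod.pow_card_sub_one_eq_one hk]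

section Operations

variable {𝒢 : GroupGenerator 3} {n : ℕ} {d : Val} (hd : d ∈ 𝒢.good n)
include hd

theorem mulV_enc {i : ℕ} (hi : 1 ≤ i) (hi3 : i ≤ 3) (x y : (𝒢.grp d).G i) :
    mulV 𝒢 n d i (𝒢.enc d i x) (𝒢.enc d i y) = 𝒢.enc d i (x * y) := by
  rw [mulV, 𝒢.mulFun_enc hd hi hi3, trunc_of_le (𝒢.size_enc_le hd hi hi3 _)]

theorem mapV_enc {i j : ℕ} (hi : 1 ≤ i) (hj : 1 ≤ j) (hij : i + j ≤ 3) (x y : ZMod (𝒢.grp d).p) :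
    mapV 𝒢 n d i j (𝒢.enc d i ((𝒢.grp d).gp i x)) (𝒢.enc d j ((𝒢.grp d).gp j y))
      = 𝒢.enc d (i + j) ((𝒢.grp d).gp (i + j) (x * y)) := by
  rw [mapV, 𝒢.mapFun_enc hd hi hj hij, e_gp hi hj hij]

theorem powV_enc {i : ℕ} (hi : 1 ≤ i) (hi3 : i ≤ 3) (x : ZMod (𝒢.grp d).p) (m : ℕ) :
    powV 𝒢 n d i (𝒢.enc d i ((𝒢.grp d).gp i x)) m = 𝒢.enc d i ((𝒢.grp d).gp i (x * m)) := by
  have hp := (𝒢.grp d).prime.pos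
  rw [powV, powSucc_eq (fun x y => mulV_enc hd hi hi3 x y), 𝒢.fst_eq hd, Val.toNat_num,
    -- The surplus factor `x ^ p` is `1`.
    show m + (𝒢.grp d).p - 1 + 1 = m + (𝒢.grp d).p by omega, pow_add, pow_p_eq_one hi hi3, mul_one,
    gp_pow hi hi3]

theorem genV_zero : genV d 0 = 𝒢.enc d 1 ((𝒢.grp d).gp 1 1) := by
  obtain ⟨aux, h⟩ := 𝒢.description n d hd
  have := congrArg (fun d : Val => d.snd.fst) h
  rw [genV, this, gp_one le_rfl (by norm_num)]
  simp
  rfl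

theorem genV_one : genV d 1 = 𝒢.enc d 2 ((𝒢.grp d).gp 2 1) := by
  obtain ⟨aux, h⟩ := 𝒢.description n d hd
  have := congrArg (fun d : Val => d.snd.fst) h
  rw [genV, this, gp_one (by norm_num) (by norm_num)]
  simp
  rfl

variable {E : Val} {a β : ZMod (𝒢.grp d).p} (hE : envD E = d)
  (ha : envGa E = 𝒢.enc d 1 ((𝒢.grp d).gp 1 a)) (hb : envHb E = 𝒢.enc d 2 ((𝒢.grp d).gp 2 β))
include hE ha

theorem exp1_eq (x z : ℕ) : exp1 𝒢 n E x z = 𝒢.enc d 1 ((𝒢.grp d).gp 1 (x + z * a)) := by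
  rw [exp1, hE, ha, genV_zero hd, powV_enc hd le_rfl (by norm_num), powV_enc hd le_rfl (by norm_num),
    mulV_enc hd le_rfl (by norm_num), ← gp_add le_rfl (by norm_num), one_mul, mul_comm a]

include hb

theorem exp2_eq (x z w : ℕ) :
    exp2 𝒢 n E x z w = 𝒢.enc d 2 ((𝒢.grp d).gp 2 (x + z * a + w * β)) := by
  rw [exp2, hE, ha, hb, genV_zero hd, genV_one hd, powV_enc hd (by norm_num) (by norm_num),
    mapV_enc hd le_rfl le_rfl (by norm_num), powV_enc hd (by norm_num) (by norm_num),
    powV_enc hd (by norm_num) (by norm_num), mulV_enc hd (by norm_num) (by norm_num),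
    mulV_enc hd (by norm_num) (by norm_num), ← gp_add (by norm_num) (by norm_num),
    ← gp_add (by norm_num) (by norm_num), one_mul, mul_one, mul_comm a, mul_comm β]

end Operations

end Sim


/-! ### Correctness of the simulator -/

/-- The private key with given exponents. -/
def keyDet {M : MultilinearGroup 3} {l₁ l₂ L : ℕ} (H : List Bool → (Fin l₁ → Bool))
    (PP : PublicParams M l₁ l₂ L) (α : ZMod M.p) (ID : HierID l₁ L) (T : Fin l₂ → Bool)
    (r : Fin ID.depth → ZMod M.p) (rlast : ZMod M.p) : PrivateKey M ID.depth where
  D0 := M.g 2 ^ α.val * (∏ i, PP.F2 (ID.level i) (ID.encodeCID H i) ^ (r i).val)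
      * PP.H2 T ^ rlast.val
  D := fun i => (M.g 2 ^ (r i).val)⁻¹
  Dlast := (M.g 2 ^ rlast.val)⁻¹

namespace Sim

variable {𝒢 : GroupGenerator 3} {H : HashFunction} {L : ℕ → ℕ} {A : Adversary} {n : ℕ}

/-- The public parameters of the simulator. -/
def simParams (M : MultilinearGroup 3) (L : ℕ → ℕ) (n : ℕ) (E : Val)
    (ω : ℕ → ℕ → Bool → ZMod M.p) (a β : ZMod M.p) : PublicParams M (2 * n) n (L n) where
  f0 i := M.gp 1 (ω i (2 * n) false + delta0 L n E i * a)
  f i j b := M.gp 1 (ω i j b + delta L n E i j b * a)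
  h0 := M.gp 1 (ω (L n) (2 * n) false + delta0 L n E (L n) * a)
  h j b := M.gp 1 (ω (L n) j b + delta L n E (L n) j b * a)
  Lam := M.gp 3 (a * β)

section Hashes

variable {M : MultilinearGroup 3} {E : Val} {a β : ZMod M.p}

theorem rowLength_of_lt {row : ℕ} (h : row < L n) : rowLength L n row = 2 * n :=
  if_neg h.ne

theorem rowLength_self : rowLength L n (L n) = n := if_pos rfl

/-- Collecting terms splits the exponent of a hash value into the known part `K` and the multiple
`J` of the secret `a`. -/
theorem coeff_cast {row l : ℕ} (hl : rowLength L n row = l) {w : Val} {x : Fin l → Bool}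
    (hw : ∀ j : Fin l, bitAt w j = x j) :
    ((u L A n E row (2 * n) false : ZMod M.p) + delta0 L n E row * a)
        + ∑ j : Fin l, ((u L A n E row j (x j) : ZMod M.p) + delta L n E row j (x j) * a)
      = coeffK L A n E row w + coeffJ L n E row w * a := by
  subst hl
  simp only [coeffK, coeffJ, u0, sum_map_range, Nat.cast_add, Nat.cast_sum, hw,
    Finset.sum_add_distrib, ← Finset.sum_mul]
  ring

theorem F_eq {row : Fin (L n)} {w : Val} {x : Fin (2 * n) → Bool}
    (hw : ∀ j : Fin (2 * n), bitAt w j = x j) :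
    (simParams M L n E (fun i j b => (u L A n E i j b : ZMod M.p)) a β).F1 row x
        = M.gp 1 (coeffK L A n E row w + coeffJ L n E row w * a) ∧
      (simParams M L n E (fun i j b => (u L A n E i j b : ZMod M.p)) a β).F2 row x
        = M.gp 2 (coeffK L A n E row w + coeffJ L n E row w * a) := by
  have := coeff_cast (M := M) (A := A) (E := E) (a := a) (rowLength_of_lt row.2) hw
  simp only [PublicParams.F1, PublicParams.F2, simParams, toLevelTwo_gp]
  rw [selectProd_gp le_rfl (by norm_num), selectProd_gp (by norm_num) (by norm_num), this]
  exact ⟨rfl, rfl⟩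

theorem H_eq {w : Val} {x : Fin n → Bool} (hw : ∀ j : Fin n, bitAt w j = x j) :
    (simParams M L n E (fun i j b => (u L A n E i j b : ZMod M.p)) a β).H1 x
        = M.gp 1 (coeffK L A n E (L n) w + coeffJ L n E (L n) w * a) ∧
      (simParams M L n E (fun i j b => (u L A n E i j b : ZMod M.p)) a β).H2 x
        = M.gp 2 (coeffK L A n E (L n) w + coeffJ L n E (L n) w * a) := by
  have := coeff_cast (M := M) (A := A) (E := E) (a := a) (rowLength_self (L := L)) hw
  simp only [PublicParams.H1, PublicParams.H2, simParams, toLevelTwo_gp]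
  rw [selectProd_gp le_rfl (by norm_num), selectProd_gp (by norm_num) (by norm_num), this]
  exact ⟨rfl, rfl⟩

end Hashes

theorem delta_le (E : Val) (row j : ℕ) (b : Bool) : delta L n E row j b ≤ 1 := by
  unfold delta; split_ifs <;> simp

theorem delta0_le (E : Val) (row : ℕ) : delta0 L n E row ≤ 1 := by
  unfold delta0; split_ifs <;> simp

/-- A sum of at most `2 n` bits and one constant term. With `p > 2 n + 1` a nonzero `J` remains
nonzero modulo `p`. -/
theorem coeffJ_le (E : Val) (row : ℕ) (w : Val) : coeffJ L n E row w ≤ 2 * n + 1 := by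
  have h1 : rowLength L n row ≤ 2 * n := by unfold rowLength; split <;> omega
  have h2 : ∑ j : Fin (rowLength L n row), delta L n E row j (bitAt w j) ≤ rowLength L n row := by
    simpa using Finset.sum_le_sum (s := Finset.univ)
      fun (j : Fin (rowLength L n row)) _ => delta_le (L := L) (n := n) E row j (bitAt w j)
  rw [coeffJ, sum_map_range]
  have := delta0_le (L := L) (n := n) E row
  omega

theorem coeffJ_eq_zero {E : Val} {row l : ℕ} (hl : rowLength L n row = l) {w : Val} :
    coeffJ L n E row w = 0 ↔
      delta0 L n E row = 0 ∧ ∀ j : Fin l, delta L n E row j (bitAt w j) = 0 := by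
  subst hl
  rw [coeffJ, sum_map_range, Nat.add_eq_zero_iff, Finset.sum_eq_zero_iff]
  simp

theorem coeffJ_time_eq_zero {E : Val} {w : Val} :
    coeffJ L n E (L n) w = 0 ↔ w.readBits n = (envT E).readBits n := by
  rw [coeffJ_eq_zero rowLength_self, funext_iff]
  simp [delta0, delta, bitAt_eq_readBits]

/-- In a level of the target, `J` is a Hamming distance. In a deeper level the constant term
contributes `1` and the bits nothing, so `J` never vanishes. -/
theorem coeffJ_level_eq_zero {E : Val} {row : ℕ} (hrow : row < L n) {w : Val} :
    coeffJ L n E row w = 0 ↔ row < (envIds E).length ∧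
      ∀ j : Fin (2 * n), bitAt w j = bitAt ((envCis E).nth row) j := by
  rw [coeffJ_eq_zero (rowLength_of_lt hrow)]
  by_cases h : row < (envIds E).length <;> simp [delta0, delta, hrow.ne, h]

/-! ### Simulated parameters and the cancellation in private keys -/

section Key

variable {d : Val} (hd : d ∈ 𝒢.good n) {E : Val} {a β : ZMod (𝒢.grp d).p} (hE : envD E = d)
  (ha : envGa E = 𝒢.enc d 1 ((𝒢.grp d).gp 1 a)) (hb : envHb E = 𝒢.enc d 2 ((𝒢.grp d).gp 2 β))
include hd hE ha hb

theorem params_eq : params 𝒢 L A n E = encParams 𝒢 d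
    (simParams (𝒢.grp d) L n E (fun i j b => (u L A n E i j b : ZMod (𝒢.grp d).p)) a β) := by
  have hp : ∀ row j : ℕ, paramPair 𝒢 L A n E row j = .pair
      (𝒢.enc d 1 ((𝒢.grp d).gp 1 (u L A n E row j false + delta L n E row j false * a)))
      (𝒢.enc d 1 ((𝒢.grp d).gp 1 (u L A n E row j true + delta L n E row j true * a))) := by
    intro row j
    rw [paramPair, exp1_eq hd hE ha, exp1_eq hd hE ha]
  have hr : ∀ row : ℕ, paramRow 𝒢 L A n E row = .pair
      (𝒢.enc d 1 ((𝒢.grp d).gp 1 (u L A n E row (2 * n) false + delta0 L n E row * a)))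
      (.ofList (List.ofFn fun j : Fin (rowLength L n row) => paramPair 𝒢 L A n E row j)) := by
    intro row
    rw [paramRow, exp1_eq hd hE ha, map_range_eq_ofFn, u0]
  have hl : mapV 𝒢 n (envD E) 1 2 (envGa E) (envHb E) = 𝒢.enc d 3 ((𝒢.grp d).gp 3 (a * β)) := by
    rw [hE, ha, hb, mapV_enc hd le_rfl (by norm_num) (by norm_num)]
  rw [params, hl, encParams, map_range_eq_ofFn, hr, rowLength_self, hE]
  have : ∀ i : Fin (L n), paramRow 𝒢 L A n E i = .pair
      (𝒢.enc d 1 ((𝒢.grp d).gp 1 (u L A n E i (2 * n) false + delta0 L n E i * a)))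
      (.ofList (List.ofFn fun j : Fin (2 * n) => paramPair 𝒢 L A n E i j)) := by
    intro i
    rw [hr, rowLength_of_lt i.2]
  simp only [this, hp]
  rfl

/-- With `s = β / J`, the row `piv` contributes `-(K + J a) s`, and `J a s = a β` cancels the master
key. What remains is linear in `a` and `β` separately, so it can be computed in level two. The
simulated key is thus a genuine one whose exponents are shifted by `s` in row `piv`. -/
theorem key_eq {v : Val} {ID : HierID (2 * n) (L n)} (hID : readID (2 * n) (L n) v.fst = some ID)
    (hp3 : 3 ≤ (𝒢.grp d).p) (t piv : ℕ) (hpiv : piv = L n ∨ piv < ID.depth) (s : ZMod (𝒢.grp d).p)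
    (hs : s * coeffJ L n E piv (word H L n v.fst.toList v.snd piv) = β) (hJ :
      (coeffJ L n E piv (word H L n v.fst.toList v.snd piv) : ZMod (𝒢.grp d).p) ≠ 0) :
    key 𝒢 H L A n E t v.fst.toList v.snd piv = encKey 𝒢 d (keyDet (H.eval n)
      (simParams (𝒢.grp d) L n E (fun i j b => (u L A n E i j b : ZMod (𝒢.grp d).p)) a β) (a * β) ID
      (v.snd.readBits n)
      (fun i => keyRnd L A n E t i - if (i : ℕ) = piv then s else 0)
      (keyRnd L A n E t (L n) - if piv = L n then s else 0)) := by
  obtain ⟨hIDl, h1, hIDL⟩ := readID_eq_some hID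
  have hlen : ID.depth = v.fst.toList.length := by rw [HierID.depth, hIDl, List.length_map]
  have hpp : (envD E).fst.toNat = (𝒢.grp d).p := by rw [hE, 𝒢.fst_eq hd, Val.toNat_num]
  have hneg : (((𝒢.grp d).p - 1 : ℕ) : ZMod (𝒢.grp d).p) = -1 := by
    rw [Nat.cast_sub (𝒢.grp d).prime.one_le]; simp
  set J := coeffJ L n E piv (word H L n v.fst.toList v.snd piv) with hJdef
  set K := coeffK L A n E piv (word H L n v.fst.toList v.snd piv) with hKdef
  have hinv : ((modInv (𝒢.grp d).p J : ℕ) : ZMod (𝒢.grp d).p) * β = s := by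
    rw [modInv_eq hp3, ← hs]; field_simp
  have hF : ∀ i : Fin ID.depth,
      (simParams (𝒢.grp d) L n E (fun i j b => (u L A n E i j b : ZMod (𝒢.grp d).p)) a β).F2
      (ID.level i) (ID.encodeCID (H.eval n) i) = (𝒢.grp d).gp 2 (coeffK L A n E i (ci H n v.fst.toList i)
        + coeffJ L n E i (ci H n v.fst.toList i) * a) := fun i =>
    (F_eq (row := ID.level i) (bitAt_ci H hID i)).2
  have hT := (H_eq (M := 𝒢.grp d) (A := A) (E := E) (a := a) (β := β) (L := L)
    (bitAt_eq_readBits (l := n) v.snd)).2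
  simp only [key, ← hJdef, ← hKdef, hpp, exp2_eq hd hE ha hb, encKey, keyDet]
  rw [← hlen]
  simp only [sum_map_range]
  rw [map_range_eq_ofFn]
  congr 2
  · simp only [hF, hT, gp_pow_val (M := 𝒢.grp d) (i := 2) (by norm_num) (by norm_num)]
    rw [← gp_sum (by norm_num) (by norm_num)]
    change _ = 𝒢.enc d 2 ((𝒢.grp d).gp 2 _ * _ * _)
    rw [← gp_add (by norm_num) (by norm_num), ← gp_add (by norm_num) (by norm_num)]
    congr 2
    simp only [Nat.cast_add, Nat.cast_sum, Nat.cast_mul, hneg, mul_sub, mul_ite,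
      mul_zero, Finset.sum_sub_distrib]
    -- The shift occurs once: among the levels, or in the time row (`hKT`). The alternatives exclude
    -- each other because a level is less than `L n`.
    have hsum : ∑ x : Fin ID.depth, (if (x : ℕ) = piv then
        ((coeffK L A n E x (ci H n v.fst.toList x) : ZMod (𝒢.grp d).p)
          + coeffJ L n E x (ci H n v.fst.toList x) * a) * s else 0)
        = if piv = L n then 0 else (K + J * a) * s := by
      split_ifs with h
      · refine Finset.sum_eq_zero fun x _ => if_neg ?_
        have := x.2
        omega
      · have hlt : piv < ID.depth := hpiv.resolve_left h
        rw [Finset.sum_eq_single_of_mem ⟨piv, hlt⟩ (Finset.mem_univ _)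
          fun x _ hx => if_neg fun hx' => hx (Fin.ext hx'), if_pos rfl, hJdef, hKdef, word, if_neg h]
    have hKT : (if piv = L n then ((coeffK L A n E (L n) v.snd : ZMod (𝒢.grp d).p)
        + coeffJ L n E (L n) v.snd * a) * s else 0) = if piv = L n then (K + J * a) * s else 0 := by
      split_ifs with h
      · rw [hJdef, hKdef, word, if_pos h, h]
      · rfl
    rw [hsum, hKT]
    simp only [add_mul, Finset.sum_add_distrib, Finset.sum_mul]
    have e1 : (-1 * (K : ZMod (𝒢.grp d).p) * modInv (𝒢.grp d).p J) * β = - (K * s) := by rw [← hinv]; ring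
    rw [e1]
    -- The cancellation: the unknown product is exactly what the shift of the pivot row removes.
    have e2 : a * β = J * a * s := by rw [← hs]; ring
    have e3 : ∀ x : Fin ID.depth, (coeffJ L n E x (ci H n v.fst.toList x) : ZMod (𝒢.grp d).p) *
        keyRnd L A n E t x * a = coeffJ L n E x (ci H n v.fst.toList x) * a * keyRnd L A n E t x :=
      fun x => by ring
    simp only [e3]
    split_ifs with h <;> rw [e2] <;> ring
  · have e : ∀ i : Fin ID.depth,
        ((((𝒢.grp d).p - 1) * keyRnd L A n E t i : ℕ) : ZMod (𝒢.grp d).p) + (0 : ℕ) * a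
        + ((if (i : ℕ) = piv then modInv (𝒢.grp d).p J else 0 : ℕ) : ZMod (𝒢.grp d).p) * β
        = -(keyRnd L A n E t i - if (i : ℕ) = piv then s else 0) := by
      intro i
      rw [Nat.cast_mul, hneg]
      split_ifs <;> simp [hinv]
      ring
    have e' : ((((𝒢.grp d).p - 1) * keyRnd L A n E t (L n) : ℕ) : ZMod (𝒢.grp d).p) + (0 : ℕ) * a
        + ((if piv = L n then modInv (𝒢.grp d).p J else 0 : ℕ) : ZMod (𝒢.grp d).p) * β
        = -(keyRnd L A n E t (L n) - if piv = L n then s else 0) := by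
      rw [Nat.cast_mul, hneg]
      split_ifs <;> simp [hinv]
      ring
    rw [e']
    simp only [e, gp_neg (M := 𝒢.grp d) (i := 2) (by norm_num) (by norm_num)]
    rfl

end Key

end Sim

/-- The messages received in a phase of queries, when the answers are determined by the queries
and by given random choices. -/
def feed {X : Type*} (move : List Val → Val) (ans : X → Val → Val) (xs : List X) (R : List Val) :
    List Val :=
  xs.foldl (fun R x => R ++ [ans x (move R)]) R

namespace Sim

/-! ### Collisions hidden in the queries -/

section Defs

variable (H : HashFunction) (L : ℕ → ℕ) (A : Adversary) (n : ℕ)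

/-- The hashes of the prefixes of an identity. -/
noncomputable def hashes (ids : Val) : Val :=
  .ofList ((List.range ids.toList.length).map fun i => ci H n ids.toList i)

/-- The collision of the hash function, if any, contained in an identity and the target. -/
noncomputable def candidate (ids ids' : List Val) : Val :=
  if 1 ≤ ids.length ∧ ids.length ≤ L n ∧ ids.length ≤ ids'.length then
    if Val.ofList (flatBits n ids) = .ofList (flatBits n (ids'.take ids.length)) then .num 0
    else if H.hashFun n (.ofList (flatBits n ids))
        = H.hashFun n (.ofList (flatBits n (ids'.take ids.length))) then
      .pair (.ofList (flatBits n ids)) (.ofList (flatBits n (ids'.take ids.length)))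
    else .num 0
  else .num 0

/-- The first collision in the queries of the adversary, if any. -/
noncomputable def search (ρ : ℕ) (ids' R : Val) : Val :=
  firstNonzero ((List.range (R.toList.length + 1)).map fun k =>
    candidate H L n (move A n ρ (.ofList (R.toList.take k))).fst.toList ids'.toList)

/-- The row of a query whose exponent is shifted. -/
noncomputable def pivot (E v : Val) : ℕ :=
  if coeffJ L n E (L n) v.snd = 0 then v.fst.toList.length - 1 else L n

/-- The coefficient of `a` in the row `pivot`. -/
noncomputable def pivotJ (E v : Val) : ℕ :=
  coeffJ L n E (pivot L n E v) (word H L n v.fst.toList v.snd (pivot L n E v))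

end Defs

section Time

variable (H : HashFunction) {L : ℕ → ℕ} (A : Adversary) (hL : FN fun n _ => L n)

theorem fp_hashes {ids : ℕ → Val → Val} (h : FP ids) : FP fun n x => hashes H n (ids n x) :=
  FL.map_range (g := fun n i x => ci H n (ids n x).toList i.toNat) (FN.length (FL.toList h))
    (PB.length (FL.toList h)) (fp_ci H (FL.toList (h.comp FP.id.snd)) FP.id.fst.toNat)

include hL

theorem fp_candidate {ids ids' : ℕ → Val → List Val} (h : FL ids) (h' : FL ids') :
    FP fun n x => candidate H L n (ids n x) (ids' n x) := by
  have hf := fl_flatBits h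
  have hf' := fl_flatBits (FL.take (FN.length h) h')
  exact FP.ite (((FP.num 1).leNat (FN.length h)).and
    (((FN.length h).leNat hL).and ((FN.length h).leNat (FN.length h'))))
    (FP.ite (hf.eq hf') (FP.num 0) (FP.ite ((H.fp_hashFun.comp hf).eq (H.fp_hashFun.comp hf'))
      (hf.pair hf') (FP.num 0))) (FP.num 0)

theorem fp_search {ρ : ℕ → Val → ℕ} {ids' R : ℕ → Val → Val} (hρ : FN ρ) (h' : FP ids') (hR : FP R) :
    FP fun n x => search H L A n (ρ n x) (ids' n x) (R n x) := by
  have hR' : FP fun n z => R n z.snd := hR.comp FP.id.snd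
  have hρ' : FN fun n z => ρ n z.snd := FP.comp hρ FP.id.snd
  exact FP.firstNonzero (FL.map_range
    (g := fun n k x => candidate H L n (move A n (ρ n x)
      (.ofList ((R n x).toList.take k.toNat))).fst.toList (ids' n x).toList)
    ((FN.length (FL.toList hR)).add (FP.num 1)) ((PB.length (FL.toList hR)).add (PB.const 1))
    (fp_candidate H hL
      (FL.toList (fp_move A hρ' (FL.take FP.id.fst.toNat (FL.toList hR'))).fst)
      (FL.toList (h'.comp FP.id.snd))))

end Time

variable {𝒢 : GroupGenerator 3} {H : HashFunction} {L : ℕ → ℕ} {A : Adversary} {n : ℕ}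

theorem isCollision_of_candidate_ne {ids ids' : List Val} (h : candidate H L n ids ids' ≠ .num 0) :
    H.IsCollision n (candidate H L n ids ids') := by
  unfold candidate at h ⊢
  split_ifs at h ⊢ with h1 h2 h3
  · simp at h
  · rw [ofList_flatBits] at h2 h3 ⊢
    rw [ofList_flatBits] at h2 h3 ⊢
    rw [H.hashFun_ofBits, H.hashFun_ofBits] at h3
    exact ⟨_, _, rfl, fun h => h2 (congrArg _ h), List.ofFn_injective (Val.ofBits_injective h3)⟩
  · simp at h
  · simp at h

/-- The search replays the adversary on every prefix of the message list, including prefixes that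
are not followed by a query. This does no harm, since a nonzero candidate is always a collision. -/
theorem isCollision_search {ρ : ℕ} {ids' : Val} {R : List Val} {k : ℕ} (hk : k ≤ R.length)
    (h : candidate H L n (A.move n ρ (R.take k)).fst.toList ids'.toList ≠ .num 0) :
    H.IsCollision n (search H L A n ρ ids' (.ofList R)) := by
  unfold search
  set l := (List.range ((Val.ofList R).toList.length + 1)).map fun k =>
    candidate H L n (move A n ρ (.ofList ((Val.ofList R).toList.take k))).fst.toList ids'.toList with hl
  have hmem : candidate H L n (A.move n ρ (R.take k)).fst.toList ids'.toList ∈ l := by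
    rw [hl, List.mem_map]
    refine ⟨k, by simpa using Nat.lt_succ_of_le hk, ?_⟩
    rw [Val.toList_ofList]
    rfl
  rcases firstNonzero_spec l with h' | ⟨h1, h2⟩
  · exact absurd (h'.2 _ hmem) h
  · rw [hl, List.mem_map] at h2
    obtain ⟨j, -, hj⟩ := h2
    rw [← hj] at h1 ⊢
    exact isCollision_of_candidate_ne h1

/-! ### When the simulator cannot answer -/

section Target

variable {E tgt : Val} (hids : envIds E = tgt.fst.toList) (hT : envT E = tgt.snd)
  (hcis : envCis E = hashes H n tgt.fst) {ID' : HierID (2 * n) (L n)}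
  (hID' : readID (2 * n) (L n) tgt.fst = some ID')
include hcis

theorem envCis_nth {i : ℕ} (hi : i < tgt.fst.toList.length) :
    (envCis E).nth i = ci H n tgt.fst.toList i := by
  rw [hcis, hashes, Val.nth_ofList, List.getD_eq_getElem _ _ (by simpa using hi)]
  simp

include hids

omit hcis in
theorem coeffJ_target {i : ℕ} (hi : i < tgt.fst.toList.length) (hiL : i < L n) :
    coeffJ L n E i ((envCis E).nth i) = 0 := by
  rw [coeffJ_level_eq_zero hiL, hids]
  exact ⟨hi, fun _ => rfl⟩

include hT hID'

variable {v : Val} {ID : HierID (2 * n) (L n)} (hID : readID (2 * n) (L n) v.fst = some ID)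
include hID

/-- The word in the last level is the hash of the whole identity, so `J = 0` there compares it with
the hash of the target truncated to the same depth. -/
theorem coeffJ_eq_zero_iff_last :
    (coeffJ L n E (L n) v.snd = 0 ∧ coeffJ L n E (v.fst.toList.length - 1)
      (ci H n v.fst.toList (v.fst.toList.length - 1)) = 0) ↔
    v.snd.readBits n = tgt.snd.readBits n ∧ ID.depth ≤ ID'.depth ∧
      H.eval n (ID.toList.flatMap List.ofFn)
        = H.eval n ((ID'.toList.take ID.depth).flatMap List.ofFn) := by
  obtain ⟨h1, h2, h3⟩ := readID_eq_some hID
  obtain ⟨h1', h2', h3'⟩ := readID_eq_some hID'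
  have hl : ID.depth = v.fst.toList.length := by rw [HierID.depth, h1, List.length_map]
  have hl' : ID'.depth = tgt.fst.toList.length := by rw [HierID.depth, h1', List.length_map]
  rw [coeffJ_time_eq_zero, hT, coeffJ_level_eq_zero (by omega), hids, hl, hl', h1, h1']
  have hlt : v.fst.toList.length - 1 < tgt.fst.toList.length ↔
      v.fst.toList.length ≤ tgt.fst.toList.length := by omega
  rw [hlt]
  refine and_congr_right fun _ => and_congr_right fun hle => ?_
  rw [envCis_nth hcis (by omega), ci_eq, ci_eq, Nat.sub_add_cancel h2, List.take_of_length_le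
    (i := v.fst.toList.length) (by simp), funext_iff]
  simp only [bitAt_ofBits]

theorem coeffJ_eq_zero_of_prefix (h : ID.toList <+: ID'.toList)
    (h' : v.snd.readBits n = tgt.snd.readBits n) :
    coeffJ L n E (L n) v.snd = 0 ∧ coeffJ L n E (v.fst.toList.length - 1)
      (ci H n v.fst.toList (v.fst.toList.length - 1)) = 0 := by
  rw [coeffJ_eq_zero_iff_last hids hT hcis hID' hID]
  exact ⟨h', h.length_le, by rw [← List.prefix_iff_eq_take.1 h]⟩

/-- Equal hashes come from equal strings when the candidate is `0`, and strings of equally many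
components determine the components. So without a collision the simulator fails only on forbidden
queries. -/
theorem prefix_of_coeffJ_eq_zero (hc : candidate H L n v.fst.toList tgt.fst.toList = .num 0)
    (h : coeffJ L n E (L n) v.snd = 0 ∧ coeffJ L n E (v.fst.toList.length - 1)
      (ci H n v.fst.toList (v.fst.toList.length - 1)) = 0) :
    ID.toList <+: ID'.toList ∧ v.snd.readBits n = tgt.snd.readBits n := by
  rw [coeffJ_eq_zero_iff_last hids hT hcis hID' hID] at h
  obtain ⟨hT, hle, hH⟩ := h
  obtain ⟨h1, h2, h3⟩ := readID_eq_some hID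
  obtain ⟨h1', h2', h3'⟩ := readID_eq_some hID'
  have hl : ID.depth = v.fst.toList.length := by rw [HierID.depth, h1, List.length_map]
  have hl' : ID'.depth = tgt.fst.toList.length := by rw [HierID.depth, h1', List.length_map]
  refine ⟨?_, hT⟩
  rw [List.prefix_iff_eq_take]
  apply flatMap_ofFn_injective
  · rw [List.length_take]; simpa using hle
  · by_contra hne
    rw [candidate, if_pos ⟨h2, h3, by omega⟩, ofList_flatBits, ofList_flatBits, List.map_take, ← h1,
      ← h1', ← hl, if_neg (fun h => hne (Val.ofBits_injective h)), H.hashFun_ofBits,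
      H.hashFun_ofBits, if_pos (by rw [hH])] at hc
    simp at hc

end Target

/-! ### Answers as functions of predetermined exponents -/

section Answers

variable {d : Val}

/-- The encoded private key for the query `v`, with random exponents `x`. -/
noncomputable def keyOf (H : HashFunction) (PP : PublicParams (𝒢.grp d) (2 * n) n (L n))
    (α : ZMod (𝒢.grp d).p) (v : Val) (ID : HierID (2 * n) (L n))
    (x : Fin (L n + 1) → ZMod (𝒢.grp d).p) : Val :=
  encKey 𝒢 d (keyDet (H.eval n) PP α ID (v.snd.readBits n) (fun i => x (ID.level i).castSucc)
    (x (Fin.last _)))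

/-- The shift of the random exponents by which the simulator makes up for the unknown key. -/
noncomputable def shift (H : HashFunction) {p : ℕ} (E v : Val) (β : ZMod p) :
    Fin (L n + 1) → ZMod p :=
  fun i => if (i : ℕ) = pivot L n E v then β * (pivotJ H L n E v : ZMod p)⁻¹ else 0

/-- The answers of the simulator. -/
noncomputable def simAnswer (H : HashFunction) (E : Val)
    (PP : PublicParams (𝒢.grp d) (2 * n) n (L n)) (a β : ZMod (𝒢.grp d).p)
    (x : Fin (L n + 1) → ZMod (𝒢.grp d).p) (v : Val) : Val :=
  match readID (2 * n) (L n) v.fst with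
  | none => .num 0
  | some ID =>
    if coeffJ L n E (L n) v.snd = 0 ∧ coeffJ L n E (v.fst.toList.length - 1)
      (ci H n v.fst.toList (v.fst.toList.length - 1)) = 0 then .num 0
    else keyOf H PP (a * β) v ID (x - shift H E v β)

open Classical in
/-- The answers of the challenger. -/
noncomputable def realAnswer (H : HashFunction) (PP : PublicParams (𝒢.grp d) (2 * n) n (L n))
    (α : ZMod (𝒢.grp d).p) (ID' : HierID (2 * n) (L n)) (T' : Fin n → Bool)
    (x : Fin (L n + 1) → ZMod (𝒢.grp d).p) (v : Val) : Val :=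
  match readID (2 * n) (L n) v.fst with
  | none => .num 0
  | some ID =>
    if ID.toList <+: ID'.toList ∧ v.snd.readBits n = T' then .num 0 else keyOf H PP α v ID x

/-- This makes the truncation in `step` invisible. -/
theorem size_simAnswer_le (hd : d ∈ 𝒢.good n) (E : Val)
    (PP : PublicParams (𝒢.grp d) (2 * n) n (L n)) (a β : ZMod (𝒢.grp d).p)
    (x : Fin (L n + 1) → ZMod (𝒢.grp d).p) (v : Val) :
    (simAnswer H E PP a β x v).size ≤ keyBound 𝒢 L n := by
  have h0 : (Val.num 0).size ≤ keyBound 𝒢 L n := by simp [keyBound]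
  unfold simAnswer
  split
  · exact h0
  · split_ifs
    · exact h0
    · rename_i ID _ _
      have h2 : ∀ x, (𝒢.enc d 2 x).size ≤ 𝒢.encBound n := 𝒢.size_enc_le hd (by norm_num) (by norm_num)
      unfold keyOf encKey
      -- A key is a list of three entries, the longest possible being the list of at most `L n`
      -- group elements.
      refine (Val.size_ofList_le _ (L n * (𝒢.encBound n + 1) + 𝒢.encBound n + 1) ?_).trans ?_
      · intro v hv
        simp only [List.mem_cons, List.not_mem_nil, or_false] at hv
        rcases hv with rfl | rfl | rfl
        · exact (h2 _).trans (by omega)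
        · refine (Val.size_ofList_le _ (𝒢.encBound n) ?_).trans ?_
          · intro v hv
            obtain ⟨i, rfl⟩ := List.mem_ofFn.1 hv
            exact h2 _
          · rw [List.length_ofFn]
            have : ID.depth * _ ≤ _ := Nat.mul_le_mul_right (𝒢.encBound n + 1) ID.length_le
            omega
        · exact (h2 _).trans (by omega)
      · simp [keyBound]

theorem pivotJ_cast_ne_zero {E v : Val} {p : ℕ} (hp : 2 * n + 1 < p)
    (h : ¬ (coeffJ L n E (L n) v.snd = 0 ∧ coeffJ L n E (v.fst.toList.length - 1)
      (ci H n v.fst.toList (v.fst.toList.length - 1)) = 0))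
    (hl : v.fst.toList.length - 1 < L n) : (pivotJ H L n E v : ZMod p) ≠ 0 := by
  have hne : pivotJ H L n E v ≠ 0 := by
    unfold pivotJ pivot word
    by_cases h1 : coeffJ L n E (L n) v.snd = 0
    · rw [if_pos h1, if_neg hl.ne]
      exact fun h3 => h ⟨h1, h3⟩
    · rwa [if_neg h1, if_pos rfl]
  have hle : pivotJ H L n E v ≤ 2 * n + 1 := coeffJ_le _ _ _
  rw [Ne, ZMod.natCast_eq_zero_iff]
  exact fun h => hne (Nat.eq_zero_of_dvd_of_lt h (by omega))

variable {E : Val} {a β : ZMod (𝒢.grp d).p}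

/-- Passage from data to mathematics: from here on the simulator is described by group elements, and
its running time no longer matters. -/
theorem answer_eq (hd : d ∈ 𝒢.good n) (hE : envD E = d)
    (ha : envGa E = 𝒢.enc d 1 ((𝒢.grp d).gp 1 a)) (hb : envHb E = 𝒢.enc d 2 ((𝒢.grp d).gp 2 β))
    (hp : 2 * n + 1 < (𝒢.grp d).p) (hp3 : 3 ≤ (𝒢.grp d).p) (t : ℕ) (v : Val) :
    answer 𝒢 H L A n E t v = simAnswer H E
      (simParams (𝒢.grp d) L n E (fun i j b => (u L A n E i j b : ZMod (𝒢.grp d).p)) a β) a β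
      (fun i => (keyRnd L A n E t i : ZMod (𝒢.grp d).p)) v := by
  unfold answer simAnswer
  cases hID : readID (2 * n) (L n) v.fst with
  | none => rw [if_neg (readID_eq_none.1 hID)]
  | some ID =>
    obtain ⟨h1, h2, h3⟩ := readID_eq_some hID
    have hl : ID.depth = v.fst.toList.length := by rw [HierID.depth, h1, List.length_map]
    rw [if_pos ⟨h2, h3⟩]
    simp only
    by_cases hz : coeffJ L n E (L n) v.snd = 0 ∧ coeffJ L n E (v.fst.toList.length - 1)
        (ci H n v.fst.toList (v.fst.toList.length - 1)) = 0
    · rw [if_pos hz, if_pos hz.1, if_pos hz.2]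
    · rw [if_neg hz]
      have hne := pivotJ_cast_ne_zero hp hz (by omega)
      have hkey : key 𝒢 H L A n E t v.fst.toList v.snd (pivot L n E v) = _ :=
        key_eq hd hE ha hb hID hp3 t (pivot L n E v) (by unfold pivot; split_ifs <;> omega)
        (β * (pivotJ H L n E v : ZMod (𝒢.grp d).p)⁻¹) (by
          rw [mul_assoc, ← pivotJ, inv_mul_cancel₀ hne, mul_one]) hne
      trans key 𝒢 H L A n E t v.fst.toList v.snd (pivot L n E v)
      · unfold pivot
        split_ifs with h4 h5
        · exact absurd ⟨h4, h5⟩ hz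
        · rfl
        · rfl
      · rw [hkey, keyOf]
        simp [shift, eq_comm (a := L n)]

end Answers

end Sim

theorem length_feed {X : Type*} (move : List Val → Val) (ans : X → Val → Val) (xs : List X) :
    ∀ R, (feed move ans xs R).length = R.length + xs.length := by
  induction xs with
  | nil => simp [feed]
  | cons x xs ih =>
    intro R
    have : feed move ans (x :: xs) R = feed move ans xs (R ++ [ans x (move R)]) := rfl
    rw [this, ih]
    simp
    omega

namespace Sim

variable {𝒢 : GroupGenerator 3} {H : HashFunction} {L : ℕ → ℕ} {A : Adversary} {n : ℕ} {d : Val}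

/-- The messages that the adversary receives, for given parameters, challenge, answers to the
queries, and random choices. -/
noncomputable def transcript {X : Type*} (A : Adversary) (n ρ : ℕ) (ans : X → Val → Val)
    (PP ch : Val) (xs₁ : Fin (A.q₁.eval n) → X) (xs₂ : Fin (A.q₂.eval n) → X) : List Val :=
  feed (A.move n ρ) ans (List.ofFn xs₂) (feed (A.move n ρ) ans (List.ofFn xs₁) [PP] ++ [ch])

/-! ### The transcript produced by the simulator -/

section Run

variable {E : Val} {a β : ZMod (𝒢.grp d).p} (hd : d ∈ 𝒢.good n) (hE : envD E = d)
  (ha : envGa E = 𝒢.enc d 1 ((𝒢.grp d).gp 1 a)) (hb : envHb E = 𝒢.enc d 2 ((𝒢.grp d).gp 2 β))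
  (hp : 2 * n + 1 < (𝒢.grp d).p) (hp3 : 3 ≤ (𝒢.grp d).p)
include hd hE ha hb hp hp3

/-- The number of messages already received selects the row of exponents, so every query gets fresh
ones. -/
theorem iterate_step_eq (m : ℕ) : ∀ R : List Val,
    (fun R => step 𝒢 H L A n E R)^[m] (.ofList R) = .ofList (feed (A.move n (envRho E))
      (simAnswer H E (simParams (𝒢.grp d) L n E
        (fun i j b => (u L A n E i j b : ZMod (𝒢.grp d).p)) a β) a β)
      (List.ofFn fun t : Fin m => fun i => (keyRnd L A n E (R.length + t) i : ZMod (𝒢.grp d).p)) R) := by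
  induction m with
  | zero => simp [feed]
  | succ m ih =>
    intro R
    have hstep : step 𝒢 H L A n E (.ofList R) = .ofList (R ++ [simAnswer H E (simParams (𝒢.grp d) L n E
        (fun i j b => (u L A n E i j b : ZMod (𝒢.grp d).p)) a β) a β
        (fun i => (keyRnd L A n E R.length i : ZMod (𝒢.grp d).p)) (A.move n (envRho E) R)]) := by
      rw [step, Val.toList_ofList, answer_eq hd hE ha hb hp hp3,
        trunc_of_le (size_simAnswer_le hd _ _ _ _ _ _)]
      rfl
    rw [Function.iterate_succ_apply, hstep, ih, List.ofFn_succ]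
    simp only [feed, List.foldl_cons, List.length_append, List.length_singleton, Fin.val_zero,
      Nat.add_zero, Fin.val_succ]
    congr 3
    funext t i
    congr 2
    omega

-- All coefficients `J` vanish on the target, so the exponents of the hash values are the known `K`,
-- and raising to the unknown `c` amounts to raising `g₁^c` to `K`.
omit ha hb hp hp3 in
theorem header_eq {tgt : Val} {c : ZMod (𝒢.grp d).p} (hc : envGc E = 𝒢.enc d 1 ((𝒢.grp d).gp 1 c))
    (hids : envIds E = tgt.fst.toList) (hT : envT E = tgt.snd)
    (hcis : envCis E = hashes H n tgt.fst) {ID' : HierID (2 * n) (L n)}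
    (hID' : readID (2 * n) (L n) tgt.fst = some ID') :
    header 𝒢 L A n E = encHeader 𝒢 d (encrypt (H.eval n) (simParams (𝒢.grp d) L n E
      (fun i j b => (u L A n E i j b : ZMod (𝒢.grp d).p)) a β) ID' (tgt.snd.readBits n) c).1 := by
  obtain ⟨h1, h2, h3⟩ := readID_eq_some hID'
  have hl : ID'.depth = tgt.fst.toList.length := by rw [HierID.depth, h1, List.length_map]
  have hF : ∀ i : Fin ID'.depth, (simParams (𝒢.grp d) L n E
      (fun i j b => (u L A n E i j b : ZMod (𝒢.grp d).p)) a β).F1 (ID'.level i)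
      (ID'.encodeCID (H.eval n) i) = (𝒢.grp d).gp 1 (coeffK L A n E i ((envCis E).nth i)) := by
    intro i
    have hi := i.2
    rw [(F_eq (row := ID'.level i) (bitAt_ci H hID' i)).1, envCis_nth hcis (by omega)]
    have := coeffJ_target (L := L) (n := n) (E := E) hids (i := i) (by omega) (by omega)
    rw [envCis_nth hcis (by omega)] at this
    change (𝒢.grp d).gp 1 (_ + (coeffJ L n E i (ci H n tgt.fst.toList i) : ℕ) * a) = _
    rw [this]
    simp
  have hH := (H_eq (M := 𝒢.grp d) (A := A) (E := E) (a := a) (β := β) (L := L)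
    (bitAt_eq_readBits (l := n) tgt.snd)).1
  rw [(coeffJ_time_eq_zero (w := tgt.snd)).2 (by rw [hT])] at hH
  rw [header, encHeader, encrypt, hc, hT, hE, hids, map_range_eq_ofFn, ← hl]
  simp only [hF, hH, gp_pow_val (M := 𝒢.grp d) (i := 1) le_rfl (by norm_num),
    powV_enc hd le_rfl (show 1 ≤ 3 by norm_num), Nat.cast_zero, zero_mul, add_zero, mul_comm c]
  rfl

theorem run_eq {tgt : Val} {c : ZMod (𝒢.grp d).p} (hc : envGc E = 𝒢.enc d 1 ((𝒢.grp d).gp 1 c))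
    (hids : envIds E = tgt.fst.toList) (hT : envT E = tgt.snd)
    (hcis : envCis E = hashes H n tgt.fst) {ID' : HierID (2 * n) (L n)}
    (hID' : readID (2 * n) (L n) tgt.fst = some ID')
    (PP : PublicParams (𝒢.grp d) (2 * n) n (L n)) (hPP : PP = simParams (𝒢.grp d) L n E
      (fun i j b => (u L A n E i j b : ZMod (𝒢.grp d).p)) a β) :
    run 𝒢 H L A n E = .ofList (transcript A n (envRho E) (simAnswer H E PP a β) (encParams 𝒢 d PP)
      (.pair (encHeader 𝒢 d (encrypt (H.eval n) PP ID' (tgt.snd.readBits n) c).1) (envZ E))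
      (fun t i => (keyRnd L A n E (1 + t) i : ZMod (𝒢.grp d).p))
      (fun t i => (keyRnd L A n E (A.q₁.eval n + 2 + t) i : ZMod (𝒢.grp d).p))) := by
  subst hPP
  rw [run, iterate_step_eq hd hE ha hb hp hp3, iterate_step_eq hd hE ha hb hp hp3, Val.toList_ofList,
    header_eq (a := a) (β := β) hd hE hc hids hT hcis hID', params_eq hd hE ha hb, transcript]
  congr 3
  funext t i
  -- The second phase starts after the parameters, `q₁` answers and the challenge, hence the offset
  -- `q₁ + 2`.
  simp only [List.length_append, length_feed, List.length_ofFn, List.length_singleton]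
  congr 2
  omega

end Run

end Sim

open scoped BigOperators

/-! ### Averages over finite types -/

section Average

variable {α β γ : Type*} [Fintype α] [Fintype β] [Fintype γ]

theorem expect_mono {f g : α → ℝ} (h : ∀ a, f a ≤ g a) : 𝔼 a, f a ≤ 𝔼 a, g a :=
  Finset.expect_le_expect fun a _ => h a

theorem abs_expect_sub_le {f g h : α → ℝ} (H : ∀ a, |f a - g a| ≤ h a) :
    |𝔼 a, f a - 𝔼 a, g a| ≤ 𝔼 a, h a := by
  rw [← Finset.expect_sub_distrib]
  exact (Finset.abs_expect_le _ _).trans (expect_mono H)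

theorem expect_nonneg' {f : α → ℝ} (h : ∀ a, 0 ≤ f a) : 0 ≤ 𝔼 a, f a :=
  Finset.expect_nonneg fun a _ => h a

theorem expect_le_one {f : α → ℝ} [Nonempty α] (h : ∀ a, f a ≤ 1) : 𝔼 a, f a ≤ 1 :=
  (expect_mono h).trans (by rw [Fintype.expect_const])

theorem expect_prod (f : α × β → ℝ) : 𝔼 x, f x = 𝔼 a, 𝔼 b, f (a, b) := by
  rw [← Finset.univ_product_univ, Finset.expect_product]

/-- The image of a uniformly random element is uniformly random. -/
def Balanced (φ : α → β) : Prop := ∀ f : β → ℝ, 𝔼 a, f (φ a) = 𝔼 b, f b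

theorem Balanced.of_bijective {φ : α → β} (h : Function.Bijective φ) : Balanced φ :=
  fun _ => Fintype.expect_bijective φ h _ _ fun _ => rfl

theorem Balanced.comp {φ : α → β} {ψ : β → γ} (hψ : Balanced ψ) (hφ : Balanced φ) :
    Balanced (ψ ∘ φ) := fun f => (hφ fun b => f (ψ b)).trans (hψ f)

/-- Averages over the domain are invariant under translation, so averaging `f (φ a + b)` over both
variables can be evaluated in either order. -/
theorem Balanced.of_hom {α β : Type*} [Fintype α] [Fintype β] [AddCommGroup α] [AddCommGroup β]
    (φ : α →+ β) (h : Function.Surjective φ) : Balanced φ := by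
  intro f
  have h1 : ∀ b : β, 𝔼 a, f (φ a + b) = 𝔼 a, f (φ a) := by
    intro b
    obtain ⟨a, rfl⟩ := h b
    exact Fintype.expect_equiv (Equiv.addRight a) _ _ fun x => by simp
  have h2 : ∀ a : α, 𝔼 b, f (φ a + b) = 𝔼 b, f b := fun a =>
    Fintype.expect_equiv (Equiv.addLeft (φ a)) _ _ fun x => by simp
  calc 𝔼 a, f (φ a) = 𝔼 _b : β, 𝔼 a, f (φ a) := by rw [Fintype.expect_const]
    _ = 𝔼 b : β, 𝔼 a, f (φ a + b) := by simp only [h1]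
    _ = 𝔼 a : α, 𝔼 b, f (φ a + b) := Finset.expect_comm _ _ _
    _ = 𝔼 b, f b := by simp only [h2]; rw [Fintype.expect_const]

end Average

section PMF

variable {α : Type*} {β : Type*} [Fintype α] [Nonempty α]

theorem toReal_uniform_bind (f : α → PMF β) (b : β) :
    (((PMF.uniformOfFintype α).bind f) b).toReal = 𝔼 a, (f a b).toReal := by
  rw [PMF.bind_apply, tsum_fintype, ENNReal.toReal_sum
    fun a _ => ENNReal.mul_ne_top (PMF.apply_ne_top _ _) (PMF.apply_ne_top _ _),
    Fintype.expect_eq_sum_div_card, Finset.sum_div]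
  refine Finset.sum_congr rfl fun a _ => ?_
  simp [div_eq_inv_mul]

theorem toReal_uniform_map [DecidableEq β] (f : α → β) (b : β) :
    (((PMF.uniformOfFintype α).map f) b).toReal = 𝔼 a, if b = f a then 1 else 0 := by
  rw [← PMF.bind_pure_comp, toReal_uniform_bind]
  refine Finset.expect_congr rfl fun a _ => ?_
  simp only [Function.comp_apply, PMF.pure_apply]
  split_ifs <;> simp

theorem toReal_outerMeasure_map (f : α → β) (s : Set β) [DecidablePred (· ∈ s)] :
    (((PMF.uniformOfFintype α).map f).toOuterMeasure s).toReal
      = 𝔼 a, if f a ∈ s then 1 else 0 := by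
  rw [PMF.toOuterMeasure_map_apply, PMF.toOuterMeasure_apply_fintype, ENNReal.toReal_sum,
    Fintype.expect_eq_sum_div_card, Finset.sum_div]
  · refine Finset.sum_congr rfl fun a _ => ?_
    by_cases h : f a ∈ s <;> simp [h]
  · intro a _
    by_cases h : f a ∈ s <;> simp [h]

theorem Balanced.map_uniform [Fintype β] [Nonempty β] {φ : α → β} (h : Balanced φ) :
    (PMF.uniformOfFintype α).map φ = PMF.uniformOfFintype β := by
  classical
  ext b
  rw [← ENNReal.toReal_eq_toReal_iff' (PMF.apply_ne_top _ _) (PMF.apply_ne_top _ _),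
    toReal_uniform_map, h fun y => if b = y then 1 else 0, ← toReal_uniform_map (fun y : β => y)]
  change ((PMF.map id _) b).toReal = _
  rw [PMF.map_id]

end PMF

/-! ### Phases of queries with predetermined random choices -/

theorem expect_fin_succ {X : Type*} [Fintype X] (m : ℕ) (f : (Fin (m + 1) → X) → ℝ) :
    𝔼 xs, f xs = 𝔼 x, 𝔼 xs : Fin m → X, f (Fin.cons x xs) := by
  rw [← expect_prod fun x : X × (Fin m → X) => f (Fin.cons x.1 x.2)]
  exact (Fintype.expect_equiv (Fin.consEquiv fun _ => X) _ _ fun x => rfl).symm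

/-- Fresh randomness for each answer can be drawn before the phase begins, although the queries are
adaptive. Experiments with different answer functions can then be compared for the same random
choices. -/
theorem toReal_queryPhase_bind {X β : Type} [Fintype X] [Nonempty X] {move : List Val → Val}
    {oracle : Val → PMF Val} {ans : X → Val → Val}
    (h : ∀ v, oracle v = (PMF.uniformOfFintype X).map fun x => ans x v) (k : List Val → PMF β)
    (b : β) (m : ℕ) : ∀ R, (((queryPhase move oracle m R).bind k) b).toReal
      = 𝔼 xs : Fin m → X, (k (feed move ans (List.ofFn xs) R) b).toReal := by
  induction m with
  | zero =>
    intro R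
    have : queryPhase move oracle 0 R = PMF.pure R := rfl
    rw [this, PMF.pure_bind]
    simp only [List.ofFn_zero, feed, List.foldl_nil]
    rw [Fintype.expect_const]
  | succ m ih =>
    intro R
    have : queryPhase move oracle (m + 1) R
        = (oracle (move R)).bind fun a => queryPhase move oracle m (R ++ [a]) := rfl
    rw [this, h, PMF.bind_map, PMF.bind_bind, toReal_uniform_bind, expect_fin_succ]
    refine Finset.expect_congr rfl fun x _ => ?_
    simp only [Function.comp_apply, ih, List.ofFn_succ, Fin.cons_zero, Fin.cons_succ]
    rfl

theorem prefix_feed {X : Type*} (move : List Val → Val) (ans : X → Val → Val) (xs : List X) :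
    ∀ R, R <+: feed move ans xs R := by
  induction xs with
  | nil => intro R; exact List.prefix_rfl
  | cons x xs ih => intro R; exact (List.prefix_append _ _).trans (ih (R ++ [ans x (move R)]))

/-- Identical until bad: the bad event is read off the run with `ans'` alone, here the simulator's,
so an algorithm that performs this run can detect it. -/
theorem feed_congr {X : Type*} {move : List Val → Val} {ans ans' : X → Val → Val} {bad : Val → Prop}
    (h : ∀ x v, ¬ bad v → ans x v = ans' x v) {F : List Val}
    (hF : ∀ k ≤ F.length, ¬ bad (move (F.take k))) (xs : List X) :
    ∀ R, feed move ans' xs R <+: F → feed move ans xs R = feed move ans' xs R := by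
  induction xs with
  | nil => intro R _; rfl
  | cons x xs ih =>
    intro R hR
    have h1 := (prefix_feed move ans' (x :: xs) R).trans hR
    have h2 : ans x (move R) = ans' x (move R) := by
      apply h
      have := hF R.length h1.length_le
      rwa [← List.prefix_iff_eq_take.1 h1] at this
    change feed move ans xs (R ++ [ans x (move R)]) = feed move ans' xs (R ++ [ans' x (move R)])
    rw [h2]
    exact ih _ hR

/-! ### Hybrid answers with the challenger's distribution -/

namespace Sim

variable {𝒢 : GroupGenerator 3} {H : HashFunction} {L : ℕ → ℕ} {A : Adversary} {n : ℕ} {d : Val}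

theorem transcript_congr {X : Type*} {ρ : ℕ} {ans ans' : X → Val → Val} {bad : Val → Prop}
    (h : ∀ x v, ¬ bad v → ans x v = ans' x v) {PP ch : Val} {xs₁ : Fin (A.q₁.eval n) → X}
    {xs₂ : Fin (A.q₂.eval n) → X}
    (hF : ∀ k ≤ (transcript A n ρ ans' PP ch xs₁ xs₂).length,
      ¬ bad (A.move n ρ ((transcript A n ρ ans' PP ch xs₁ xs₂).take k))) :
    transcript A n ρ ans PP ch xs₁ xs₂ = transcript A n ρ ans' PP ch xs₁ xs₂ := by
  have h1 := feed_congr (move := A.move n ρ) h hF (List.ofFn xs₁) [PP]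
    ((List.prefix_append _ _).trans (prefix_feed (A.move n ρ) ans' (List.ofFn xs₂) _))
  have h2 := feed_congr (move := A.move n ρ) h hF (List.ofFn xs₂)
    (feed (A.move n ρ) ans' (List.ofFn xs₁) [PP] ++ [ch]) List.prefix_rfl
  rw [transcript, h1, h2, transcript]

/-- The random exponents of the first `ℓ` levels and of the time period. -/
theorem balanced_restrict {p : ℕ} [NeZero p] {m : ℕ} {ID : HierID m (L n)} :
    Balanced fun x : Fin (L n + 1) → ZMod p =>
      ((fun i => x (ID.level i).castSucc : Fin ID.depth → ZMod p), x (Fin.last _)) := by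
  let φ : (Fin (L n + 1) → ZMod p) →+ (Fin ID.depth → ZMod p) × ZMod p :=
    { toFun := fun x => (fun i => x (ID.level i).castSucc, x (Fin.last _))
      map_zero' := rfl
      map_add' := fun _ _ => rfl }
  -- Coordinates beyond the depth are free. Filling them with `y.2` also gives the last coordinate
  -- the right value, because its index `L n` is not below the depth.
  refine Balanced.of_hom φ fun y => ⟨fun i => if h : (i : ℕ) < ID.depth then y.1 ⟨i, h⟩ else y.2, ?_⟩
  refine Prod.ext (funext fun i => ?_) ?_
  · simp [φ]
  · simp [φ, ID.length_le]

/-- Drawing `L n + 1` exponents regardless of the depth of the identity gives all queries the same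
sample space; the superfluous ones are averaged away. -/
theorem map_keyOf (PP : PublicParams (𝒢.grp d) (2 * n) n (L n)) (α : ZMod (𝒢.grp d).p) (v : Val)
    (ID : HierID (2 * n) (L n)) :
    (PMF.uniformOfFintype _).map (keyOf (𝒢 := 𝒢) H PP α v ID)
      = (genKey (H.eval n) PP α ID (v.snd.readBits n)).map (encKey 𝒢 d) := by
  have h := (balanced_restrict (L := L) (n := n) (p := (𝒢.grp d).p) (ID := ID)).map_uniform
  have h2 : genKey (H.eval n) PP α ID (v.snd.readBits n) = (PMF.uniformOfFintype
      ((Fin ID.depth → ZMod (𝒢.grp d).p) × ZMod (𝒢.grp d).p)).map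
      fun x => keyDet (H.eval n) PP α ID (v.snd.readBits n) x.1 x.2 := by
    ext K
    rw [← ENNReal.toReal_eq_toReal_iff' (PMF.apply_ne_top _ _) (PMF.apply_ne_top _ _),
      ← PMF.bind_pure_comp, toReal_uniform_bind, expect_prod]
    change (((PMF.uniformOfFintype _).bind fun r => (PMF.uniformOfFintype _).bind fun rlast =>
      PMF.pure (keyDet (H.eval n) PP α ID (v.snd.readBits n) r rlast)) K).toReal = _
    simp only [toReal_uniform_bind]
    rfl
  rw [h2, PMF.map_comp, ← h, PMF.map_comp]
  rfl

theorem map_realAnswer (PP : PublicParams (𝒢.grp d) (2 * n) n (L n)) (α : ZMod (𝒢.grp d).p)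
    (ID' : HierID (2 * n) (L n)) (T' : Fin n → Bool) (v : Val) :
    BBHIBE.answer 𝒢 H (L n) n d PP α ID' T' v
      = (PMF.uniformOfFintype _).map fun x => realAnswer H PP α ID' T' x v := by
  have hc : ∀ w : Val, (pure w : PMF Val) = (PMF.uniformOfFintype (Fin (L n + 1) → ZMod (𝒢.grp d).p)).map
      fun _ => w := fun w => (PMF.map_const _ w).symm
  unfold BBHIBE.answer realAnswer
  simp only
  cases readID (2 * n) (L n) v.fst with
  | none => exact hc _
  | some ID =>
    simp only
    split_ifs
    · exact hc _
    · exact (map_keyOf PP α v ID).symm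

open Classical in
/-- Answers with the distribution of the challenger's that agree with the simulator's except for
queries that contain a collision of the hash function. -/
noncomputable def hybridAnswer (H : HashFunction) (E tgt : Val) (ID' : HierID (2 * n) (L n))
    (PP : PublicParams (𝒢.grp d) (2 * n) n (L n)) (a β : ZMod (𝒢.grp d).p)
    (x : Fin (L n + 1) → ZMod (𝒢.grp d).p) (v : Val) : Val :=
  if candidate H L n v.fst.toList tgt.fst.toList = .num 0 then simAnswer H E PP a β x v
  else realAnswer H PP (a * β) ID' (tgt.snd.readBits n) x v

/-- Without a collision, the simulator refuses exactly the forbidden queries. On the others its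
exponents are uniform ones translated by a vector that depends only on the query and `β`, and are
therefore uniform. Queries with a collision are answered as by the challenger. -/
theorem map_hybridAnswer {E tgt : Val} (hids : envIds E = tgt.fst.toList) (hT : envT E = tgt.snd)
    (hcis : envCis E = hashes H n tgt.fst) {ID' : HierID (2 * n) (L n)}
    (hID' : readID (2 * n) (L n) tgt.fst = some ID')
    (PP : PublicParams (𝒢.grp d) (2 * n) n (L n)) (a β : ZMod (𝒢.grp d).p) (v : Val) :
    BBHIBE.answer 𝒢 H (L n) n d PP (a * β) ID' (tgt.snd.readBits n) v
      = (PMF.uniformOfFintype _).map fun x => hybridAnswer H E tgt ID' PP a β x v := by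
  rw [map_realAnswer]
  by_cases hc : candidate H L n v.fst.toList tgt.fst.toList = .num 0
  · simp only [hybridAnswer, if_pos hc]
    unfold realAnswer simAnswer
    cases hID : readID (2 * n) (L n) v.fst with
    | none => rfl
    | some ID =>
      simp only
      by_cases hz : ID.toList <+: ID'.toList ∧ v.snd.readBits n = tgt.snd.readBits n
      · have := coeffJ_eq_zero_of_prefix hids hT hcis hID' hID hz.1 hz.2
        simp only [if_pos hz, if_pos this]
      · have := fun h => hz (prefix_of_coeffJ_eq_zero hids hT hcis hID' hID hc h)
        simp only [if_neg hz, if_neg this]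
        have h := (Balanced.of_bijective (Equiv.subRight
          (shift (L := L) (n := n) H E v β)).bijective).map_uniform
        conv_lhs => rw [← h, PMF.map_comp]
        rfl
  · simp only [hybridAnswer, if_neg hc]

end Sim

/-! ### Sampling exponents with coins -/

/-- A uniformly random number below `K`, reduced modulo `m`, is almost uniformly random. -/
theorem abs_expect_mod_sub_le {K m : ℕ} (hK : 0 < K) (hm : 0 < m) {F : ℕ → ℝ} (h0 : ∀ y, 0 ≤ F y)
    (h1 : ∀ y, F y ≤ 1) :
    |𝔼 y : Fin K, F (y % m) - 𝔼 y : Fin m, F y| ≤ (m : ℝ) / K := by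
  rw [Fintype.expect_eq_sum_div_card, Fintype.expect_eq_sum_div_card, Fintype.card_fin,
    Fintype.card_fin, Fin.sum_univ_eq_sum_range (fun y => F (y % m)) K, Fin.sum_univ_eq_sum_range F m]
  set S := ∑ y ∈ Finset.range m, F y with hS
  -- Full blocks of length `m` reproduce the uniform average; the bias comes from the incomplete
  -- last block.
  have hsum : ∀ q r : ℕ, r ≤ m → ∑ y ∈ Finset.range (m * q + r), F (y % m)
      = q * S + ∑ y ∈ Finset.range r, F y := by
    intro q r hr
    induction q with
    | zero =>
      simp only [mul_zero, zero_add, Nat.cast_zero, zero_mul]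
      exact Finset.sum_congr rfl fun y hy => by
        rw [Nat.mod_eq_of_lt ((Finset.mem_range.1 hy).trans_le hr)]
    | succ q ih =>
      have : m * (q + 1) + r = m + (m * q + r) := by ring
      rw [this, Finset.sum_range_add]
      have h2 : ∑ y ∈ Finset.range m, F (y % m) = S := Finset.sum_congr rfl fun y hy => by
        rw [Nat.mod_eq_of_lt (Finset.mem_range.1 hy)]
      have h3 : ∀ y, F ((m + y) % m) = F (y % m) := fun y => by rw [Nat.add_mod_left]
      simp only [h2, h3, ih]
      push_cast
      ring
  have hlt := Nat.mod_lt K hm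
  have hK' : (K : ℝ) = m * (K / m : ℕ) + (K % m : ℕ) := by exact_mod_cast (Nat.div_add_mod K m).symm
  have hKeq := hsum (K / m) (K % m) hlt.le
  rw [Nat.div_add_mod] at hKeq
  rw [hKeq]
  set q := K / m
  set r := K % m
  set Sr := ∑ y ∈ Finset.range r, F y
  have hS0 : 0 ≤ S := Finset.sum_nonneg fun y _ => h0 y
  have hS1 : S ≤ m := by
    simpa using Finset.sum_le_sum (s := Finset.range m) fun y _ => h1 y
  have hr0 : 0 ≤ Sr := Finset.sum_nonneg fun y _ => h0 y
  have hr1 : Sr ≤ r := by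
    simpa using Finset.sum_le_sum (s := Finset.range r) fun y _ => h1 y
  have hmR : (0 : ℝ) < m := by exact_mod_cast hm
  have hKR : (0 : ℝ) < K := by exact_mod_cast hK
  have hrm : (r : ℝ) ≤ m := by exact_mod_cast hlt.le
  have hr : (0 : ℝ) ≤ r := by positivity
  have key : (q * S + Sr) / K - S / m = (Sr * m - S * r) / (K * m) := by
    rw [div_sub_div _ _ hKR.ne' hmR.ne', hK']
    congr 1
    ring
  rw [key, abs_div, abs_of_pos (mul_pos hKR hmR), div_le_div_iff₀ (mul_pos hKR hmR) hKR]
  have h2 : |Sr * m - S * r| ≤ m * m := by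
    rw [abs_le]
    constructor <;> nlinarith
  nlinarith

namespace Sim

/-! ### Digits of a random number as independent exponents -/

section Split

variable (L : ℕ → ℕ) (A : Adversary) (n p : ℕ)

/-- The exponents chosen by the setup algorithm. -/
abbrev SetupExp : Type :=
  (Fin (L n) → ZMod p) × (Fin (L n) → Fin (2 * n) → Bool → ZMod p) × ZMod p × (Fin n → Bool → ZMod p)

/-- The exponents chosen for the answers to the queries in both phases. -/
abbrev QueryExp : Type :=
  (Fin (A.q₁.eval n) → Fin (L n + 1) → ZMod p) × (Fin (A.q₂.eval n) → Fin (L n + 1) → ZMod p)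

/-- The random exponents as parts of an array. -/
def parts (ω : ℕ → ℕ → Bool → ZMod p) :
    (Fin 4 → ZMod p) × SetupExp L n p × QueryExp L A n p :=
  (fun k => ω (L n + 1) k false,
    (fun i => ω i (2 * n) false, fun i j b => ω i j b, ω (L n) (2 * n) false, fun j b => ω (L n) j b),
    (fun t i => ω (L n + 1 + (1 + t)) i false, fun t i => ω (L n + 1 + (A.q₁.eval n + 2 + t)) i false))

variable {L A n p}

theorem index_lt {row j : ℕ} (hr : row < rows L A n) (hj : j < width L n) (b : Bool) :
    index L n row j b < digits L A n := by
  have h1 : (row + 1) * width L n ≤ rows L A n * width L n := Nat.mul_le_mul_right _ hr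
  have h2 := b.toNat_lt
  have h3 : (row + 1) * width L n = row * width L n + width L n := by ring
  unfold index digits
  omega

theorem digits_pos : 0 < digits L A n := by unfold digits rows width; positivity

theorem index_decode {row j : ℕ} (hj : j < width L n) (b : Bool) :
    index L n row j b / 2 / width L n = row ∧ index L n row j b / 2 % width L n = j ∧
      decide (index L n row j b % 2 = 1) = b := by
  have h1 : index L n row j b / 2 = row * width L n + j := by
    have := b.toNat_lt
    unfold index; omega
  refine ⟨?_, ?_, ?_⟩
  · rw [h1, mul_comm, Nat.mul_add_div (by omega), Nat.div_eq_of_lt hj, add_zero]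
  · rw [h1, mul_comm, Nat.mul_add_mod, Nat.mod_eq_of_lt hj]
  · unfold index
    cases b <;> simp

variable (L A n) in
/-- An array with given entries. -/
def arrayOf (D : Fin (digits L A n) → ZMod p) (row j : ℕ) (b : Bool) : ZMod p :=
  D ⟨index L n row j b % digits L A n, Nat.mod_lt _ digits_pos⟩

/-- Different exponents of the experiment occupy different positions of the array, so reading them
off is a surjective homomorphism. -/
theorem balanced_parts [NeZero p] :
    Balanced fun D : Fin (digits L A n) → ZMod p => parts L A n p (arrayOf L A n D) := by
  let φ : (Fin (digits L A n) → ZMod p) →+ (Fin 4 → ZMod p) × SetupExp L n p × QueryExp L A n p :=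
    { toFun := fun D => parts L A n p (arrayOf L A n D)
      map_zero' := rfl
      map_add' := fun _ _ => rfl }
  refine Balanced.of_hom φ ?_
  rintro ⟨w, ⟨f0, f, h0, h⟩, x₁, x₂⟩
  -- The preimage is the layout read backwards. Keys of the two phases start at rows `L n + 2` and
  -- `L n + 3 + q₁`; the row between them corresponds to the challenge message and is never read, so
  -- its value is irrelevant.
  let τ : ℕ → ℕ → Bool → ZMod p := fun row j b =>
    if hr : row < L n then if hj : j < 2 * n then f ⟨row, hr⟩ ⟨j, hj⟩ b else f0 ⟨row, hr⟩
    else if row = L n then if hj : j < n then h ⟨j, hj⟩ b else h0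
    else if row = L n + 1 then if hj : j < 4 then w ⟨j, hj⟩ else 0
    else if hj : j < L n + 1 then
      if hr : row - (L n + 2) < A.q₁.eval n then x₁ ⟨row - (L n + 2), hr⟩ ⟨j, hj⟩
      else if hr : row - (L n + 3 + A.q₁.eval n) < A.q₂.eval n then
        x₂ ⟨row - (L n + 3 + A.q₁.eval n), hr⟩ ⟨j, hj⟩
      else 0
    else 0
  let D : Fin (digits L A n) → ZMod p := fun k =>
    τ (k / 2 / width L n) (k / 2 % width L n) (decide ((k : ℕ) % 2 = 1))
  have hD : ∀ row j b, row < rows L A n → j < width L n → arrayOf L A n D row j b = τ row j b := by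
    intro row j b hr hj
    obtain ⟨h1, h2, h3⟩ := index_decode (row := row) hj b
    simp only [arrayOf, D, Nat.mod_eq_of_lt (index_lt hr hj b), h1, h2, h3]
  have hrows : rows L A n = L n + A.q₁.eval n + A.q₂.eval n + 4 := rfl
  have hwidth : width L n = 2 * n + L n + 5 := rfl
  refine ⟨D, ?_⟩
  change parts L A n p (arrayOf L A n D) = _
  simp only [parts]
  refine Prod.ext (funext fun k => ?_) (Prod.ext (Prod.ext (funext fun i => ?_)
    (Prod.ext (funext fun i => funext fun j => funext fun b => ?_) (Prod.ext ?_
      (funext fun j => funext fun b => ?_)))) (Prod.ext (funext fun t => funext fun i => ?_)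
        (funext fun t => funext fun i => ?_)))
  · simp only
    rw [hD _ _ _ (by omega) (by omega)]
    simp [τ]
  · simp only
    rw [hD _ _ _ (by omega) (by omega)]
    simp [τ]
  · simp only
    rw [hD _ _ _ (by omega) (by omega)]
    simp [τ]
  · simp only
    rw [hD _ _ _ (by omega) (by omega)]
    have : ¬ 2 * n < n := by omega
    simp [τ, this]
  · simp only
    rw [hD _ _ _ (by omega) (by omega)]
    simp [τ]
  · simp only
    rw [hD _ _ _ (by omega) (by omega)]
    have h1 : ¬ L n + 1 + (1 + (t : ℕ)) < L n := by omega
    have h2 : ¬ L n + 1 + (1 + (t : ℕ)) = L n := by omega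
    have h3 : ¬ L n + 1 + (1 + (t : ℕ)) = L n + 1 := by omega
    have h4 : L n + 1 + (1 + (t : ℕ)) - (L n + 2) = t := by omega
    simp only [τ, h1, h2, h3, h4, dif_neg, if_neg, not_false_eq_true, i.2, t.2, dif_pos, Fin.eta]
  · simp only
    rw [hD _ _ _ (by omega) (by omega)]
    have h1 : ¬ L n + 1 + (A.q₁.eval n + 2 + (t : ℕ)) < L n := by omega
    have h2 : ¬ L n + 1 + (A.q₁.eval n + 2 + (t : ℕ)) = L n := by omega
    have h3 : ¬ L n + 1 + (A.q₁.eval n + 2 + (t : ℕ)) = L n + 1 := by omega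
    have h4 : ¬ L n + 1 + (A.q₁.eval n + 2 + (t : ℕ)) - (L n + 2) < A.q₁.eval n := by omega
    have h5 : L n + 1 + (A.q₁.eval n + 2 + (t : ℕ)) - (L n + 3 + A.q₁.eval n) = t := by omega
    simp only [τ, h1, h2, h3, h4, h5, dif_neg, if_neg, not_false_eq_true, i.2, t.2, dif_pos, Fin.eta]

theorem rnd_mod {row j : ℕ} {b : Bool} (y : ℕ) (h : index L n row j b < digits L A n) :
    rnd L A n p (y % p ^ digits L A n) row j b = rnd L A n p y row j b := by
  unfold rnd
  rw [min_eq_left h.le]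
  obtain ⟨k, hk⟩ := Nat.exists_eq_add_of_lt h
  have : p ^ digits L A n = p ^ index L n row j b * p ^ (k + 1) := by
    rw [← pow_add, hk, add_assoc]
  rw [this, Nat.mod_mul_right_div_self, pow_succ', Nat.mod_mod_of_dvd _ (dvd_mul_right _ _)]

variable (L A n p) in
/-- The random exponents of the simulator. -/
def randomParts (y : ℕ) : (Fin 4 → ZMod p) × SetupExp L n p × QueryExp L A n p :=
  parts L A n p fun row j b => (rnd L A n p y row j b : ZMod p)

theorem parts_congr {ω ω' : ℕ → ℕ → Bool → ZMod p}
    (h : ∀ row j b, row < rows L A n → j < width L n → ω row j b = ω' row j b) :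
    parts L A n p ω = parts L A n p ω' := by
  have hrows : rows L A n = L n + A.q₁.eval n + A.q₂.eval n + 4 := rfl
  have hwidth : width L n = 2 * n + L n + 5 := rfl
  refine Prod.ext (funext fun k => ?_) (Prod.ext (Prod.ext (funext fun i => ?_)
    (Prod.ext (funext fun i => funext fun j => funext fun b => ?_) (Prod.ext ?_
      (funext fun j => funext fun b => ?_)))) (Prod.ext (funext fun t => funext fun i => ?_)
        (funext fun t => funext fun i => ?_))) <;> exact h _ _ _ (by omega) (by omega)

/-- Numbers below `p ^ digits` correspond bijectively to their base-`p` digits, hence to arbitrary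
arrays of residues. -/
theorem balanced_randomParts [NeZero p] :
    Balanced fun y : Fin (p ^ digits L A n) => randomParts L A n p y := by
  have h1 : Balanced fun y : Fin (p ^ digits L A n) => finFunctionFinEquiv.symm y :=
    Balanced.of_bijective finFunctionFinEquiv.symm.bijective
  have hp : Function.Bijective fun i : Fin p => ((i : ℕ) : ZMod p) := by
    rw [Fintype.bijective_iff_surjective_and_card]
    refine ⟨fun x => ⟨⟨x.val, x.val_lt⟩, ZMod.natCast_zmod_val x⟩, by simp [ZMod.card]⟩
  have h2 : Balanced fun D : Fin (digits L A n) → Fin p => fun k => ((D k : ℕ) : ZMod p) :=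
    Balanced.of_bijective hp.comp_left
  convert (balanced_parts (L := L) (A := A) (n := n) (p := p)).comp (h2.comp h1) using 2 with y
  refine parts_congr fun row j b hr hj => ?_
  have := index_lt hr hj b
  simp only [arrayOf, Nat.mod_eq_of_lt this, finFunctionFinEquiv_symm_apply_val, rnd,
    Function.comp_apply, min_eq_left this.le]

/-- The exponents depend only on `y` modulo `p ^ digits`, so the bias is that of reducing a number
below `K`. -/
theorem abs_expect_randomParts_sub_le [NeZero p] {K : ℕ} (hK : 0 < K)
    {F : (Fin 4 → ZMod p) × SetupExp L n p × QueryExp L A n p → ℝ} (h0 : ∀ x, 0 ≤ F x)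
    (h1 : ∀ x, F x ≤ 1) :
    |𝔼 y : Fin K, F (randomParts L A n p y) - 𝔼 x, F x| ≤ (p ^ digits L A n : ℕ) / K := by
  have h := abs_expect_mod_sub_le (F := fun y => F (randomParts L A n p y)) hK
    (m := p ^ digits L A n) (Nat.pow_pos (NeZero.pos p)) (fun _ => h0 _) fun _ => h1 _
  rw [balanced_randomParts (p := p) F] at h
  have h2 : ∀ y, randomParts L A n p (y % p ^ digits L A n) = randomParts L A n p y := fun y =>
    parts_congr fun row j b hr hj => by rw [rnd_mod _ (index_lt hr hj b)]
  simpa only [h2] using h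

end Split

end Sim

/-! ### The experiment for a given group -/

section Tail

variable (𝒢 : GroupGenerator 3) (H : HashFunction) (L : ℕ → ℕ) (A : Adversary) (n ρ : ℕ) (d : Val)

/-- The experiment after Setup. -/
noncomputable def tail (PP : PublicParams (𝒢.grp d) (2 * n) n (L n)) (α : ZMod (𝒢.grp d).p)
    (ID' : HierID (2 * n) (L n)) (T' : Fin n → Bool) : PMF Bool :=
  let oracle := answer 𝒢 H (L n) n d PP α ID' T'
  (queryPhase (A.move n ρ) oracle (A.q₁.eval n) [encParams 𝒢 d PP]).bind fun received₁ =>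
  (PMF.uniformOfFintype Bool).bind fun μ =>
  (PMF.uniformOfFintype (ZMod (𝒢.grp d).p)).bind fun s =>
  (PMF.uniformOfFintype ((𝒢.grp d).G 3)).bind fun EK₁ =>
  (queryPhase (A.move n ρ) oracle (A.q₂.eval n) (received₁ ++
    [.pair (encHeader 𝒢 d (encrypt (H.eval n) PP ID' T' s).1)
      (𝒢.enc d 3 (if μ then EK₁ else (encrypt (H.eval n) PP ID' T' s).2))])).bind fun received₂ =>
  PMF.pure (decide (A.move n ρ received₂ = .num 1) == μ)

/-- The experiment for given groups. -/
noncomputable def gameIn (ID' : HierID (2 * n) (L n)) (T' : Fin n → Bool) : PMF Bool :=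
  (setup (𝒢.grp d) (2 * n) n (L n)).bind fun keys => tail 𝒢 H L A n ρ d keys.2 keys.1 ID' T'

theorem gameFrom_eq (ID' : HierID (2 * n) (L n)) (T' : Fin n → Bool) :
    gameFrom 𝒢 H (L n) A n ρ ID' T' = (𝒢.sample n).bind fun d => gameIn 𝒢 H L A n ρ d ID' T' := rfl

/-- Indicator of the guess `1` of the adversary. -/
noncomputable def guess {X : Type} (ans : X → Val → Val)
    (PP : PublicParams (𝒢.grp d) (2 * n) n (L n)) (ID' : HierID (2 * n) (L n)) (T' : Fin n → Bool)
    (s : ZMod (𝒢.grp d).p) (EK : (𝒢.grp d).G 3) (xs₁ : Fin (A.q₁.eval n) → X)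
    (xs₂ : Fin (A.q₂.eval n) → X) : ℝ :=
  if A.move n ρ (Sim.transcript A n ρ ans (encParams 𝒢 d PP)
    (.pair (encHeader 𝒢 d (encrypt (H.eval n) PP ID' T' s).1) (𝒢.enc d 3 EK)) xs₁ xs₂) = .num 1
  then 1 else 0

variable {𝒢 H L A n ρ d}

/-- The winning probability is `1/2` plus half the difference between the probabilities of the guess
`1` in the random and in the real case. The average over a dummy session key is retained in the real
case to give both terms the same sample space. -/
theorem toReal_tail {X : Type} [Fintype X] [Nonempty X] {ans : X → Val → Val}
    {PP : PublicParams (𝒢.grp d) (2 * n) n (L n)} {α : ZMod (𝒢.grp d).p}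
    {ID' : HierID (2 * n) (L n)} {T' : Fin n → Bool}
    (h : ∀ v, answer 𝒢 H (L n) n d PP α ID' T' v = (PMF.uniformOfFintype X).map fun x => ans x v) :
    (tail 𝒢 H L A n ρ d PP α ID' T' true).toReal = 1 / 2 + 1 / 2 *
      ((𝔼 xs₁, 𝔼 s, 𝔼 EK, 𝔼 xs₂, guess 𝒢 H L A n ρ d ans PP ID' T' s EK xs₁ xs₂)
      - 𝔼 xs₁, 𝔼 s, 𝔼 _EK : (𝒢.grp d).G 3, 𝔼 xs₂,
        guess 𝒢 H L A n ρ d ans PP ID' T' s (PP.Lam ^ s.val) xs₁ xs₂) := by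
  have hb : ∀ f : Bool → ℝ, 𝔼 μ, f μ = 1 / 2 * (f true + f false) := fun f => by
    rw [Fintype.expect_eq_sum_div_card]
    simp
    ring
  have key : ∀ (R : List Val) (μ : Bool),
      ((PMF.pure (decide (A.move n ρ R = .num 1) == μ)) true : ENNReal).toReal
        = if μ then (if A.move n ρ R = .num 1 then 1 else 0)
          else 1 - (if A.move n ρ R = .num 1 then 1 else 0) := by
    intro R μ
    cases μ <;> by_cases h : A.move n ρ R = .num 1 <;> simp [h, PMF.pure_apply]
  have hone : ∀ {ι : Type} [Fintype ι] [Nonempty ι] (f : ι → ℝ), 𝔼 i, (1 - f i) = 1 - 𝔼 i, f i :=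
    fun f => by rw [Finset.expect_sub_distrib, Fintype.expect_const]
  unfold tail
  simp only [toReal_queryPhase_bind h, toReal_uniform_bind, hb, key]
  simp only [if_true, Bool.false_eq_true, if_false, hone, ← Finset.mul_expect,
    Finset.expect_add_distrib]
  simp only [guess, Sim.transcript, encrypt]
  ring_nf
  rfl

theorem toReal_gameIn {ID' : HierID (2 * n) (L n)} {T' : Fin n → Bool} :
    (gameIn 𝒢 H L A n ρ d ID' T' true).toReal =
      𝔼 f : (Fin (L n) → (𝒢.grp d).G 1) × (Fin (L n) → Fin (2 * n) → Bool → (𝒢.grp d).G 1) ×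
        (𝒢.grp d).G 1 × (Fin n → Bool → (𝒢.grp d).G 1), 𝔼 α : ZMod (𝒢.grp d).p,
        (tail 𝒢 H L A n ρ d ⟨f.1, f.2.1, f.2.2.1, f.2.2.2, (𝒢.grp d).gp 3 α⟩ α ID' T' true).toReal := by
  have : gameIn 𝒢 H L A n ρ d ID' T' =
    (PMF.uniformOfFintype (Fin (L n) → (𝒢.grp d).G 1)).bind fun f0 =>
    (PMF.uniformOfFintype (Fin (L n) → Fin (2 * n) → Bool → (𝒢.grp d).G 1)).bind fun f =>
    (PMF.uniformOfFintype ((𝒢.grp d).G 1)).bind fun h0 =>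
    (PMF.uniformOfFintype (Fin n → Bool → (𝒢.grp d).G 1)).bind fun h =>
    (PMF.uniformOfFintype (ZMod (𝒢.grp d).p)).bind fun α =>
      tail 𝒢 H L A n ρ d ⟨f0, f, h0, h, (𝒢.grp d).gp 3 α⟩ α ID' T' := by
    change (((PMF.uniformOfFintype _).bind fun f0 => (PMF.uniformOfFintype _).bind fun f =>
      (PMF.uniformOfFintype _).bind fun h0 => (PMF.uniformOfFintype _).bind fun h =>
      (PMF.uniformOfFintype _).bind fun α => PMF.pure
        (α, (⟨f0, f, h0, h, (𝒢.grp d).gp 3 α⟩ : PublicParams (𝒢.grp d) (2 * n) n (L n)))).bind _) = _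
    simp only [PMF.bind_bind, PMF.pure_bind]
  rw [this]
  simp only [toReal_uniform_bind, expect_prod]

end Tail

namespace Sim

/-! ### Comparison of the game with its simulation -/

section Hybrid

variable (𝒢 : GroupGenerator 3) (H : HashFunction) {L : ℕ → ℕ} (A : Adversary) {n : ℕ} (ρ : ℕ) (d : Val)
  (tgt : Val) (ID' : HierID (2 * n) (L n))

/-- The part of the simulator's data that describes the target. -/
noncomputable def targetEnv (H : HashFunction) (n : ℕ) (tgt : Val) : Val :=
  mkEnv (.num 0) (.num 0) (.num 0) (.num 0) (.num 0) 0 0 tgt.fst tgt.snd (hashes H n tgt.fst)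

/-- The public parameters of the simulator with given exponents. -/
def paramsOf (M : MultilinearGroup 3) (E : Val) (v : SetupExp L n M.p) (a β : ZMod M.p) :
    PublicParams M (2 * n) n (L n) where
  f0 i := M.gp 1 (v.1 i + delta0 L n E i * a)
  f i j b := M.gp 1 (v.2.1 i j b + delta L n E i j b * a)
  h0 := M.gp 1 (v.2.2.1 + delta0 L n E (L n) * a)
  h j b := M.gp 1 (v.2.2.2 j b + delta L n E (L n) j b * a)
  Lam := M.gp 3 (a * β)

/-- The random choices of the simulator, in the order in which the experiment makes them. -/
abbrev Choices (L : ℕ → ℕ) (A : Adversary) (n p : ℕ) : Type :=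
  SetupExp L n p × ZMod p × (Fin (A.q₁.eval n) → Fin (L n + 1) → ZMod p) × ZMod p × ZMod p ×
    (Fin (A.q₂.eval n) → Fin (L n + 1) → ZMod p)

/-- The exponent of the session key in the challenge. -/
def sessionExp {R : Type*} [Mul R] (real : Bool) (a β c z : R) : R :=
  if real then a * β * c else z

/-- The messages that the adversary receives from the simulator. -/
noncomputable def simTranscript (real : Bool) (a : ZMod (𝒢.grp d).p)
    (x : Choices L A n (𝒢.grp d).p) : List Val :=
  let PP := paramsOf (𝒢.grp d) (targetEnv H n tgt) x.1 a x.2.1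
  transcript A n ρ (simAnswer H (targetEnv H n tgt) PP a x.2.1) (encParams 𝒢 d PP)
    (.pair (encHeader 𝒢 d (encrypt (H.eval n) PP ID' (tgt.snd.readBits n) x.2.2.2.1).1)
      (𝒢.enc d 3 ((𝒢.grp d).gp 3 (sessionExp real a x.2.1 x.2.2.2.1 x.2.2.2.2.1))))
    x.2.2.1 x.2.2.2.2.2

/-- Indicator of the guess `1` in the simulated experiment. -/
noncomputable def simGuess (real : Bool) (a : ZMod (𝒢.grp d).p)
    (x : Choices L A n (𝒢.grp d).p) : ℝ :=
  if A.move n ρ (simTranscript 𝒢 H A ρ d tgt ID' real a x) = .num 1 then 1 else 0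

open Classical in
/-- Indicator of a collision in the queries in the simulated experiment. -/
noncomputable def simCollision (real : Bool) (a : ZMod (𝒢.grp d).p)
    (x : Choices L A n (𝒢.grp d).p) : ℝ :=
  if H.IsCollision n (search H L A n ρ tgt.fst (.ofList (simTranscript 𝒢 H A ρ d tgt ID' real a x)))
  then 1 else 0

variable {𝒢 H A ρ d tgt ID'}

/-- Both sides use the same random choices. If the simulated transcript contains no collision,
hybrid and simulated answers agree along it, and the guesses are equal. -/
theorem abs_guess_sub_le (real : Bool) (a : ZMod (𝒢.grp d).p) (x : Choices L A n (𝒢.grp d).p) :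
    |guess 𝒢 H L A n ρ d (hybridAnswer H (targetEnv H n tgt) tgt ID'
        (paramsOf (𝒢.grp d) (targetEnv H n tgt) x.1 a x.2.1) a x.2.1)
        (paramsOf (𝒢.grp d) (targetEnv H n tgt) x.1 a x.2.1) ID' (tgt.snd.readBits n) x.2.2.2.1
        ((𝒢.grp d).gp 3 (sessionExp real a x.2.1 x.2.2.2.1 x.2.2.2.2.1)) x.2.2.1 x.2.2.2.2.2
      - simGuess 𝒢 H A ρ d tgt ID' real a x| ≤ simCollision 𝒢 H A ρ d tgt ID' real a x := by
  by_cases hc : H.IsCollision n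
      (search H L A n ρ tgt.fst (.ofList (simTranscript 𝒢 H A ρ d tgt ID' real a x)))
  · rw [simCollision, if_pos hc]
    unfold guess simGuess
    split_ifs <;> simp
  · rw [simCollision, if_neg hc]
    have hF : ∀ k ≤ (simTranscript 𝒢 H A ρ d tgt ID' real a x).length, ¬ candidate H L n
        (A.move n ρ ((simTranscript 𝒢 H A ρ d tgt ID' real a x).take k)).fst.toList tgt.fst.toList
          ≠ .num 0 := fun k hk h => hc (isCollision_search hk h)
    have := transcript_congr (bad := fun v => candidate H L n v.fst.toList tgt.fst.toList ≠ .num 0)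
      (ans := hybridAnswer H (targetEnv H n tgt) tgt ID'
        (paramsOf (𝒢.grp d) (targetEnv H n tgt) x.1 a x.2.1) a x.2.1)
      (fun x v hv => by rw [hybridAnswer, if_pos (not_not.1 hv)]) hF
    rw [guess, this, simGuess, simTranscript, sub_self, abs_zero]

theorem expect_choices [NeZero (𝒢.grp d).p] (f : Choices L A n (𝒢.grp d).p → ℝ) :
    𝔼 x, f x = 𝔼 v, 𝔼 β, 𝔼 xs₁, 𝔼 c, 𝔼 z, 𝔼 xs₂, f (v, β, xs₁, c, z, xs₂) := by
  simp only [expect_prod (fun x : Choices L A n (𝒢.grp d).p => f x)]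
  refine Finset.expect_congr rfl fun v _ => ?_
  rw [expect_prod]
  refine Finset.expect_congr rfl fun β _ => ?_
  rw [expect_prod]
  refine Finset.expect_congr rfl fun x _ => ?_
  rw [expect_prod]
  refine Finset.expect_congr rfl fun c _ => ?_
  rw [expect_prod]

/-- The parameters hide the target: each exponent is a uniform one translated by a multiple of `a`.
-/
theorem balanced_params (E : Val) (a : ZMod (𝒢.grp d).p) :
    Balanced fun v : SetupExp L n (𝒢.grp d).p =>
      (((fun i => (𝒢.grp d).gp 1 (v.1 i + delta0 L n E i * a)),
        (fun i j b => (𝒢.grp d).gp 1 (v.2.1 i j b + delta L n E i j b * a)),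
        (𝒢.grp d).gp 1 (v.2.2.1 + delta0 L n E (L n) * a),
        (fun j b => (𝒢.grp d).gp 1 (v.2.2.2 j b + delta L n E (L n) j b * a))) :
        (Fin (L n) → (𝒢.grp d).G 1) × (Fin (L n) → Fin (2 * n) → Bool → (𝒢.grp d).G 1) ×
        (𝒢.grp d).G 1 × (Fin n → Bool → (𝒢.grp d).G 1)) := by
  have hg : Function.Bijective ((𝒢.grp d).gp 1) := gp_bijective le_rfl (by norm_num)
  have h := (Function.Bijective.prodMap
    (hg.comp_left.comp (Equiv.addRight fun i : Fin (L n) => (delta0 L n E i : ZMod _) * a).bijective)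
    (Function.Bijective.prodMap (hg.comp_left.comp_left.comp_left.comp (Equiv.addRight
      fun (i : Fin (L n)) (j : Fin (2 * n)) (b : Bool) => (delta L n E i j b : ZMod _) * a).bijective)
    (Function.Bijective.prodMap (hg.comp (Equiv.addRight ((delta0 L n E (L n) : ZMod _) * a)).bijective)
    (hg.comp_left.comp_left.comp (Equiv.addRight fun (j : Fin n) (b : Bool) =>
      (delta L n E (L n) j b : ZMod _) * a).bijective))))
  exact Balanced.of_bijective h

/-- The simulation is perfect up to collisions, unless `a = 0`. -/
theorem abs_gameIn_sub_le_of_ne_zero (hID' : readID (2 * n) (L n) tgt.fst = some ID')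
    {a : ZMod (𝒢.grp d).p} (ha : a ≠ 0) :
    |(gameIn 𝒢 H L A n ρ d ID' (tgt.snd.readBits n) true).toReal
      - (1 / 2 + 1 / 2 * ((𝔼 x, simGuess 𝒢 H A ρ d tgt ID' false a x)
        - 𝔼 x, simGuess 𝒢 H A ρ d tgt ID' true a x))|
      ≤ 1 / 2 * ((𝔼 x, simCollision 𝒢 H A ρ d tgt ID' false a x)
        + 𝔼 x, simCollision 𝒢 H A ρ d tgt ID' true a x) := by
  set E := targetEnv H n tgt with hE
  let hyb : Bool → Choices L A n (𝒢.grp d).p → ℝ := fun real x =>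
    guess 𝒢 H L A n ρ d (hybridAnswer H E tgt ID' (paramsOf (𝒢.grp d) E x.1 a x.2.1) a x.2.1)
      (paramsOf (𝒢.grp d) E x.1 a x.2.1) ID' (tgt.snd.readBits n) x.2.2.2.1
      ((𝒢.grp d).gp 3 (sessionExp real a x.2.1 x.2.2.2.1 x.2.2.2.2.1)) x.2.2.1 x.2.2.2.2.2
  -- For fixed nonzero `a` the master key `a β` is uniform; this is the one place where `a ≠ 0`
  -- enters.
  have hβ : Function.Bijective fun β : ZMod (𝒢.grp d).p => a * β := mulLeft_bijective₀ a ha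
  have hgame : (gameIn 𝒢 H L A n ρ d ID' (tgt.snd.readBits n) true).toReal
      = 1 / 2 + 1 / 2 * ((𝔼 x, hyb false x) - 𝔼 x, hyb true x) := by
    have e1 : (gameIn 𝒢 H L A n ρ d ID' (tgt.snd.readBits n) true).toReal = 𝔼 v, 𝔼 β,
        (tail 𝒢 H L A n ρ d (paramsOf (𝒢.grp d) E v a β) (a * β) ID' (tgt.snd.readBits n) true).toReal := by
      rw [toReal_gameIn, ← balanced_params E a]
      refine Finset.expect_congr rfl fun v _ => ?_
      rw [← Balanced.of_bijective hβ]
      rfl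
    have h3 : Balanced ((𝒢.grp d).gp 3) :=
      Balanced.of_bijective (gp_bijective (by norm_num) le_rfl)
    have : ∀ v β, (tail 𝒢 H L A n ρ d (paramsOf (𝒢.grp d) E v a β) (a * β) ID' (tgt.snd.readBits n)
        true).toReal = 1 / 2 + 1 / 2 * ((𝔼 xs₁, 𝔼 c, 𝔼 z, 𝔼 xs₂, hyb false (v, β, xs₁, c, z, xs₂))
          - 𝔼 xs₁, 𝔼 c, 𝔼 z, 𝔼 xs₂, hyb true (v, β, xs₁, c, z, xs₂)) := by
      intro v β
      rw [toReal_tail (map_hybridAnswer (E := E) (tgt := tgt) rfl rfl rfl hID' _ a β)]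
      -- The uniform session key is rewritten as `g₃^z` with a uniform exponent `z`.
      simp only [← h3 (fun _ => (_ : ℝ))]
      simp only [hyb, sessionExp, paramsOf, if_true, Bool.false_eq_true, if_false,
        gp_pow_val (M := 𝒢.grp d) (i := 3) (by norm_num) le_rfl]
    rw [e1]
    simp only [this, expect_choices, Finset.expect_add_distrib, ← Finset.mul_expect,
      Finset.expect_sub_distrib, Fintype.expect_const]
  rw [hgame]
  have h1 := abs_expect_sub_le (abs_guess_sub_le (H := H) (A := A) (ρ := ρ) (tgt := tgt) (ID' := ID')
    false a)
  have h2 := abs_expect_sub_le (abs_guess_sub_le (H := H) (A := A) (ρ := ρ) (tgt := tgt) (ID' := ID')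
    true a)
  change |(𝔼 x, hyb false x) - _| ≤ _ at h1
  change |(𝔼 x, hyb true x) - _| ≤ _ at h2
  rw [abs_le] at h1 h2 ⊢
  constructor <;> linarith [h1.1, h1.2, h2.1, h2.2]

/-- A single exceptional value of `a` has weight `1 / p`. -/
theorem abs_expect_sub_le_add_inv {p : ℕ} [NeZero p] {f g h : ZMod p → ℝ}
    (H : ∀ a, a ≠ 0 → |f a - g a| ≤ h a) (h0 : |f 0 - g 0| ≤ h 0 + 1) :
    |(𝔼 a, f a) - 𝔼 a, g a| ≤ (𝔼 a, h a) + 1 / p := by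
  have h1 : ∀ a, |f a - g a| ≤ h a + if a = 0 then 1 else 0 := by
    intro a
    by_cases ha : a = 0
    · subst ha
      simpa using h0
    · simpa [ha] using H a ha
  refine (abs_expect_sub_le h1).trans_eq ?_
  rw [Finset.expect_add_distrib]
  congr 1
  rw [Fintype.expect_eq_sum_div_card]
  simp [ZMod.card]

theorem simGuess_nonneg (real : Bool) (a : ZMod (𝒢.grp d).p) (x : Choices L A n (𝒢.grp d).p) :
    0 ≤ simGuess 𝒢 H A ρ d tgt ID' real a x := by
  unfold simGuess; split_ifs <;> simp

theorem simGuess_le_one (real : Bool) (a : ZMod (𝒢.grp d).p) (x : Choices L A n (𝒢.grp d).p) :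
    simGuess 𝒢 H A ρ d tgt ID' real a x ≤ 1 := by
  unfold simGuess; split_ifs <;> simp

theorem simCollision_nonneg (real : Bool) (a : ZMod (𝒢.grp d).p) (x : Choices L A n (𝒢.grp d).p) :
    0 ≤ simCollision 𝒢 H A ρ d tgt ID' real a x := by
  unfold simCollision; split_ifs <;> simp

theorem simCollision_le_one (real : Bool) (a : ZMod (𝒢.grp d).p) (x : Choices L A n (𝒢.grp d).p) :
    simCollision 𝒢 H A ρ d tgt ID' real a x ≤ 1 := by
  unfold simCollision; split_ifs <;> simp

theorem toReal_le_one {β : Type*} (P : PMF β) (b : β) : (P b).toReal ≤ 1 :=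
  ENNReal.toReal_mono ENNReal.one_ne_top (PMF.coe_le_one P b)

/-- The simulation is perfect up to collisions and up to the case `a = 0`. -/
theorem abs_gameIn_sub_le (hID' : readID (2 * n) (L n) tgt.fst = some ID') :
    |(gameIn 𝒢 H L A n ρ d ID' (tgt.snd.readBits n) true).toReal
      - (1 / 2 + 1 / 2 * ((𝔼 a : ZMod (𝒢.grp d).p, 𝔼 x, simGuess 𝒢 H A ρ d tgt ID' false a x)
        - 𝔼 a : ZMod (𝒢.grp d).p, 𝔼 x, simGuess 𝒢 H A ρ d tgt ID' true a x))|
      ≤ 1 / 2 * ((𝔼 a : ZMod (𝒢.grp d).p, 𝔼 x, simCollision 𝒢 H A ρ d tgt ID' false a x)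
        + 𝔼 a : ZMod (𝒢.grp d).p, 𝔼 x, simCollision 𝒢 H A ρ d tgt ID' true a x) + 1 / (𝒢.grp d).p := by
  have h0 : ∀ real, 0 ≤ 𝔼 x, simGuess 𝒢 H A ρ d tgt ID' real 0 x := fun real =>
    expect_nonneg' (simGuess_nonneg real 0)
  have h1 : ∀ real, 𝔼 x, simGuess 𝒢 H A ρ d tgt ID' real 0 x ≤ 1 := fun real =>
    expect_le_one (simGuess_le_one real 0)
  have h2 : ∀ real, 0 ≤ 𝔼 x, simCollision 𝒢 H A ρ d tgt ID' real 0 x := fun real =>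
    expect_nonneg' (simCollision_nonneg real 0)
  have h3 := toReal_le_one (gameIn 𝒢 H L A n ρ d ID' (tgt.snd.readBits n)) true
  have h4 : 0 ≤ (gameIn 𝒢 H L A n ρ d ID' (tgt.snd.readBits n) true).toReal := ENNReal.toReal_nonneg
  -- For `a = 0` both quantities lie between `0` and `1`, so the trivial bound applies.
  have := abs_expect_sub_le_add_inv (fun a ha => abs_gameIn_sub_le_of_ne_zero (𝒢 := 𝒢) (H := H) (A := A)
    (ρ := ρ) (d := d) hID' (a := a) ha) (by
      rw [abs_le]
      constructor <;> linarith [h0 true, h0 false, h1 true, h1 false, h2 true, h2 false])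
  simpa only [Fintype.expect_const, Finset.expect_add_distrib, Finset.expect_sub_distrib,
    ← Finset.mul_expect] using this

/-- The random choices of the simulator, from the exponents that it samples. -/
def choices {p : ℕ} (β c z : ZMod p) (x : (Fin 4 → ZMod p) × SetupExp L n p × QueryExp L A n p) :
    Choices L A n p :=
  (x.2.1, β, x.2.2.1, c, z, x.2.2.2)

/-- This form is for the collision finder, which takes all four secret exponents from its own array.
-/
theorem expect_choices_eq {p : ℕ} [NeZero p] (f : ZMod p → Choices L A n p → ℝ) :
    𝔼 a, 𝔼 x, f a x = 𝔼 x : (Fin 4 → ZMod p) × SetupExp L n p × QueryExp L A n p,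
      f (x.1 0) (choices (x.1 1) (x.1 2) (x.1 3) x) := by
  rw [← expect_prod fun x : ZMod p × Choices L A n p => f x.1 x.2]
  have h : Balanced fun x : (Fin 4 → ZMod p) × SetupExp L n p × QueryExp L A n p =>
      (x.1 0, choices (x.1 1) (x.1 2) (x.1 3) x) := by
    refine Balanced.of_bijective ⟨fun x y h => ?_, fun y => ?_⟩
    · simp only [choices, Prod.mk.injEq] at h
      obtain ⟨h0, hv, h1, hx, h2, h3, hy⟩ := h
      refine Prod.ext (funext fun k => ?_) (Prod.ext hv (Prod.ext hx hy))
      fin_cases k <;> assumption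
    · exact ⟨(![y.1, y.2.2.1, y.2.2.2.2.1, y.2.2.2.2.2.1], y.2.1, y.2.2.2.1, y.2.2.2.2.2.2), rfl⟩
  exact (h fun y => f y.1 y.2).symm

/-- This form is for the distinguisher: the secrets come from the challenge, and the four secret
entries of its own array are ignored. -/
theorem expect_choices_eq' {p : ℕ} [NeZero p] (f : ZMod p → Choices L A n p → ℝ) :
    𝔼 a, 𝔼 x, f a x = 𝔼 a, 𝔼 β, 𝔼 c, 𝔼 z,
      𝔼 x : (Fin 4 → ZMod p) × SetupExp L n p × QueryExp L A n p, f a (choices β c z x) := by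
  refine Finset.expect_congr rfl fun a _ => ?_
  let φ : (ZMod p × ZMod p × ZMod p × ((Fin 4 → ZMod p) × SetupExp L n p × QueryExp L A n p)) →+
      Choices L A n p :=
    { toFun := fun y => choices y.1 y.2.1 y.2.2.1 y.2.2.2
      map_zero' := rfl
      map_add' := fun _ _ => rfl }
  have h : Balanced φ := Balanced.of_hom φ fun x =>
    ⟨(x.2.1, x.2.2.2.1, x.2.2.2.2.1, 0, x.1, x.2.2.1, x.2.2.2.2.2), rfl⟩
  rw [← h fun x => f a x]
  simp only [expect_prod fun y : ZMod p × ZMod p × ZMod p ×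
    ((Fin 4 → ZMod p) × SetupExp L n p × QueryExp L A n p) => f a (φ y)]
  refine Finset.expect_congr rfl fun β _ => ?_
  rw [expect_prod]
  refine Finset.expect_congr rfl fun c _ => ?_
  rw [expect_prod]
  rfl

end Hybrid
end Sim

/-! ### The distinguisher and the collision finder -/

/-- A probabilistic algorithm that computes a polynomial-time function of its coins and input. -/
noncomputable def FP.toPPT {f : ℕ → Val → Val} (h : FP f) (q : Polynomial ℕ) : PPT where
  prog := Classical.choose h
  polyTime := (Classical.choose_spec h).1
  coins := q

theorem FP.out_toPPT {f : ℕ → Val → Val} (h : FP f) (q : Polynomial ℕ) (n ρ : ℕ) (x : Val) :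
    (h.toPPT q).out n ρ x = f n (.pair (.num ρ) x) :=
  (Classical.choose_spec h).2 n _

namespace Sim

noncomputable section

variable (𝒢 : GroupGenerator 3) (H : HashFunction) (L : ℕ → ℕ) (A : Adversary)

/-- The target that the adversary submits. -/
def target (n ρ : ℕ) : Val := move A n ρ (.num 0)

/-- The simulator's data for the target of the adversary. -/
def env (n : ℕ) (d ga hb gc Z : Val) (ρ y : ℕ) : Val :=
  mkEnv d ga hb gc Z ρ y (target A n ρ).fst (target A n ρ).snd (hashes H n (target A n ρ).fst)

def IsValid (n : ℕ) (tgt : Val) : Prop := 1 ≤ tgt.fst.toList.length ∧ tgt.fst.toList.length ≤ L n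

instance (n : ℕ) (tgt : Val) : Decidable (IsValid L n tgt) := inferInstanceAs (Decidable (_ ∧ _))

/-- The distinguisher, with input `(r, D)` where `r` are its coins. -/
def distinguish (n : ℕ) (x : Val) : Val :=
  let ρ := x.fst.toNat % 2 ^ A.coins.eval n
  let I := x.snd
  if IsValid L n (target A n ρ) ∧ move A n ρ (run 𝒢 H L A n (env H A n (I.nth 0) ((I.nth 1).nth 1)
    -- The element `g₁^(a^N)` is the last entry of the list of powers, so it is found without
    -- computing `N`.
    (mapV 𝒢 n (I.nth 0) 1 1 ((I.nth 1).nth ((I.nth 1).toList.length - 1)) (I.nth 3))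
    (I.nth 4) (I.nth 5) ρ (x.fst.toNat / 2 ^ A.coins.eval n))) = .num 1
  then .num 1 else .num 0

/-- The data of a simulation that samples the secret exponents itself. -/
def selfEnv (real : Bool) (n : ℕ) (d : Val) (ρ y : ℕ) : Val :=
  let w : ℕ → ℕ := fun k => rnd L A n d.fst.toNat y (L n + 1) k false
  env H A n d (powV 𝒢 n d 1 (genV d 0) (w 0)) (powV 𝒢 n d 2 (genV d 1) (w 1))
    (powV 𝒢 n d 1 (genV d 0) (w 2))
    (powV 𝒢 n d 3 (mapV 𝒢 n d 1 2 (genV d 0) (genV d 1)) (sessionExp real (w 0) (w 1) (w 2) (w 3))) ρ y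

/-- The collision finder for given groups. -/
def findIn (real : Bool) (n : ℕ) (d : Val) (ρ y : ℕ) : Val :=
  if IsValid L n (target A n ρ) then
    search H L A n ρ (target A n ρ).fst (run 𝒢 H L A n (selfEnv 𝒢 H L A real n d ρ y))
  else .num 0

/-- The collision finder, with input `(r, x)` where `r` are its coins. -/
def find (real : Bool) (n : ℕ) (x : Val) : Val :=
  let r := x.fst.toNat / 2 ^ 𝒢.gen.coins.eval n
  findIn 𝒢 H L A real n (𝒢.gen.out n (x.fst.toNat % 2 ^ 𝒢.gen.coins.eval n) (.num 3))
    (r % 2 ^ A.coins.eval n) (r / 2 ^ A.coins.eval n)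

section Time

variable {L} (hL : FN fun n _ => L n) (hLb : PB fun n _ => L n)

theorem fp_target {ρ : ℕ → Val → ℕ} (hρ : FN ρ) : FP fun n x => target A n (ρ n x) :=
  fp_move A hρ (FP.num 0)

theorem fp_env {d ga hb gc Z : ℕ → Val → Val} {ρ y : ℕ → Val → ℕ} (hd : FP d) (ha : FP ga)
    (hb' : FP hb) (hc : FP gc) (hZ : FP Z) (hρ : FN ρ) (hy : FN y) :
    FP fun n x => env H A n (d n x) (ga n x) (hb n x) (gc n x) (Z n x) (ρ n x) (y n x) :=
  have ht := fp_target A hρ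
  FL.cons hd (FL.cons ha (FL.cons hb' (FL.cons hc (FL.cons hZ (FL.cons hρ (FL.cons hy
    (FL.cons ht.fst (FL.cons ht.snd (FL.cons (fp_hashes H ht.fst) FL.nil)))))))))

theorem fn_two_pow (q : Polynomial ℕ) : FN fun n _ => 2 ^ q.eval n :=
  FN.pow (FP.num 2) (FN.polynomial q) (PB.eval q PB.param)

include hL

theorem fb_isValid {v : ℕ → Val → Val} (hv : FP v) : FB fun n x => decide (IsValid L n (v n x)) :=
  ((FP.num 1).leNat (FN.length (FL.toList hv.fst))).and ((FN.length (FL.toList hv.fst)).leNat hL)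

include hLb

theorem fp_distinguish : FP (distinguish 𝒢 H L A) := by
  have hρ := FP.id.fst.toNat.mod (fn_two_pow A.coins)
  have hI : FP fun _ x => x.snd := FP.id.snd
  have hd := hI.nth (FP.num 0)
  have hg := hI.nth (FP.num 1)
  exact ((fb_isValid hL (fp_target A hρ)).and ((fp_move A hρ (fp_run 𝒢 H A hL hLb
    (fp_env H A hd (hg.nth (FP.num 1))
      (fp_mapV 𝒢 hd (FP.num 1) (FP.num 1) (hg.nth ((FN.length (FL.toList hg)).sub (FP.num 1)))
        (hI.nth (FP.num 3))) (hI.nth (FP.num 4)) (hI.nth (FP.num 5)) hρ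
      (FP.id.fst.toNat.div (fn_two_pow A.coins))))).eq (FP.num 1))).ite (FP.num 1) (FP.num 0)

theorem fp_selfEnv (real : Bool) {d : ℕ → Val → Val} {ρ y : ℕ → Val → ℕ} (hd : FP d) (hρ : FN ρ)
    (hy : FN y) : FP fun n x => selfEnv 𝒢 H L A real n (d n x) (ρ n x) (y n x) := by
  have hw : ∀ k : ℕ, FN fun n x => rnd L A n (d n x).fst.toNat (y n x) (L n + 1) k false := fun k =>
    fn_rnd A hL hLb hd.fst.toNat hy (hL.add (FP.num 1)) (FP.num k) (FP.num 0)
  have hs : FN fun n x => sessionExp real (rnd L A n (d n x).fst.toNat (y n x) (L n + 1) 0 false)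
      (rnd L A n (d n x).fst.toNat (y n x) (L n + 1) 1 false)
      (rnd L A n (d n x).fst.toNat (y n x) (L n + 1) 2 false)
      (rnd L A n (d n x).fst.toNat (y n x) (L n + 1) 3 false) := by
    cases real
    · exact hw 3
    · exact ((hw 0).mul (hw 1)).mul (hw 2)
  exact fp_env H A hd (fp_powV 𝒢 hd (FP.num 1) (fp_genV hd 0) (hw 0))
    (fp_powV 𝒢 hd (FP.num 2) (fp_genV hd 1) (hw 1)) (fp_powV 𝒢 hd (FP.num 1) (fp_genV hd 0) (hw 2))
    (fp_powV 𝒢 hd (FP.num 3) (fp_mapV 𝒢 hd (FP.num 1) (FP.num 2) (fp_genV hd 0) (fp_genV hd 1)) hs)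
    hρ hy

theorem fp_find (real : Bool) : FP (find 𝒢 H L A real) := by
  have hr := FP.id.fst.toNat.div (fn_two_pow 𝒢.gen.coins)
  have hd : FP fun n x => 𝒢.gen.out n (x.fst.toNat % 2 ^ 𝒢.gen.coins.eval n) (.num 3) :=
    𝒢.gen.polyTime.fp.comp ((FP.id.fst.toNat.mod (fn_two_pow 𝒢.gen.coins)).pair (FP.num 3))
  have hρ := hr.mod (fn_two_pow A.coins)
  have hy := hr.div (fn_two_pow A.coins)
  exact (fb_isValid hL (fp_target A hρ)).ite (fp_search H A hL hρ (fp_target A hρ).fst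
    (fp_run 𝒢 H A hL hLb (fp_selfEnv 𝒢 H A hL hLb real hd hρ hy))) (FP.num 0)

end Time

/-! ### Both algorithms run the ideal simulation -/

section Correct

variable {𝒢 H L A} {n ρ y : ℕ} {d : Val} {ID' : HierID (2 * n) (L n)}

theorem isValid_iff {tgt : Val} : IsValid L n tgt ↔ ∃ ID', readID (2 * n) (L n) tgt.fst = some ID' := by
  rw [← Option.ne_none_iff_exists', Ne, readID_eq_none, not_not]
  rfl

variable (hd : d ∈ 𝒢.good n) (hp : 2 * n + 1 < (𝒢.grp d).p) (hp3 : 3 ≤ (𝒢.grp d).p)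
  (hID' : readID (2 * n) (L n) (target A n ρ).fst = some ID')
include hd hp hp3 hID'

theorem run_env_eq (real : Bool) (a β c z : ZMod (𝒢.grp d).p) :
    run 𝒢 H L A n (env H A n d (𝒢.enc d 1 ((𝒢.grp d).gp 1 a)) (𝒢.enc d 2 ((𝒢.grp d).gp 2 β))
      (𝒢.enc d 1 ((𝒢.grp d).gp 1 c)) (𝒢.enc d 3 ((𝒢.grp d).gp 3 (sessionExp real a β c z))) ρ y)
    = .ofList (simTranscript 𝒢 H A ρ d (target A n ρ) ID' real a
        (choices β c z (randomParts L A n (𝒢.grp d).p y))) := by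
  have hp' : d.fst.toNat = (𝒢.grp d).p := by rw [𝒢.fst_eq hd, Val.toNat_num]
  have h := run_eq (H := H) (L := L) (A := A) (E := env H A n d (𝒢.enc d 1 ((𝒢.grp d).gp 1 a))
    (𝒢.enc d 2 ((𝒢.grp d).gp 2 β)) (𝒢.enc d 1 ((𝒢.grp d).gp 1 c))
    (𝒢.enc d 3 ((𝒢.grp d).gp 3 (sessionExp real a β c z))) ρ y) hd rfl (a := a) rfl (β := β) rfl hp hp3
    (tgt := target A n ρ) (c := c) rfl rfl rfl rfl hID' _ rfl
  rw [h]
  have hu : ∀ row j b, u L A n (env H A n d (𝒢.enc d 1 ((𝒢.grp d).gp 1 a))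
    (𝒢.enc d 2 ((𝒢.grp d).gp 2 β)) (𝒢.enc d 1 ((𝒢.grp d).gp 1 c))
    (𝒢.enc d 3 ((𝒢.grp d).gp 3 (sessionExp real a β c z))) ρ y) row j b
      = rnd L A n (𝒢.grp d).p y row j b := fun row j b => by
    change rnd L A n d.fst.toNat y row j b = _
    rw [hp']
  -- The quantities `delta`, `coeffJ` and `shift` read only the target entries of the data, so `env`
  -- may be replaced by `targetEnv`, whose other entries are dummies.
  simp only [keyRnd, hu]
  rfl

theorem findIn_eq (real : Bool) : findIn 𝒢 H L A real n d ρ y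
    = search H L A n ρ (target A n ρ).fst (.ofList (simTranscript 𝒢 H A ρ d (target A n ρ) ID' real
      ((randomParts L A n (𝒢.grp d).p y).1 0) (choices ((randomParts L A n (𝒢.grp d).p y).1 1)
      ((randomParts L A n (𝒢.grp d).p y).1 2) ((randomParts L A n (𝒢.grp d).p y).1 3)
      (randomParts L A n (𝒢.grp d).p y)))) := by
  rw [findIn, if_pos (isValid_iff.2 ⟨_, hID'⟩), ← run_env_eq hd hp hp3 hID' real, selfEnv]
  have hp' : d.fst.toNat = (𝒢.grp d).p := by rw [𝒢.fst_eq hd, Val.toNat_num]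
  have h3 : mapV 𝒢 n d 1 2 (genV d 0) (genV d 1) = 𝒢.enc d 3 ((𝒢.grp d).gp 3 (1 * 1)) := by
    rw [genV_zero hd, genV_one hd]
    exact mapV_enc hd le_rfl (by norm_num) le_rfl 1 1
  simp only [h3, hp']
  rw [genV_zero hd, genV_one hd, powV_enc hd le_rfl (by norm_num), powV_enc hd (by norm_num) (by norm_num),
    powV_enc hd le_rfl (by norm_num), powV_enc hd (by norm_num) le_rfl]
  have hs : ((sessionExp real (rnd L A n (𝒢.grp d).p y (L n + 1) 0 false)
      (rnd L A n (𝒢.grp d).p y (L n + 1) 1 false) (rnd L A n (𝒢.grp d).p y (L n + 1) 2 false)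
      (rnd L A n (𝒢.grp d).p y (L n + 1) 3 false) : ℕ) : ZMod (𝒢.grp d).p)
      = sessionExp real ((randomParts L A n (𝒢.grp d).p y).1 0) ((randomParts L A n (𝒢.grp d).p y).1 1)
        ((randomParts L A n (𝒢.grp d).p y).1 2) ((randomParts L A n (𝒢.grp d).p y).1 3) := by
    cases real
    · rfl
    · simp only [sessionExp, if_true, Nat.cast_mul]; rfl
  simp only [one_mul, hs]
  rfl

/-- The challenge is the simulation with `β = a^N b`, whose real session key has exponent `a β c =
a^(N+1) b c`. The condition `N ≥ 1` guarantees that `g₁^a` is among the listed powers. -/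
theorem distinguish_eq (real : Bool) {N : ℕ} (hN : 1 ≤ N)
    (a b c z : ZMod (𝒢.grp d).p) {r : ℕ} (hr : r % 2 ^ A.coins.eval n = ρ)
    (hr' : r / 2 ^ A.coins.eval n = y) :
    distinguish 𝒢 H L A n (.pair (.num r) (mdheInstance 𝒢 N d a b c
      (if real then (𝒢.grp d).g 3 ^ (a ^ (N + 1) * b * c).val else (𝒢.grp d).gp 3 z)))
    = if A.move n ρ (simTranscript 𝒢 H A ρ d (target A n ρ) ID' real a
        (choices (a ^ N * b) c z (randomParts L A n (𝒢.grp d).p y))) = .num 1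
      then .num 1 else .num 0 := by
  have hZ : (if real then (𝒢.grp d).g 3 ^ (a ^ (N + 1) * b * c).val else (𝒢.grp d).gp 3 z)
      = (𝒢.grp d).gp 3 (sessionExp real a (a ^ N * b) c z) := by
    cases real
    · rfl
    · simp only [sessionExp, if_true, gp]
      congr 2
      ring
  have hB : mapV 𝒢 n d 1 1 (𝒢.enc d 1 ((𝒢.grp d).gp 1 (a ^ N))) (𝒢.enc d 1 ((𝒢.grp d).gp 1 b))
      = 𝒢.enc d 2 ((𝒢.grp d).gp 2 (a ^ N * b)) :=
    mapV_enc hd le_rfl le_rfl (by norm_num) _ _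
  rw [hZ]
  set Z := (𝒢.grp d).gp 3 (sessionExp real a (a ^ N * b) c z) with hZdef
  set I := mdheInstance 𝒢 N d a b c Z with hI
  have hv := isValid_iff.2 ⟨_, hID'⟩
  have h1 : I.nth 1 = .ofList ((List.range (N + 1)).map fun i =>
      𝒢.enc d 1 ((𝒢.grp d).gp 1 (a ^ i))) := rfl
  have h2 : (I.nth 1).nth 1 = 𝒢.enc d 1 ((𝒢.grp d).gp 1 a) := by
    rw [h1, Val.nth_ofList, List.getD_eq_getElem _ _ (by simp; omega)]
    simp
  have h3 : (I.nth 1).nth ((I.nth 1).toList.length - 1) = 𝒢.enc d 1 ((𝒢.grp d).gp 1 (a ^ N)) := by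
    rw [h1, Val.nth_ofList, Val.toList_ofList, List.getD_eq_getElem _ _ (by simp)]
    simp
  have h0 : I.nth 0 = d := rfl
  have h4 : I.nth 3 = 𝒢.enc d 1 ((𝒢.grp d).gp 1 b) := rfl
  have h5 : I.nth 4 = 𝒢.enc d 1 ((𝒢.grp d).gp 1 c) := rfl
  have h6 : I.nth 5 = 𝒢.enc d 3 Z := rfl
  simp only [distinguish, Val.fst_pair, Val.snd_pair, Val.toNat_num, hr, hr', hv, true_and]
  rw [h3, h2, h0, h4, h5, h6, hB, hZdef, run_env_eq hd hp hp3 hID' real]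
  rfl

end Correct

end

end Sim

/-! ### Probabilities -/

theorem expect_fin_divMod {M K S : ℕ} (hS : S = K * M) (f : ℕ → ℕ → ℝ) :
    𝔼 r : Fin S, f (r % M) (r / M) = 𝔼 i : Fin M, 𝔼 j : Fin K, f i j := by
  subst hS
  rw [Finset.expect_comm, ← expect_prod fun x : Fin K × Fin M => f x.2 x.1]
  exact Fintype.expect_equiv finProdFinEquiv.symm _ _ fun r => rfl

theorem PPT.run_eq_map (B : PPT) (n : ℕ) (x : Val) : B.run n x
    = (PMF.uniformOfFintype (Fin (2 ^ B.coins.eval n))).map fun r : Fin _ => B.out n r x := by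
  change PMF.map _ ((PMF.uniformOfFintype _).bind (PMF.pure ∘ _)) = _
  rw [PMF.bind_pure_comp, PMF.map_comp]
  rfl

theorem PPT.toReal_run_bind {β : Type*} (B : PPT) (n : ℕ) (x : Val) (f : Val → PMF β) (b : β) :
    (((B.run n x).bind f) b).toReal = 𝔼 r : Fin (2 ^ B.coins.eval n), (f (B.out n r x) b).toReal := by
  rw [PPT.run_eq_map, PMF.bind_map, toReal_uniform_bind]
  rfl

theorem PPT.toReal_run_apply (B : PPT) (n : ℕ) (x v : Val) :
    ((B.run n x) v).toReal
      = 𝔼 r : Fin (2 ^ B.coins.eval n), if v = B.out n r x then (1 : ℝ) else 0 := by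
  rw [PPT.run_eq_map, toReal_uniform_map]

theorem abs_sub_le_one {x y : ℝ} (hx : 0 ≤ x) (hx' : x ≤ 1) (hy : 0 ≤ y) (hy' : y ≤ 1) :
    |x - y| ≤ 1 := by
  rw [abs_le]
  constructor <;> linarith

/-- The probability that the distinguisher outputs `0`, for given groups. -/
noncomputable def mdheProb (𝒢 : GroupGenerator 3) (N : ℕ) (B : PPT) (n : ℕ) (d : Val)
    (real : Bool) : ℝ :=
  𝔼 a : ZMod (𝒢.grp d).p, 𝔼 b : ZMod (𝒢.grp d).p, 𝔼 c : ZMod (𝒢.grp d).p, 𝔼 z : ZMod (𝒢.grp d).p,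
    (B.run n (mdheInstance 𝒢 N d a b c (if real then (𝒢.grp d).g 3 ^ (a ^ (N + 1) * b * c).val
      else (𝒢.grp d).gp 3 z)) (.num 0)).toReal

theorem toReal_mdheExperiment (𝒢 : GroupGenerator 3) (N : ℕ) (B : PPT) (n : ℕ) (real : Bool) :
    (mdheExperiment 𝒢 N B n real (.num 0)).toReal
      = 𝔼 r : Fin (2 ^ 𝒢.gen.coins.eval n), mdheProb 𝒢 N B n (𝒢.gen.out n r (.num 3)) real := by
  change (((𝒢.gen.run n (.num 3)).bind fun d => (PMF.uniformOfFintype (ZMod (𝒢.grp d).p)).bind fun a =>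
    (PMF.uniformOfFintype (ZMod (𝒢.grp d).p)).bind fun b =>
    (PMF.uniformOfFintype (ZMod (𝒢.grp d).p)).bind fun c =>
    (PMF.uniformOfFintype ((𝒢.grp d).G 3)).bind fun Z => B.run n (mdheInstance 𝒢 N d a b c
      (if real then (𝒢.grp d).g 3 ^ (a ^ (N + 1) * b * c).val else Z))) (.num 0)).toReal = _
  rw [PPT.toReal_run_bind]
  refine Finset.expect_congr rfl fun r _ => ?_
  simp only [toReal_uniform_bind]
  refine Finset.expect_congr rfl fun a _ => Finset.expect_congr rfl fun b _ =>
    Finset.expect_congr rfl fun c _ => ?_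
  exact (Balanced.of_bijective (gp_bijective (by norm_num) le_rfl) fun Z => _).symm

namespace Sim

/-! ### Deviation from a fair coin, for given coins and groups -/

section Deviation

variable (𝒢 : GroupGenerator 3) (H : HashFunction) (L : ℕ → ℕ) (A : Adversary) (n ρ : ℕ) (d : Val)

/-- The probability of the guess `1` in the simulated experiment. -/
noncomputable def avgGuess (real : Bool) : ℝ :=
  match readID (2 * n) (L n) (target A n ρ).fst with
  | none => 0
  | some ID' => 𝔼 a : ZMod (𝒢.grp d).p, 𝔼 x, simGuess 𝒢 H A ρ d (target A n ρ) ID' real a x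

/-- The probability of a collision in the simulated experiment. -/
noncomputable def avgCollision (real : Bool) : ℝ :=
  match readID (2 * n) (L n) (target A n ρ).fst with
  | none => 0
  | some ID' => 𝔼 a : ZMod (𝒢.grp d).p, 𝔼 x, simCollision 𝒢 H A ρ d (target A n ρ) ID' real a x

/-- The deviation from `1 / 2` of the probability that the adversary wins. -/
noncomputable def deviation : ℝ :=
  match readID (2 * n) (L n) (target A n ρ).fst with
  | none => 0
  | some ID' => (gameIn 𝒢 H L A n ρ d ID' ((target A n ρ).snd.readBits n) true).toReal - 1 / 2

variable {𝒢 H L A n ρ d}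

/-- If the submitted target is invalid, the experiment is a fair coin and all terms but `1 / p` are
set to `0`. -/
theorem abs_deviation_sub_le :
    |deviation 𝒢 H L A n ρ d - 1 / 2 * (avgGuess 𝒢 H L A n ρ d false - avgGuess 𝒢 H L A n ρ d true)|
      ≤ 1 / 2 * (avgCollision 𝒢 H L A n ρ d false + avgCollision 𝒢 H L A n ρ d true)
        + 1 / (𝒢.grp d).p := by
  unfold deviation avgGuess avgCollision
  cases h : readID (2 * n) (L n) (target A n ρ).fst with
  | none => simp
  | some ID' =>
    simp only
    rw [sub_sub]
    exact abs_gameIn_sub_le h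

theorem abs_deviation_le : |deviation 𝒢 H L A n ρ d| ≤ 1 / 2 := by
  unfold deviation
  cases readID (2 * n) (L n) (target A n ρ).fst with
  | none => simp
  | some ID' =>
    have h3 := toReal_le_one (gameIn 𝒢 H L A n ρ d ID' ((target A n ρ).snd.readBits n)) true
    have h4 : 0 ≤ (gameIn 𝒢 H L A n ρ d ID' ((target A n ρ).snd.readBits n) true).toReal :=
      ENNReal.toReal_nonneg
    simp only
    rw [abs_le]
    constructor <;> linarith

theorem toReal_game_sub : (game 𝒢 H (L n) A n true).toReal - 1 / 2
    = 𝔼 ρ : Fin (2 ^ A.coins.eval n), 𝔼 r : Fin (2 ^ 𝒢.gen.coins.eval n),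
      deviation 𝒢 H L A n ρ (𝒢.gen.out n r (.num 3)) := by
  have h : (game 𝒢 H (L n) A n true).toReal = 𝔼 ρ : Fin (2 ^ A.coins.eval n),
      𝔼 r : Fin (2 ^ 𝒢.gen.coins.eval n),
        (deviation 𝒢 H L A n ρ (𝒢.gen.out n r (.num 3)) + 1 / 2) := by
    unfold game
    change (((PMF.uniformOfFintype (Fin (2 ^ A.coins.eval n))).bind _) true).toReal = _
    rw [toReal_uniform_bind]
    refine Finset.expect_congr rfl fun ρ _ => ?_
    unfold deviation
    cases h : readID (2 * n) (L n) (target A n ρ).fst with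
    | none =>
      have h' : readID (2 * n) (L n) (A.move n ρ []).fst = none := h
      simp [h']
    | some ID' =>
      have h' : readID (2 * n) (L n) (A.move n ρ []).fst = some ID' := h
      simp only [h', gameFrom_eq, GroupGenerator.sample, PPT.toReal_run_bind, sub_add_cancel]
      rfl
  rw [h]
  simp only [Finset.expect_add_distrib, Fintype.expect_const]
  ring

end Deviation

/-! ### The algorithms compared with the ideal simulation -/

section Bounds

variable {𝒢 : GroupGenerator 3} {H : HashFunction} {L : ℕ → ℕ} {A : Adversary} {n : ℕ} {d : Val}
  (hL : FN fun n _ => L n) (hLb : PB fun n _ => L n) (κ : Polynomial ℕ)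
  (hd : d ∈ 𝒢.good n) (hp : 2 * n + 1 < (𝒢.grp d).p) (hp3 : 3 ≤ (𝒢.grp d).p)
  (hκ : (𝒢.grp d).p ^ digits L A n * 2 ^ n ≤ 2 ^ κ.eval n)

include hκ in
theorem error_le : (((𝒢.grp d).p ^ digits L A n : ℕ) : ℝ) / (2 ^ κ.eval n : ℕ) ≤ 1 / 2 ^ n := by
  rw [div_le_div_iff₀ (by positivity) (by positivity), one_mul]
  exact_mod_cast hκ

theorem expect_comm₄ {α ι : Type} [Fintype α] [Fintype ι] (f : α → α → α → α → ι → ℝ) :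
    𝔼 a, 𝔼 b, 𝔼 c, 𝔼 z, 𝔼 r, f a b c z r = 𝔼 r, 𝔼 a, 𝔼 b, 𝔼 c, 𝔼 z, f a b c z r := by
  have h1 : ∀ a b c, 𝔼 z, 𝔼 r, f a b c z r = 𝔼 r, 𝔼 z, f a b c z r := fun a b c =>
    Finset.expect_comm _ _ _
  have h2 : ∀ a b, 𝔼 c, 𝔼 r, 𝔼 z, f a b c z r = 𝔼 r, 𝔼 c, 𝔼 z, f a b c z r := fun a b =>
    Finset.expect_comm _ _ _
  have h3 : ∀ a, 𝔼 b, 𝔼 r, 𝔼 c, 𝔼 z, f a b c z r = 𝔼 r, 𝔼 b, 𝔼 c, 𝔼 z, f a b c z r := fun a =>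
    Finset.expect_comm _ _ _
  simp only [h1, h2, h3]
  exact Finset.expect_comm _ _ _

/-- The algorithm that breaks the assumption on the groups. -/
noncomputable def distinguisher (𝒢 : GroupGenerator 3) (H : HashFunction) (A : Adversary) : PPT :=
  (fp_distinguish 𝒢 H A hL hLb).toPPT (A.coins + κ)

/-- The algorithm that finds collisions. -/
noncomputable def finder (𝒢 : GroupGenerator 3) (H : HashFunction) (A : Adversary) (real : Bool) : PPT :=
  (fp_find 𝒢 H A hL hLb real).toPPT (𝒢.gen.coins + (A.coins + κ))

include hd hp hp3 hκ

/-- The finder performs the simulation exactly, except that its exponents come from coins. -/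
theorem avgCollision_le [DecidablePred (H.IsCollision n)] (ρ : ℕ) (real : Bool) :
    avgCollision 𝒢 H L A n ρ d real ≤ (𝔼 y : Fin (2 ^ κ.eval n),
      if H.IsCollision n (findIn 𝒢 H L A real n d ρ y) then (1 : ℝ) else 0) + 1 / 2 ^ n := by
  unfold avgCollision
  cases hID' : readID (2 * n) (L n) (target A n ρ).fst with
  | none =>
    simp only
    have : 0 ≤ 𝔼 y : Fin (2 ^ κ.eval n),
        if H.IsCollision n (findIn 𝒢 H L A real n d ρ y) then (1 : ℝ) else 0 :=
      expect_nonneg' fun y => by split_ifs <;> simp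
    positivity
  | some ID' =>
    simp only
    have h := abs_expect_randomParts_sub_le (L := L) (A := A) (n := n) (p := (𝒢.grp d).p)
      (K := 2 ^ κ.eval n) (by positivity)
      (F := fun x => simCollision 𝒢 H A ρ d (target A n ρ) ID' real (x.1 0)
        (choices (x.1 1) (x.1 2) (x.1 3) x))
      (fun _ => simCollision_nonneg _ _ _) fun _ => simCollision_le_one _ _ _
    rw [← expect_choices_eq fun a x => simCollision 𝒢 H A ρ d (target A n ρ) ID' real a x] at h
    have h2 := (abs_le.1 (h.trans (error_le κ hκ))).1
    have h3 : ∀ y : ℕ, simCollision 𝒢 H A ρ d (target A n ρ) ID' real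
        ((randomParts L A n (𝒢.grp d).p y).1 0) (choices ((randomParts L A n (𝒢.grp d).p y).1 1)
        ((randomParts L A n (𝒢.grp d).p y).1 2) ((randomParts L A n (𝒢.grp d).p y).1 3)
        (randomParts L A n (𝒢.grp d).p y))
        = if H.IsCollision n (findIn 𝒢 H L A real n d ρ y) then (1 : ℝ) else 0 := by
      intro y
      rw [findIn_eq hd hp hp3 hID', simCollision]
      congr
    simp only [h3] at h2
    linarith

-- Two imperfections of the distinguisher: exponents from coins cost `2^(-n)`, and `β = a^N b` is
-- uniform only for `a ≠ 0`, which costs `1 / p`.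
omit hd hp hp3 in
theorem abs_expect_simGuess_sub_le {N ρ : ℕ} {tgt : Val}
    {ID' : HierID (2 * n) (L n)} (real : Bool) :
    |(𝔼 a : ZMod (𝒢.grp d).p, 𝔼 b : ZMod (𝒢.grp d).p, 𝔼 c : ZMod (𝒢.grp d).p,
        𝔼 z : ZMod (𝒢.grp d).p, 𝔼 y : Fin (2 ^ κ.eval n), simGuess 𝒢 H A ρ d tgt ID' real a
          (choices (a ^ N * b) c z (randomParts L A n (𝒢.grp d).p y)))
      - 𝔼 a, 𝔼 x, simGuess 𝒢 H A ρ d tgt ID' real a x| ≤ 1 / 2 ^ n + 1 / (𝒢.grp d).p := by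
  have h1 : ∀ a β, |(𝔼 c : ZMod (𝒢.grp d).p, 𝔼 z : ZMod (𝒢.grp d).p, 𝔼 y : Fin (2 ^ κ.eval n),
      simGuess 𝒢 H A ρ d tgt ID' real a (choices β c z (randomParts L A n (𝒢.grp d).p y)))
      - 𝔼 c, 𝔼 z, 𝔼 x, simGuess 𝒢 H A ρ d tgt ID' real a (choices β c z x)| ≤ 1 / 2 ^ n := by
    intro a β
    have := abs_expect_sub_le fun c : ZMod (𝒢.grp d).p => abs_expect_sub_le fun z : ZMod (𝒢.grp d).p =>
      (abs_expect_randomParts_sub_le (L := L) (A := A) (n := n) (p := (𝒢.grp d).p)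
      (K := 2 ^ κ.eval n) (by positivity)
      (F := fun x => simGuess 𝒢 H A ρ d tgt ID' real a (choices β c z x))
      (fun _ => simGuess_nonneg _ _ _) fun _ => simGuess_le_one _ _ _).trans (error_le κ hκ)
    simpa only [Fintype.expect_const] using this
  rw [expect_choices_eq']
  have h2 : ∀ a : ZMod (𝒢.grp d).p, a ≠ 0 → |(𝔼 b : ZMod (𝒢.grp d).p, 𝔼 c : ZMod (𝒢.grp d).p,
        𝔼 z : ZMod (𝒢.grp d).p, 𝔼 y : Fin (2 ^ κ.eval n), simGuess 𝒢 H A ρ d tgt ID' real a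
          (choices (a ^ N * b) c z (randomParts L A n (𝒢.grp d).p y)))
      - 𝔼 β, 𝔼 c, 𝔼 z, 𝔼 x, simGuess 𝒢 H A ρ d tgt ID' real a (choices β c z x)| ≤ 1 / 2 ^ n := by
    intro a ha
    rw [Balanced.of_bijective (mulLeft_bijective₀ (a ^ N) (pow_ne_zero N ha)) fun β =>
      𝔼 c : ZMod (𝒢.grp d).p, 𝔼 z : ZMod (𝒢.grp d).p, 𝔼 y : Fin (2 ^ κ.eval n),
        simGuess 𝒢 H A ρ d tgt ID' real a (choices β c z (randomParts L A n (𝒢.grp d).p y))]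
    have := abs_expect_sub_le (h1 a)
    simpa only [Fintype.expect_const] using this
  have h3 := abs_expect_sub_le_add_inv h2 ((abs_sub_le_one
    (expect_nonneg' fun b => expect_nonneg' fun c => expect_nonneg' fun z => expect_nonneg' fun y =>
      simGuess_nonneg _ _ _)
    (expect_le_one fun b => expect_le_one fun c => expect_le_one fun z => expect_le_one fun y =>
      simGuess_le_one _ _ _)
    (expect_nonneg' fun b => expect_nonneg' fun c => expect_nonneg' fun z => expect_nonneg' fun y =>
      simGuess_nonneg _ _ _)
    (expect_le_one fun b => expect_le_one fun c => expect_le_one fun z => expect_le_one fun y =>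
      simGuess_le_one _ _ _)).trans (by simp))
  simpa only [Fintype.expect_const] using h3

/-- The assumption counts the output `0`, while the distinguisher outputs `1` on the guess `1`;
hence the complement. On an invalid target the output is always `0`, in accordance with `avgGuess =
0`. -/
theorem abs_mdheProb_sub_le {N : ℕ} (hN : 1 ≤ N) (real : Bool) :
    |mdheProb 𝒢 N (distinguisher hL hLb κ 𝒢 H A) n d real
      - (1 - 𝔼 ρ : Fin (2 ^ A.coins.eval n), avgGuess 𝒢 H L A n ρ d real)|
      ≤ 1 / 2 ^ n + 1 / (𝒢.grp d).p := by
  let g : ℕ → ℕ → ZMod (𝒢.grp d).p → ZMod (𝒢.grp d).p → ZMod (𝒢.grp d).p → ZMod (𝒢.grp d).p → ℝ :=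
    fun ρ y a b c z => match readID (2 * n) (L n) (target A n ρ).fst with
      | none => 1
      | some ID' => 1 - simGuess 𝒢 H A ρ d (target A n ρ) ID' real a
          (choices (a ^ N * b) c z (randomParts L A n (𝒢.grp d).p y))
  have h1 : mdheProb 𝒢 N (distinguisher hL hLb κ 𝒢 H A) n d real
      = 𝔼 ρ : Fin (2 ^ A.coins.eval n), 𝔼 a, 𝔼 b, 𝔼 c, 𝔼 z, 𝔼 y : Fin (2 ^ κ.eval n), g ρ y a b c z := by
    rw [mdheProb, ← expect_comm₄]
    refine Finset.expect_congr rfl fun a _ => Finset.expect_congr rfl fun b _ =>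
      Finset.expect_congr rfl fun c _ => Finset.expect_congr rfl fun z _ => ?_
    -- The low-order coins are those of the adversary, and the high-order ones form the number `y`.
    rw [PPT.toReal_run_apply, ← expect_fin_divMod (f := fun ρ y => g ρ y a b c z)
      (S := 2 ^ (distinguisher hL hLb κ 𝒢 H A).coins.eval n)
      (by rw [← pow_add, add_comm, ← Polynomial.eval_add]; rfl)]
    refine Finset.expect_congr rfl fun r _ => ?_
    have hout : (distinguisher hL hLb κ 𝒢 H A).out n r (mdheInstance 𝒢 N d a b c
        (if real then (𝒢.grp d).g 3 ^ (a ^ (N + 1) * b * c).val else (𝒢.grp d).gp 3 z))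
        = distinguish 𝒢 H L A n _ := FP.out_toPPT _ _ _ _ _
    rw [hout]
    simp only [g]
    cases hID' : readID (2 * n) (L n) (target A n (r % 2 ^ A.coins.eval n)).fst with
    | none =>
      have : ¬ IsValid L n (target A n (r % 2 ^ A.coins.eval n)) := by
        rw [isValid_iff, hID']; simp
      simp [distinguish, this]
    | some ID' =>
      rw [distinguish_eq hd hp hp3 hID' real hN a b c z rfl rfl]
      simp only [simGuess]
      split_ifs <;> simp_all
  rw [h1]
  have h2 : (1 : ℝ) - 𝔼 ρ : Fin (2 ^ A.coins.eval n), avgGuess 𝒢 H L A n ρ d real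
      = 𝔼 ρ : Fin (2 ^ A.coins.eval n), (1 - avgGuess 𝒢 H L A n ρ d real) := by
    rw [Finset.expect_sub_distrib, Fintype.expect_const]
  rw [h2]
  refine (abs_expect_sub_le (h := fun _ => 1 / 2 ^ n + 1 / ((𝒢.grp d).p : ℝ)) fun ρ => ?_).trans_eq
    (Fintype.expect_const _)
  simp only [g]
  unfold avgGuess
  cases hID' : readID (2 * n) (L n) (target A n ρ).fst with
  | none =>
    simp only [Fintype.expect_const, sub_zero, sub_self, abs_zero]
    positivity
  | some ID' =>
    simp only [Finset.expect_sub_distrib, Fintype.expect_const]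
    rw [sub_sub_sub_cancel_left, abs_sub_comm]
    exact abs_expect_simGuess_sub_le κ hκ real

end Bounds

end Sim

namespace Sim

/-! ### Assembling the reduction -/

section Security

variable {𝒢 : GroupGenerator 3} {H : HashFunction} {L : ℕ → ℕ} {A : Adversary}
  (hL : FN fun n _ => L n) (hLb : PB fun n _ => L n)

variable (𝒢 A) in
include hLb in
/-- Polynomially many coins suffice to sample the exponents. -/
theorem exists_coins : ∃ κ : Polynomial ℕ, ∀ (n : ℕ) (r : Fin (2 ^ 𝒢.gen.coins.eval n)),
    𝒢.gen.out n r (.num 3) ∈ 𝒢.good n →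
      (𝒢.grp (𝒢.gen.out n r (.num 3))).p ^ digits L A n * 2 ^ n ≤ 2 ^ κ.eval n := by
  obtain ⟨q, hq⟩ := FP.size 𝒢.gen.polyTime.fp
  obtain ⟨D, hD⟩ := pb_digits A hLb
  -- The order `p` is written in the output of the generator, so its bit length is at most the
  -- generator's running time. Multiplying by the number of digits bounds the length of `p ^
  -- digits`, and `n` further coins push the bias below `2^(-n)`.
  refine ⟨q.comp (Polynomial.X + 𝒢.gen.coins + 5) * D.comp (Polynomial.X + 1) + Polynomial.X,
    fun n r hr => ?_⟩
  have h1 : (𝒢.grp (𝒢.gen.out n r (.num 3))).p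
      ≤ 2 ^ (q.comp (Polynomial.X + 𝒢.gen.coins + 5)).eval n := by
    have h2 := (𝒢.gen.out n r (.num 3)).size_fst_le
    rw [𝒢.fst_eq hr, Val.size_num] at h2
    have h3 : (𝒢.gen.out n r (.num 3)).size ≤ _ := hq n (.pair (.num r) (.num 3))
    have h4 : Nat.size r ≤ 𝒢.gen.coins.eval n := Nat.size_le.2 r.2
    have h5 : q.eval (n + (Val.pair (.num r) (.num 3)).size)
        ≤ (q.comp (Polynomial.X + 𝒢.gen.coins + 5)).eval n := by
      rw [Polynomial.eval_comp]
      refine eval_le_eval q ?_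
      have : Nat.size 3 = 2 := by decide
      simp only [Val.size_pair, Val.size_num, this, Polynomial.eval_add, Polynomial.eval_X,
        Polynomial.eval_ofNat]
      omega
    exact (Nat.lt_size_self _).le.trans (Nat.pow_le_pow_right two_pos (by omega))
  have h2 : digits L A n ≤ (D.comp (Polynomial.X + 1)).eval n := by
    refine (hD n (.num 0)).trans_eq ?_
    simp [Polynomial.eval_comp]
  rw [Polynomial.eval_add, Polynomial.eval_mul, Polynomial.eval_X, pow_add, pow_mul]
  refine Nat.mul_le_mul_right _ ((Nat.pow_le_pow_left h1 _).trans ?_)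
  exact Nat.pow_le_pow_right (by positivity) h2

theorem toReal_finder (κ : Polynomial ℕ) (n : ℕ) (real : Bool) [DecidablePred (H.IsCollision n)] :
    (((finder hL hLb κ 𝒢 H A real).run n (.num 0)).toOuterMeasure {v | H.IsCollision n v}).toReal
      = 𝔼 r : Fin (2 ^ 𝒢.gen.coins.eval n), 𝔼 ρ : Fin (2 ^ A.coins.eval n),
        𝔼 y : Fin (2 ^ κ.eval n), if H.IsCollision n
          (findIn 𝒢 H L A real n (𝒢.gen.out n r (.num 3)) ρ y) then (1 : ℝ) else 0 := by
  classical
  rw [PPT.run_eq_map, toReal_outerMeasure_map]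
  have h1 : ∀ r : ℕ, 𝔼 ρ : Fin (2 ^ A.coins.eval n), 𝔼 y : Fin (2 ^ κ.eval n), (if H.IsCollision n
      (findIn 𝒢 H L A real n (𝒢.gen.out n r (.num 3)) ρ y) then (1 : ℝ) else 0)
      = 𝔼 s : Fin (2 ^ (A.coins + κ).eval n), if H.IsCollision n (findIn 𝒢 H L A real n
        (𝒢.gen.out n r (.num 3)) (s % 2 ^ A.coins.eval n) (s / 2 ^ A.coins.eval n)) then 1 else 0 :=
    fun r => (expect_fin_divMod (by rw [← pow_add, add_comm, ← Polynomial.eval_add]) fun ρ y =>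
      if H.IsCollision n (findIn 𝒢 H L A real n (𝒢.gen.out n r (.num 3)) ρ y) then (1 : ℝ) else 0).symm
  simp only [h1]
  rw [← expect_fin_divMod (S := 2 ^ (finder hL hLb κ 𝒢 H A real).coins.eval n)
    (by rw [← pow_add, add_comm, ← Polynomial.eval_add]; rfl)
    fun r s => if H.IsCollision n (findIn 𝒢 H L A real n (𝒢.gen.out n r (.num 3))
      (s % 2 ^ A.coins.eval n) (s / 2 ^ A.coins.eval n)) then (1 : ℝ) else 0]
  refine Finset.expect_congr rfl fun r _ => ?_
  have hout : (finder hL hLb κ 𝒢 H A real).out n r (.num 0) = find 𝒢 H L A real n _ :=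
    FP.out_toPPT _ _ _ _ _
  rw [hout]
  congr

theorem mdheProb_nonneg {N : ℕ} {B : PPT} {n : ℕ} {d : Val} {real : Bool} :
    0 ≤ mdheProb 𝒢 N B n d real :=
  expect_nonneg' fun _ => expect_nonneg' fun _ => expect_nonneg' fun _ => expect_nonneg' fun _ =>
    ENNReal.toReal_nonneg

theorem mdheProb_le_one {N : ℕ} {B : PPT} {n : ℕ} {d : Val} {real : Bool} :
    mdheProb 𝒢 N B n d real ≤ 1 :=
  expect_le_one fun _ => expect_le_one fun _ => expect_le_one fun _ => expect_le_one fun _ =>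
    toReal_le_one _ _

/-- Together with `2 ^ n < p` this yields `2 n + 1 < p`, as required for inverting `J`; it fails for
`n = 1, 2`, whence the restriction to `n ≥ 3`. -/
theorem two_mul_add_one_le_two_pow {n : ℕ} (hn : 3 ≤ n) : 2 * n + 1 ≤ 2 ^ n := by
  induction n, hn using Nat.le_induction with
  | base => norm_num
  | succ n hn ih => rw [pow_succ]; omega

/-- The concrete reduction: a bound for the advantage of an adversary. -/
theorem hibeAdvantage_le {κ : Polynomial ℕ} (hκ : ∀ (n : ℕ) (r : Fin (2 ^ 𝒢.gen.coins.eval n)),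
    𝒢.gen.out n r (.num 3) ∈ 𝒢.good n →
      (𝒢.grp (𝒢.gen.out n r (.num 3))).p ^ digits L A n * 2 ^ n ≤ 2 ^ κ.eval n)
    {n N : ℕ} (hn : 3 ≤ n) (hN : 1 ≤ N) :
    hibeAdvantage 𝒢 H (L n) A n ≤ 1 / 2 * mdheAdvantage 𝒢 N (distinguisher hL hLb κ 𝒢 H A) n
      + 1 / 2 * ((((finder hL hLb κ 𝒢 H A false).run n (.num 0)).toOuterMeasure
          {v | H.IsCollision n v}).toReal
        + (((finder hL hLb κ 𝒢 H A true).run n (.num 0)).toOuterMeasure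
          {v | H.IsCollision n v}).toReal)
      + 4 * (1 / 2) ^ n + ((𝒢.gen.run n (.num 3)).toOuterMeasure (𝒢.good n)ᶜ).toReal := by
  classical
  set B := distinguisher hL hLb κ 𝒢 H A with hB
  let d : Fin (2 ^ 𝒢.gen.coins.eval n) → Val := fun r => 𝒢.gen.out n r (.num 3)
  let C : Bool → Fin (2 ^ 𝒢.gen.coins.eval n) → ℝ := fun real r =>
    𝔼 ρ : Fin (2 ^ A.coins.eval n), 𝔼 y : Fin (2 ^ κ.eval n),
      if H.IsCollision n (findIn 𝒢 H L A real n (d r) ρ y) then (1 : ℝ) else 0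
  have hC0 : ∀ real r, 0 ≤ C real r := fun real r => expect_nonneg' fun _ => expect_nonneg' fun _ => by
    split_ifs <;> simp
  have key : ∀ r, |(𝔼 ρ : Fin (2 ^ A.coins.eval n), deviation 𝒢 H L A n ρ (d r))
      - 1 / 2 * (mdheProb 𝒢 N B n (d r) true - mdheProb 𝒢 N B n (d r) false)|
      ≤ 1 / 2 * (C false r + C true r) + 4 * (1 / 2) ^ n + if d r ∈ (𝒢.good n)ᶜ then 1 else 0 := by
    intro r
    have hpow : (0 : ℝ) < (1 / 2) ^ n := by positivity
    by_cases hd : d r ∈ 𝒢.good n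
    · have hlt := 𝒢.lt_order n _ hd
      have h2n := two_mul_add_one_le_two_pow hn
      have hp : 2 * n + 1 < (𝒢.grp (d r)).p := by omega
      have hp3 : 3 ≤ (𝒢.grp (d r)).p := by omega
      have hinv : (1 : ℝ) / (𝒢.grp (d r)).p ≤ (1 / 2) ^ n := by
        rw [one_div_pow]
        exact one_div_le_one_div_of_le (by positivity) (by exact_mod_cast hlt.le)
      have h1 := abs_expect_sub_le fun ρ : Fin (2 ^ A.coins.eval n) =>
        abs_deviation_sub_le (𝒢 := 𝒢) (H := H) (L := L) (A := A) (n := n) (ρ := ρ) (d := d r)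
      have h2 : ∀ real, 𝔼 ρ : Fin (2 ^ A.coins.eval n), avgCollision 𝒢 H L A n ρ (d r) real
          ≤ C real r + (1 / 2) ^ n := fun real => by
        have := expect_mono fun ρ : Fin (2 ^ A.coins.eval n) =>
          avgCollision_le (H := H) κ hd hp hp3 (hκ n r hd) ρ real
        rwa [Finset.expect_add_distrib, Fintype.expect_const, ← one_div_pow] at this
      have h3 := abs_mdheProb_sub_le (H := H) hL hLb κ hd hp hp3 (hκ n r hd) hN true
      have h4 := abs_mdheProb_sub_le (H := H) hL hLb κ hd hp hp3 (hκ n r hd) hN false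
      simp only [Finset.expect_add_distrib, ← Finset.mul_expect, Finset.expect_sub_distrib,
        Fintype.expect_const] at h1
      rw [← one_div_pow] at h3 h4
      rw [if_neg (by simpa using hd), add_zero]
      rw [abs_le] at h1 h3 h4 ⊢
      -- The constant `4`: one `2^(-n)` from sampling in the two finders, weighted by `1/2` each;
      -- one from `a = 0` in the simulation; and two from the distinguisher, whose error is at most
      -- `2 * 2^(-n)` in each of the two cases, again weighted by `1/2`.
      constructor <;> linarith [h1.1, h1.2, h3.1, h3.2, h4.1, h4.2, h2 true, h2 false]
    -- For an improper group description each of the two compared numbers is at most `1/2` in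
    -- absolute value, so the indicator absorbs their difference.
    · rw [if_pos (by simpa using hd)]
      have h1 : |𝔼 ρ : Fin (2 ^ A.coins.eval n), deviation 𝒢 H L A n ρ (d r)| ≤ 1 / 2 := by
        refine (Finset.abs_expect_le _ _).trans ((expect_mono fun ρ => abs_deviation_le).trans_eq ?_)
        rw [Fintype.expect_const]
      have h2 : |mdheProb 𝒢 N B n (d r) true - mdheProb 𝒢 N B n (d r) false| ≤ 1 :=
        abs_sub_le_one mdheProb_nonneg mdheProb_le_one mdheProb_nonneg mdheProb_le_one
      rw [abs_le] at h1 h2 ⊢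
      constructor <;> linarith [h1.1, h1.2, h2.1, h2.2, hC0 true r, hC0 false r]
  have h := abs_expect_sub_le key
  rw [Finset.expect_comm, ← toReal_game_sub] at h
  simp only [Finset.expect_add_distrib, ← Finset.mul_expect, Finset.expect_sub_distrib,
    Fintype.expect_const] at h
  rw [hibeAdvantage, mdheAdvantage, toReal_mdheExperiment, toReal_mdheExperiment, toReal_finder,
    toReal_finder, PPT.run_eq_map, toReal_outerMeasure_map]
  have h3 := abs_sub_abs_le_abs_sub ((game 𝒢 H (L n) A n true).toReal - 1 / 2) (1 / 2 *
    ((𝔼 r, mdheProb 𝒢 N B n (d r) true) - 𝔼 r, mdheProb 𝒢 N B n (d r) false))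
  rw [abs_mul, abs_of_pos (show (0 : ℝ) < 1 / 2 by norm_num)] at h3
  linarith

end Security

end Sim

theorem Negligible.mono {f g : ℕ → ℝ} (hg : Negligible g) {n₀ : ℕ} (h : ∀ n ≥ n₀, |f n| ≤ g n) :
    Negligible f := by
  refine Asymptotics.SuperpolynomialDecay.trans_eventually_abs_le hg ?_
  filter_upwards [Filter.eventually_ge_atTop n₀] with n hn
  exact (h n hn).trans (le_abs_self _)

theorem Negligible.add {f g : ℕ → ℝ} (hf : Negligible f) (hg : Negligible g) :
    Negligible fun n => f n + g n :=
  Asymptotics.SuperpolynomialDecay.add hf hg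

theorem Negligible.const_mul {f : ℕ → ℝ} (hf : Negligible f) (c : ℝ) : Negligible fun n => c * f n :=
  Asymptotics.SuperpolynomialDecay.const_mul hf c

-- Exponential decay outweighs every power of `n`.
theorem negligible_half_pow : Negligible fun n => (1 / 2 : ℝ) ^ n := fun k =>
  tendsto_pow_const_mul_const_pow_of_abs_lt_one k (by rw [abs_of_pos] <;> norm_num)

/-- The modified Boneh–Boyen HIBE is selectively secure. -/
theorem selectivelySecure {𝒢 : GroupGenerator 3} {H : HashFunction} (hH : H.CollisionResistant)
    {L : ℕ → ℕ} (hL : PolyBounded L) (hLc : PolyComputable L) {N : ℕ → ℕ} (hN : ∀ n, 1 ≤ N n)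
    (hMDHE : MDHEAssumption 𝒢 N) : SelectivelySecure 𝒢 H L := by
  intro A
  have hLb := PB.of_polyBounded hL
  obtain ⟨κ, hκ⟩ := Sim.exists_coins 𝒢 A hLb
  have h := ((((hMDHE (Sim.distinguisher hLc.fn hLb κ 𝒢 H A)).const_mul (1 / 2)).add
    (((hH (Sim.finder hLc.fn hLb κ 𝒢 H A false)).add
      (hH (Sim.finder hLc.fn hLb κ 𝒢 H A true))).const_mul (1 / 2))).add
    (negligible_half_pow.const_mul 4)).add 𝒢.good_spec
  refine h.mono (n₀ := 3) fun n hn => ?_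
  rw [abs_of_nonneg (show 0 ≤ hibeAdvantage 𝒢 H (L n) A n from abs_nonneg _)]
  exact Sim.hibeAdvantage_le hLc.fn hLb hκ hn (hN n)

end BBHIBE

theorem mainTheorem3 (𝒢 : BBHIBE.GroupGenerator 3)
    (H : BBHIBE.HashFunction) (hH : H.CollisionResistant)
    (L : ℕ → ℕ) (hL : BBHIBE.PolyBounded L) (hLc : BBHIBE.PolyComputable L)
    (N : ℕ → ℕ) (hN : BBHIBE.PolyBounded N) (hN1 : ∀ n, 1 ≤ N n)
    (hMDHE : BBHIBE.MDHEAssumption 𝒢 N) :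
    BBHIBE.SelectivelySecure 𝒢 H L :=
  BBHIBE.selectivelySecure hH hL hLc hN1 hMDHE
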